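/- **Setting.** Consider $n$ players with finite state sets $S_i$ and action sets $A_i$, rewards $r_i:\prod_jS_j\times\prod_jA_j\to[0,1]$, transition matrices $P_i(s_i'|s_i,a_i)$ and an initial joint state $s^0$. At each time the players choose actions independently given the past, and then move independently, player $i$ according to $P_i$. For a profile $\pi=(\pi_1,\dots,\pi_n)$ of stationary policies $\pi_i(a_i|s_i)$ let $V_i(\pi)=\mathbb E[\lim_{T}\frac1T\sum_{t=0}^{T}r_i(s^t,a^t)]$; $\pi$ is an $\epsilon$-NE if for every $i$ and every stationary policy $\pi_i'$ of player $i$ we have $V_i(\pi)\ge V_i(\pi_i',\pi_{-i})-\epsilon$ (this includes that the limits exist almost surely). Assume that for some $\tau>0$ and all $i$, all stationary $\pi_i$ and all distributions $\nu,\nu'$ on $S_i$, the chain $P^{\pi_i}(s'|s)=\sum_aP_i(s'|s,a)\pi_i(a|s)$ satisfies $\|(\nu-\nu')P^{\pi_i}\|_1\le e^{-1/\tau}\|\nu-\nu'\|_1$. Let $\Delta_i$ be the set of $q_i\in[0,1]^{S_i\times A_i\times S_i}$ with $\sum q_i=1$ and $\sum_{s',a}q_i(s',a,s)=\sum_{a,s'}q_i(s,a,s')$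 for all $s$. Put $\rho^{q_i}(s,a)=\sum_{s'}q_i(s,a,s')$, $P^{q_i}(s'|s,a)=q_i(s,a,s')/\rho^{q_i}(s,a)$ and $\pi^{q_i}(a|s)=\rho^{q_i}(s,a)/\sum_{a'}\rho^{q_i}(s,a')$. Let $\Delta_i(P_i)$ be the set of $q_i\in\Delta_i$ with $q_i(s,a,s')=\rho^{q_i}(s,a)P_i(s'|s,a)$; for $\delta_i\in(0,1)$ let $\Delta_{i,\delta_i}=\{q_i\in\Delta_i:\rho^{q_i}\ge\delta_i\}$, and let $\Delta_{i,\delta_i}(P_i)$, $\Delta_{i,\delta_i}(\mathcal P)$ be its subsets given by $P^{q_i}=P_i$, $P^{q_i}\in\mathcal P$. The virtual payoffs are $V_i(q)=\sum_{s,a}\prod_j\rho^{q_j}(s_j,a_j)\,r_i(s,a)=\langle q_i,l_i(q_{-i})\rangle$ with $l_i(q_{-i})_{(s_i,a_i,s_i')}=\sum_{s_{-i},a_{-i}}\prod_{j\ne i}\rho^{q_j}(s_j,a_j)\,r_i(s,a)$. In the constrained virtual game $\mathcal V_\delta$ player $i$ chooses $q_i\in\Delta_{i,\delta_i}(P_i)$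 and has the payoff $V_i(q)$. **Algorithm.** Parameters: $\delta_i$; regularizers $h_i$, differentiable on $\Delta_{i,\delta_i}$ and $\mu$-strongly convex there for some $\mu>0$, with Bregman divergence $D_{h_i}$; stepsizes $\eta^k$; warm-up lengths $d^k$; radii $\epsilon_i^k$. Initially $\hat q_i^1\equiv 1/(|A_i||S_i|^2)$, all counters are $0$, and $\mathcal P_i^0$ is the set of all transition matrices. In episode $k=1,2,\dots$ (with time counted from $0$ inside the episode) player $i$ plays $\pi_i^k=\pi^{\hat q_i^k}$. The episode ends at the first time $\ge d^k$ at which every player has visited all its state-action pairs at some time $\ge d^k$ of this episode; $R_i^k(s_i,a_i,s_i')=R_i^k(s_i,a_i)$ is the reward that player $i$ received at its first visit of $(s_i,a_i)$ at a time $\ge d^k$ of this episode. With the total numbers $N_i^k(s_i,a_i)$, $M_i^k(s_i,a_i,s_i')$ of visits and transitions in the episodes $1,\dots,k$, let $B_i^k$ be the set of all $\hat P$ with $|\hat P(s_i'|s_i,a_i)-M_i^k(s_i,a_i,s_i')/\max(1,N_i^k(s_i,a_i))|\le\epsilon_i^k(s_i'|s_i,a_i)$ for all $s_i,a_i,s_i'$.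 Set $\mathcal P_i^k=B_i^k\cap\mathcal P_i^{k-1}$ and $$\hat q_i^{k+1}=\operatorname{argmax}_{\hat q_i\in\Delta_{i,\delta_i}(\mathcal P_i^k)}\{\eta^k\langle\hat q_i,R_i^k\rangle-D_{h_i}(\hat q_i\|\hat q_i^k)\}.$$ If $\Delta_{i,\delta_i}(B_i^k\cap\mathcal P_i^{k-1})=\emptyset$, so that this step has no feasible point, the old set is discarded and $\mathcal P_i^k=B_i^k$ is used; if $\Delta_{i,\delta_i}(B_i^k)=\emptyset$ too, then $\hat q_i^{k+1}=\hat q_i^k$. **Theorem.** Let $\epsilon>0$, and let the thresholds $\delta_i\in(0,1)$ satisfy $\max_{q_i'\in\Delta_{i,\delta_i}(P_i)}V_i(q_i',q_{-i})\ge\max_{q_i'\in\Delta_i(P_i)}V_i(q_i',q_{-i})-\epsilon$ for all $i$ and all $q\in\prod_j\Delta_j(P_j)$. Assume that $\mathcal V_\delta$ has a unique NE $q^*$, and that $\sum_i\langle l_i(q_{-i}),q_i^*-q_i\rangle\ge0$ for all $q\in\prod_i\Delta_{i,\delta_i}(P_i)$, with equality if and only if $q=q^*$. Let $(\eta^k)_{k\ge1}$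 be nonincreasing with $\sum_k\eta^k=\infty$, $\sum_k(\eta^k)^2<\infty$ and $\sum_k\eta^k\sqrt{\ln k/k}<\infty$. Let $\gamma\in(0,1)$, $d^k=2\tau\ln k$ and $\epsilon_i^k(s_i'|s_i,a_i)=\sqrt{\frac{\ln(2nk^2|A_i||S_i|^2)-\ln\gamma}{2\max(1,N_i^k(s_i,a_i))}}$. If all players follow the algorithm, then with probability at least $1-\gamma$ all episodes are finite and $\lim_{k\to\infty}\pi^k=\pi^*$, where $\pi^*=(\pi^{q_i^*})_i$ is an $\epsilon$-NE of the stochastic game. -/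

import Mathlib

open Filter Topology MeasureTheory

noncomputable section

namespace LearnGame

/-! Single-player objects: transition matrices, stationary policies, occupancy measures. -/

section SinglePlayer

variable {S A : Type*} [Fintype S] [Fintype A]

/-- `P s a s'` is the probability of moving from `s` to `s'` under the action `a`. -/
def IsTransition (P : S → A → S → ℝ) : Prop :=
  ∀ s a, (∀ s', 0 ≤ P s a s') ∧ ∑ s', P s a s' = 1

/-- `π s a` is the probability of choosing the action `a` in the state `s`. -/
def IsStationaryPolicy (π : S → A → ℝ) : Prop :=
  ∀ s, (∀ a, 0 ≤ π s a) ∧ ∑ a, π s a = 1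

/-- Probability vectors on the states. -/
def IsDistribution (ν : S → ℝ) : Prop :=
  (∀ s, 0 ≤ ν s) ∧ ∑ s, ν s = 1

/-- State transition matrix of the chain induced by `P` and the stationary policy `π`. -/
def inducedChain (P : S → A → S → ℝ) (π : S → A → ℝ) (s s' : S) : ℝ :=
  ∑ a, P s a s' * π s a

/-- The state-action marginal `ρ` of `q`. -/
def rho (q : S → A → S → ℝ) (s : S) (a : A) : ℝ := ∑ s', q s a s'

/-- The polytope `Δ` of feasible occupancy measures. -/
def occPolytope : Set (S → A → S → ℝ) :=
  {q | (∀ s a s', 0 ≤ q s a s' ∧ q s a s' ≤ 1) ∧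
    ∑ s, ∑ a, ∑ s', q s a s' = 1 ∧
    ∀ s, ∑ s', ∑ a, q s' a s = ∑ a, ∑ s', q s a s'}

/-- The stationary policy `π^q` induced by `q`. -/
def inducedPolicy (q : S → A → S → ℝ) (s : S) (a : A) : ℝ :=
  (∑ s', q s a s') / ∑ a', ∑ s', q s a' s'

/-- The transition matrix `P^q` induced by `q`. -/
def inducedTransition (q : S → A → S → ℝ) (s : S) (a : A) (s' : S) : ℝ :=
  q s a s' / ∑ s'', q s a s''

/-- `Δ(P)`: the feasible occupancy measures whose induced transition matrix is `P`, with the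
condition written without division because some `ρ(s,a)` may vanish. -/
def occPolytopeOf (P : S → A → S → ℝ) : Set (S → A → S → ℝ) :=
  {q | q ∈ occPolytope ∧ ∀ s a s', q s a s' = rho q s a * P s a s'}

/-- The shrunk polytope `Δ_δ`. -/
def shrunk (δ : ℝ) : Set (S → A → S → ℝ) :=
  {q | q ∈ occPolytope ∧ ∀ s a, δ ≤ rho q s a}

/-- `Δ_δ(P)`. -/
def shrunkOf (δ : ℝ) (P : S → A → S → ℝ) : Set (S → A → S → ℝ) :=
  {q | q ∈ shrunk δ ∧ inducedTransition q = P}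

/-- `Δ_δ(PP)` for a set `PP` of transition matrices. -/
def shrunkIn (δ : ℝ) (PP : Set (S → A → S → ℝ)) : Set (S → A → S → ℝ) :=
  {q | q ∈ shrunk δ ∧ inducedTransition q ∈ PP}

/-- The Bregman divergence `D_h(p‖q)` of `h : D → ℝ`. For `p, q` in a convex set `D` on which `h`
is differentiable, `p - q` is a tangent direction of `D` at `q`, so that the derivative of `h`
within `D` is determined on it. -/
def bregman (h : (S → A → S → ℝ) → ℝ) (D : Set (S → A → S → ℝ)) (p q : S → A → S → ℝ) : ℝ :=
  h p - h q - fderivWithin ℝ h D q (p - q)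

/-! One player of the learning algorithm. -/

/-- The data that a player stores. -/
structure PlayerState (S A : Type*) where
  /-- the current occupancy measure `q̂^k` -/
  qhat : S → A → S → ℝ
  /-- the confidence set computed at the end of the previous episode -/
  confSet : Set (S → A → S → ℝ)
  /-- the counters `M(s,a,s')`, over all episodes -/
  count : S → A → S → ℕ
  /-- the reward vector `R^k` of the current episode -/
  R : S → A → ℝ
  /-- the state-action pairs not yet visited in the sampling phase of the current episode -/
  todo : Set (S × A)

/-- Initially `q̂^1` is uniform, the counters vanish and nothing is known about the transitions. -/
def PlayerState.init : PlayerState S A where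
  qhat := fun _ _ _ => 1 / ((Fintype.card A : ℝ) * (Fintype.card S : ℝ) ^ 2)
  confSet := {P | IsTransition P}
  count := fun _ _ _ => 0
  R := fun _ _ => 0
  todo := Set.univ

open Classical in
/-- One step: the player was in `s`, played `a`, received `rew` and moved to `s'`. The counter is
always updated; the reward is recorded only in the sampling phase (`sampling`) and only at the
first visit of `(s, a)` in it. -/
def PlayerState.observe (p : PlayerState S A) (sampling : Prop) (s : S) (a : A) (s' : S)
    (rew : ℝ) : PlayerState S A where
  qhat := p.qhat
  confSet := p.confSet
  count := fun x b y => p.count x b y + if x = s ∧ b = a ∧ y = s' then 1 else 0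
  R := fun x b => p.R x b + if sampling ∧ (s, a) ∈ p.todo ∧ x = s ∧ b = a then rew else 0
  todo := if sampling then p.todo \ {(s, a)} else p.todo

/-- The matrices that are close to the empirical one, `M(s,a,s') / max(1, N(s,a))`; the radius is
a function of the number of visits `N(s,a)`. -/
def confBox (count : S → A → S → ℕ) (rad : ℕ → ℝ) : Set (S → A → S → ℝ) :=
  {Q | ∀ s a s',
    |Q s a s' - (count s a s' : ℝ) / max 1 ((∑ y, count s a y : ℕ) : ℝ)|
      ≤ rad (∑ y, count s a y)}

open Classical in
/-- The new confidence set: the intersection of the new box with the previous set. If no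
occupancy measure is compatible with that intersection, so that the mirror descent step would
have no feasible point, the previous set is discarded. -/
def confUpdate (δ : ℝ) (box old : Set (S → A → S → ℝ)) : Set (S → A → S → ℝ) :=
  if (shrunkIn δ (box ∩ old)).Nonempty then box ∩ old else box

/-- The objective of the mirror descent step. -/
def omdObjective (δ : ℝ) (h : (S → A → S → ℝ) → ℝ) (η : ℝ) (R : S → A → ℝ)
    (q p : S → A → S → ℝ) : ℝ :=
  η * (∑ s, ∑ a, ∑ s', p s a s' * R s a) - bregman h (shrunk δ) p q

open Classical in
/-- The mirror descent step: the maximizer of the objective over `Δ_δ(PP)`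
(and no change if there is none). -/
def omdUpdate (δ : ℝ) (h : (S → A → S → ℝ) → ℝ) (η : ℝ) (PP : Set (S → A → S → ℝ))
    (R : S → A → ℝ) (q : S → A → S → ℝ) : S → A → S → ℝ :=
  if H : ∃ p ∈ shrunkIn δ PP, IsMaxOn (omdObjective δ h η R q) (shrunkIn δ PP) p
  then H.choose else q

/-- What a player does at the end of an episode. -/
def PlayerState.endEpisode (p : PlayerState S A) (δ : ℝ) (h : (S → A → S → ℝ) → ℝ) (η : ℝ)
    (rad : ℕ → ℝ) : PlayerState S A where
  qhat := omdUpdate δ h η (confUpdate δ (confBox p.count rad) p.confSet) p.R p.qhat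
  confSet := confUpdate δ (confBox p.count rad) p.confSet
  count := p.count
  R := fun _ _ => 0
  todo := Set.univ

end SinglePlayer

/-! The stochastic game. -/

/-- An `n`-player stochastic game with independent transitions. -/
structure Game (n : ℕ) (S A : Fin n → Type*) [∀ i, Fintype (S i)] [∀ i, Fintype (A i)] where
  /-- rewards -/
  r : Fin n → (∀ j, S j) → (∀ j, A j) → ℝ
  /-- transition matrices of the players -/
  P : ∀ i, S i → A i → S i → ℝ
  /-- the initial state -/
  s0 : ∀ j, S j
  r_mem : ∀ i s a, r i s a ∈ Set.Icc (0 : ℝ) 1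
  P_isTransition : ∀ i, IsTransition (P i)

section MultiPlayer

variable {n : ℕ} {S A : Fin n → Type*} [∀ i, Fintype (S i)] [∀ i, Fintype (A i)]

open Classical in
/-- Probability of the state-action path `x 0, …, x t` when at every time `l` the players choose
their actions independently, player `i` from `pol x l i ((x l).1 i)`, and then move independently
according to their matrices. Here `pol x l` may depend on the states and actions before the time
`l` and on the state at the time `l`. -/
def Game.pathProb (G : Game n S A)
    (pol : (ℕ → (∀ i, S i) × (∀ i, A i)) → ℕ → ∀ i, S i → A i → ℝ)
    (x : ℕ → (∀ i, S i) × (∀ i, A i)) (t : ℕ) : ℝ :=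
  (if (x 0).1 = G.s0 then 1 else 0) *
    (∏ l ∈ Finset.range (t + 1), ∏ i, pol x l i ((x l).1 i) ((x l).2 i)) *
    ∏ l ∈ Finset.range t, ∏ i, G.P i ((x l).1 i) ((x l).2 i) ((x (l + 1)).1 i)

/-- `X` is the process of joint states and actions when the game is played with `pol`. -/
structure Game.IsPlay (G : Game n S A)
    (pol : (ℕ → (∀ i, S i) × (∀ i, A i)) → ℕ → ∀ i, S i → A i → ℝ)
    {Ω : Type*} [MeasurableSpace Ω] (μ : Measure Ω)
    (X : ℕ → Ω → (∀ i, S i) × (∀ i, A i)) : Prop where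
  meas : ∀ t z, MeasurableSet {ω | X t ω = z}
  law : ∀ (t : ℕ) (x : ℕ → (∀ i, S i) × (∀ i, A i)),
    μ {ω | ∀ l ≤ t, X l ω = x l} = ENNReal.ofReal (G.pathProb pol x t)

/-- The product σ-algebra on the space of infinite paths. -/
@[reducible] def pathSpace (S A : Fin n → Type*) : MeasurableSpace (ℕ → (∀ i, S i) × (∀ i, A i)) :=
  ⨆ t : ℕ, MeasurableSpace.comap (fun x => x t) ⊤

/-- `v` is the payoff `V_i(π) = 𝔼[lim_T (1/T) ∑_{t ≤ T} r_i(s^t, a^t)]` of player `i` under the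
stationary policies `π`; the existence of the limit with probability one is part of it. -/
def Game.HasPayoff (G : Game n S A) (π : ∀ i, S i → A i → ℝ) (i : Fin n) (v : ℝ) : Prop :=
  letI : MeasurableSpace (ℕ → (∀ i, S i) × (∀ i, A i)) := pathSpace S A
  ∃ μ : Measure (ℕ → (∀ i, S i) × (∀ i, A i)),
    IsProbabilityMeasure μ ∧ G.IsPlay (fun _ _ => π) μ (fun t x => x t) ∧
    ∃ V : (ℕ → (∀ i, S i) × (∀ i, A i)) → ℝ,
      (∀ᵐ x ∂μ, Tendsto
        (fun T : ℕ => (1 / (T : ℝ)) * ∑ t ∈ Finset.range (T + 1), G.r i (x t).1 (x t).2)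
        atTop (𝓝 (V x))) ∧
      Integrable V μ ∧ ∫ x, V x ∂μ = v

/-- `π` is an `ε`-Nash equilibrium (in stationary policies) of the stochastic game. -/
def Game.IsEpsNash (G : Game n S A) (ε : ℝ) (π : ∀ i, S i → A i → ℝ) : Prop :=
  (∀ i, IsStationaryPolicy (π i)) ∧
  ∀ i, ∃ v, G.HasPayoff π i v ∧
    ∀ π' : S i → A i → ℝ, IsStationaryPolicy π' →
      ∃ v', G.HasPayoff (Function.update π i π') i v' ∧ v' - ε ≤ v

/-- Uniform ergodicity: every chain induced by a stationary policy contracts the `ℓ¹` distance of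
distributions by `e^{-1/τ}` (so it converges geometrically to a unique stationary
distribution). -/
def Game.UniformlyMixing (G : Game n S A) (τ : ℝ) : Prop :=
  ∀ (i : Fin n) (π : S i → A i → ℝ), IsStationaryPolicy π →
    ∀ ν ν' : S i → ℝ, IsDistribution ν → IsDistribution ν' →
      ∑ s', |∑ s, (ν s - ν' s) * inducedChain (G.P i) π s s'| ≤
        Real.exp (-1 / τ) * ∑ s, |ν s - ν' s|

/-! The virtual game. -/

/-- The payoff `V_i(q)` in the virtual game. -/
def Game.virtualPayoff (G : Game n S A) (i : Fin n) (q : ∀ j, S j → A j → S j → ℝ) : ℝ :=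
  ∑ s : ∀ j, S j, ∑ a : ∀ j, A j, (∏ j, ∑ s', q j (s j) (a j) s') * G.r i s a

open Classical in
/-- The payoff gradient `l_i(q_{-i})`; its `(s_i, a_i, s_i')` coordinate does not depend
on `s_i'`. -/
def Game.payoffGrad (G : Game n S A) (i : Fin n) (q : ∀ j, S j → A j → S j → ℝ)
    (si : S i) (ai : A i) (_si' : S i) : ℝ :=
  ∑ s : ∀ j, S j, ∑ a : ∀ j, A j,
    if s i = si ∧ a i = ai then
      (∏ j ∈ Finset.univ.erase i, ∑ s', q j (s j) (a j) s') * G.r i s a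
    else 0

/-- Nash equilibria of the constrained virtual game `𝒱_δ`, in which player `i` chooses a point
of `Δ_{i,δ_i}(P_i)`. -/
def Game.IsConstrainedNash (G : Game n S A) (δ : Fin n → ℝ)
    (q : ∀ j, S j → A j → S j → ℝ) : Prop :=
  (∀ i, q i ∈ shrunkOf (δ i) (G.P i)) ∧
  ∀ i, ∀ p ∈ shrunkOf (δ i) (G.P i),
    G.virtualPayoff i (Function.update q i p) ≤ G.virtualPayoff i q

/-- `qs` is the unique Nash equilibrium of `𝒱_δ`, and it is globally (variationally) stable. -/
def Game.IsGloballyStableNash (G : Game n S A) (δ : Fin n → ℝ)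
    (qs : ∀ j, S j → A j → S j → ℝ) : Prop :=
  G.IsConstrainedNash δ qs ∧ (∀ q, G.IsConstrainedNash δ q → q = qs) ∧
  ∀ q : ∀ j, S j → A j → S j → ℝ, (∀ j, q j ∈ shrunkOf (δ j) (G.P j)) →
    0 ≤ ∑ i, ∑ s, ∑ a, ∑ s', G.payoffGrad i q s a s' * (qs i s a s' - q i s a s') ∧
    (∑ i, ∑ s, ∑ a, ∑ s', G.payoffGrad i q s a s' * (qs i s a s' - q i s a s') = 0 ↔ q = qs)

/-- The thresholds `δ` cost at most `ε`: against any occupancy measures of the others, the best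
point of `Δ_{i,δ_i}(P_i)` is within `ε` of the best point of `Δ_i(P_i)`. -/
def Game.ShrunkLoss (G : Game n S A) (ε : ℝ) (δ : Fin n → ℝ) : Prop :=
  ∀ (i : Fin n) (q : ∀ j, S j → A j → S j → ℝ), (∀ j, q j ∈ occPolytopeOf (G.P j)) →
    ∀ p ∈ occPolytopeOf (G.P i), ∃ p' ∈ shrunkOf (δ i) (G.P i),
      G.virtualPayoff i (Function.update q i p) - ε ≤
        G.virtualPayoff i (Function.update q i p')

/-! The learning algorithm. -/

/-- The parameters of the algorithm. -/
structure AlgParams (n : ℕ) (S A : Fin n → Type*) where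
  /-- thresholds of the shrunk polytopes -/
  δ : Fin n → ℝ
  /-- regularizers -/
  h : ∀ i, (S i → A i → S i → ℝ) → ℝ
  /-- step size of the episode `k` -/
  η : ℕ → ℝ
  /-- length of the warm-up phase of the episode `k` -/
  d : ℕ → ℝ
  /-- confidence radius of player `i` at the end of the episode `k`, as a function of the number
  of visits -/
  rad : Fin n → ℕ → ℕ → ℝ

/-- The state of the whole system of learners. -/
structure AlgState (n : ℕ) (S A : Fin n → Type*) where
  /-- the current episode, starting with `1` -/
  episode : ℕ
  /-- the step within the current episode, starting with `0` -/
  clock : ℕ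
  /-- the data of the players -/
  player : ∀ i, PlayerState (S i) (A i)

/-- The state at the beginning. -/
def AlgState.init : AlgState n S A where
  episode := 1
  clock := 0
  player := fun _ => PlayerState.init

open Classical in
/-- One step of the algorithm, from the joint state `s` with the joint action `a` to `s'`. The
episode ends as soon as the warm-up is over and every player has visited all its state-action
pairs since then. -/
def Game.algStep (G : Game n S A) (θ : AlgParams n S A) (σ : AlgState n S A)
    (s : ∀ i, S i) (a : ∀ i, A i) (s' : ∀ i, S i) : AlgState n S A :=
  let sampling : Prop := θ.d σ.episode ≤ (σ.clock : ℝ)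
  let pl : ∀ i, PlayerState (S i) (A i) := fun i =>
    (σ.player i).observe sampling (s i) (a i) (s' i) (G.r i s a)
  if sampling ∧ ∀ i, (pl i).todo = ∅ then
    { episode := σ.episode + 1
      clock := 0
      player := fun i =>
        (pl i).endEpisode (θ.δ i) (θ.h i) (θ.η σ.episode) (θ.rad i σ.episode) }
  else
    { episode := σ.episode
      clock := σ.clock + 1
      player := pl }

/-- The state of the algorithm at the time `t` along the path `x`; it depends on the states and
actions before the time `t` and on the state at the time `t`. -/
def Game.algState (G : Game n S A) (θ : AlgParams n S A)
    (x : ℕ → (∀ i, S i) × (∀ i, A i)) : ℕ → AlgState n S A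
  | 0 => AlgState.init
  | t + 1 => G.algStep θ (G.algState θ x t) (x t).1 (x t).2 (x (t + 1)).1

/-- The policies that the algorithm prescribes at the time `t` along the path `x`. -/
def Game.algPolicy (G : Game n S A) (θ : AlgParams n S A)
    (x : ℕ → (∀ i, S i) × (∀ i, A i)) (t : ℕ) (i : Fin n) : S i → A i → ℝ :=
  inducedPolicy (((G.algState θ x t).player i).qhat)

/-- The policies `π^k` of the episode `k` along the path `x`: those at its first time. -/
def Game.episodePolicy (G : Game n S A) (θ : AlgParams n S A)
    (x : ℕ → (∀ i, S i) × (∀ i, A i)) (k : ℕ) : ∀ i, S i → A i → ℝ :=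
  G.algPolicy θ x (sInf {t | (G.algState θ x t).episode = k})

end MultiPlayer

end LearnGame

end

/-!
The algorithm converges almost surely, whatever `γ` is: since an infeasible confidence set is
discarded, a wrong one does not last. The convergence is that of mirror descent with three
perturbations: the confidence sets differ from the true transition matrices, the rewards recorded in
an episode are biased, and they are noisy. Weighted with the step sizes, the first two are summable
and the noise is a convergent martingale.

*Episodes.* All policies choose every action with a probability bounded below, and an occupancy
measure of the true matrix witnesses, by the contraction of the chains, that every state can be
reached; hence every pair is visited within a fixed number of steps with a probability bounded below
(`exists_survive_le`). So the waiting times have geometric tails, all episodes are finite, and the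
first `k` of them take at most `k ^ (4/3)` steps for large `k` (`Game.IsPlay.ae_episodes`).

*Confidence sets.* By an exponential supermartingale and the Borel-Cantelli lemma, the empirical
frequencies after `N` visits deviate from the truth by at most `√(3/4 * log N / N)`
(`Game.IsPlay.ae_deviation_le`). The polynomial length of the episodes makes this smaller than the
radius, so the boxes eventually contain the true matrices (`Game.eventually_mem_confBox`). The
confidence sets then contain them as well (`Game.eventually_mem_confSet`): either an old set is
discarded at a late time, or the sets decrease with feasible points all the time, and by compactness
they have a common point, which is compatible with the true matrices only. From then on the iterates
satisfy the constraints of the true polytopes up to `O(√(log k / k))`, and Hoffman's bound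
(`exists_errorBound`) turns this into their distance from these polytopes.

*Bias and noise.* The reward recorded for a pair is that of its first visit after the warm-up. After
`2 τ log k` steps the chains are `k⁻²`-close to stationarity, so that its expectation is the payoff
gradient up to `O(k⁻² + √(log k / k))` (`Game.exists_value_estimate`). The differences from the
expectations, weighted with the step sizes, form a martingale which is bounded in `L²` because `∑ (η
k) ^ 2 < ∞`, and hence converges (`Game.IsPlay.ae_exists_tendsto_noise`).

*Mirror descent.* The Bregman divergence from the equilibrium decreases in each step by `η k` times
the variational gap, up to these perturbations (`bregman_omdUpdate_le`). A quasi-Fejér argument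
(`quasiFejer`) shows that the divergence converges and that the gap is arbitrarily small infinitely
often; by uniqueness of the zero of the gap the iterates then come close to the equilibrium, and the
divergence tends to `0` (`Game.IsGloballyStableNash.tendsto_of_recursion`). The last step needs that
`D(q* ‖ q)` is small for `q` close to `q*`. As no continuity of the gradient of the regularizer is
assumed, this is deduced from convexity and the polyhedral shape of the domain (`bregman_small`).

*The equilibrium.* Under stationary policies the average rewards converge almost surely to the
virtual payoff of the occupancy measures. This is the ergodic theorem, proved with the Poisson
equation and a martingale (`Game.IsPlay.ae_tendsto_average`, `Game.hasPayoff_virtualPayoff`). Every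
deviation of a player has an occupancy measure, so that the loss from the thresholds is at most `ε`
(`Game.IsConstrainedNash.isEpsNash`).
-/

open Filter Topology MeasureTheory

noncomputable section

namespace LearnGame

/-! ### Error bounds for systems of linear inequalities -/

section ErrorBound

variable {E : Type*} [NormedAddCommGroup E] {ι : Type*}

/-- A unit vector `u` in the polar of the cone `{v | ∀ j ∈ I, a j v ≤ 0}` violates one of the
inequalities that define the cone, since otherwise `⟪u, u⟫ ≤ 0`; by compactness of the set of these
vectors it does so by an amount that does not depend on `u`. -/
theorem exists_pos_le_of_polar [InnerProductSpace ℝ E] [FiniteDimensional ℝ E]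
    (a : ι → E →L[ℝ] ℝ) (I : Set ι) :
    ∃ c : ℝ, 0 < c ∧ ∀ u : E, ‖u‖ = 1 →
      (∀ v, (∀ j ∈ I, a j v ≤ 0) → inner ℝ u v ≤ 0) → ∃ j ∈ I, c ≤ a j u := by
  set K : Set E := Metric.sphere 0 1 ∩ {u | ∀ v, (∀ j ∈ I, a j v ≤ 0) → inner ℝ u v ≤ 0}
  have hK : IsCompact K := by
    refine (isCompact_sphere 0 1).inter_right ?_
    simp only [Set.ofPred_forall]
    refine isClosed_iInter fun v => isClosed_iInter fun _ => ?_
    exact isClosed_le (by fun_prop) continuous_const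
  set V : ℕ → Set E := fun n => {u | ∃ j ∈ I, 1 / ((n : ℝ) + 1) < a j u}
  have hVo : ∀ n, IsOpen (V n) := by
    intro n
    have : V n = ⋃ j ∈ I, {u | 1 / ((n : ℝ) + 1) < a j u} := by
      ext u; simp [V]
    rw [this]
    exact isOpen_biUnion fun j _ => isOpen_lt continuous_const (a j).continuous
  have hcov : K ⊆ ⋃ n, V n := by
    rintro u ⟨hu1, hu⟩
    have hu1 : ‖u‖ = 1 := by simpa using hu1
    have : ∃ j ∈ I, 0 < a j u := by
      by_contra! hcon
      have h0 := hu u hcon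
      rw [real_inner_self_eq_norm_sq, hu1] at h0
      norm_num at h0
    obtain ⟨j, hj, hpos⟩ := this
    obtain ⟨n, hn⟩ := exists_nat_one_div_lt hpos
    exact Set.mem_iUnion.2 ⟨n, j, hj, hn⟩
  have hdir : Directed (· ⊆ ·) V := by
    refine directed_of_isDirected_le ?_
    rintro p q hpq u ⟨j, hj, hu⟩
    exact ⟨j, hj, (Nat.one_div_le_one_div hpq).trans_lt hu⟩
  obtain ⟨n, hn⟩ := hK.elim_directed_cover V hVo hcov hdir
  refine ⟨1 / ((n : ℝ) + 1), Nat.one_div_pos_of_nat, fun u hu1 hu => ?_⟩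
  obtain ⟨j, hj, hlt⟩ := hn ⟨by simpa using hu1, hu⟩
  exact ⟨j, hj, hlt.le⟩

/-- Hoffman's error bound for a Euclidean norm: if `y` is the projection of `x` on the polyhedron,
then `x - y` lies in the polar of the cone of the constraints that are active at `y`. There are
only finitely many sets of active constraints. -/
theorem exists_errorBound_inner [Finite ι] [InnerProductSpace ℝ E] [FiniteDimensional ℝ E]
    (a : ι → E →L[ℝ] ℝ) (b : ι → ℝ) (hne : ∃ x, ∀ j, a j x ≤ b j) :
    ∃ C : ℝ, 0 ≤ C ∧ ∀ x r, 0 ≤ r → (∀ j, a j x ≤ b j + r) →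
      ∃ y, (∀ j, a j y ≤ b j) ∧ ‖x - y‖ ≤ C * r := by
  choose c hc0 hc using exists_pos_le_of_polar a
  obtain ⟨I₀, hI₀⟩ := Finite.exists_min c
  refine ⟨(c I₀)⁻¹, (inv_pos.2 (hc0 I₀)).le, fun x r hr hx => ?_⟩
  set Q : Set E := {x | ∀ j, a j x ≤ b j}
  have hQc : IsClosed Q := by
    simp only [Q, Set.ofPred_forall]
    exact isClosed_iInter fun j => isClosed_le (a j).continuous continuous_const
  have hQconv : Convex ℝ Q := by
    intro p hp q hq s t hs ht hst j
    simp only [map_add, map_smul, smul_eq_mul]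
    calc s * a j p + t * a j q ≤ s * b j + t * b j := by
          gcongr
          · exact hp j
          · exact hq j
      _ = b j := by rw [← add_mul, hst, one_mul]
  have hQne : Q.Nonempty := hne
  obtain ⟨y, hyQ, hy⟩ := exists_norm_eq_iInf_of_complete_convex hQne hQc.isComplete hQconv x
  rw [norm_eq_iInf_iff_real_inner_le_zero hQconv hyQ] at hy
  refine ⟨y, hyQ, ?_⟩
  rcases eq_or_ne x y with rfl | hxy
  · simpa using mul_nonneg (inv_pos.2 (hc0 I₀)).le hr
  have hpos : 0 < ‖x - y‖ := norm_pos_iff.2 (sub_ne_zero.2 hxy)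
  set I : Set ι := {j | a j y = b j}
  obtain ⟨j, hj, hcj⟩ := hc I (‖x - y‖⁻¹ • (x - y)) (by
      rw [norm_smul, norm_inv, norm_norm, inv_mul_cancel₀ hpos.ne']) (by
    intro v hv
    -- a small step from `y` in a direction of the cone stays in the polyhedron
    have hev : ∀ᶠ t in 𝓝[>] (0 : ℝ), y + t • v ∈ Q := by
      refine eventually_all.2 fun j => ?_
      by_cases hj : j ∈ I
      · filter_upwards [self_mem_nhdsWithin] with t ht
        have : a j y = b j := hj
        simp only [map_add, map_smul, smul_eq_mul, this]
        nlinarith [hv j hj, show 0 < t from ht]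
      · have hlt : a j y < b j := lt_of_le_of_ne (hyQ j) hj
        have hcont : Tendsto (fun t : ℝ => a j (y + t • v)) (𝓝 0) (𝓝 (a j y)) := by
          have : Continuous fun t : ℝ => a j (y + t • v) := by fun_prop
          simpa using this.tendsto 0
        have hlt' := (hcont.eventually (gt_mem_nhds hlt)).filter_mono
          (nhdsWithin_le_nhds (s := Set.Ioi 0))
        filter_upwards [hlt'] with t ht using le_of_lt ht
    obtain ⟨t, ht, ht0⟩ := (hev.and self_mem_nhdsWithin).exists
    have h1 := hy _ ht
    rw [add_sub_cancel_left, inner_smul_right] at h1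
    have ht0 : 0 < t := ht0
    have h2 : inner ℝ (x - y) v ≤ 0 := by
      by_contra! h
      exact absurd h1 (not_le.2 (mul_pos ht0 h))
    rw [real_inner_smul_left]
    exact mul_nonpos_of_nonneg_of_nonpos (inv_pos.2 hpos).le h2)
  have hj : a j y = b j := hj
  have h3 : c I₀ ≤ ‖x - y‖⁻¹ * a j (x - y) := by
    simpa using (hI₀ I).trans hcj
  have h4 : a j (x - y) ≤ r := by
    have := hx j
    rw [map_sub, hj]; linarith
  rw [inv_mul_eq_div, le_div_iff₀ (hc0 I₀)]
  rw [inv_mul_eq_div, le_div_iff₀ hpos] at h3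
  linarith

/-- **Hoffman's error bound.** A point that violates finitely many linear inequalities by at most
`r` lies within `C * r` of the polyhedron that they define. -/
theorem exists_errorBound [Finite ι] [NormedSpace ℝ E] [FiniteDimensional ℝ E]
    (a : ι → E →L[ℝ] ℝ) (b : ι → ℝ) (hne : ∃ x, ∀ j, a j x ≤ b j) :
    ∃ C : ℝ, 0 ≤ C ∧ ∀ x r, 0 ≤ r → (∀ j, a j x ≤ b j + r) →
      ∃ y, (∀ j, a j y ≤ b j) ∧ ‖x - y‖ ≤ C * r := by
  set e : E ≃L[ℝ] EuclideanSpace ℝ (Fin (Module.finrank ℝ E)) := toEuclidean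
  obtain ⟨C, hC0, hC⟩ := exists_errorBound_inner
    (fun j => (a j).comp e.symm.toContinuousLinearMap) b (by
      obtain ⟨x, hx⟩ := hne
      exact ⟨e x, fun j => by simpa using hx j⟩)
  set e' : EuclideanSpace ℝ (Fin (Module.finrank ℝ E)) →L[ℝ] E :=
    e.symm.toContinuousLinearMap
  refine ⟨‖e'‖ * C, by positivity, fun x r hr hx => ?_⟩
  obtain ⟨y, hy, hxy⟩ := hC (e x) r hr (fun j => by simpa [e'] using hx j)
  refine ⟨e' y, fun j => hy j, ?_⟩
  calc ‖x - e' y‖ = ‖e' (e x - y)‖ := by simp [e']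
    _ ≤ ‖e'‖ * ‖e x - y‖ := e'.le_opNorm _
    _ ≤ ‖e'‖ * C * r := by rw [mul_assoc]; gcongr

end ErrorBound

/-! ### Products and perturbed monotone sequences -/

theorem abs_prod_sub_prod_le {ι : Type*} (s : Finset ι) (x y : ι → ℝ)
    (hx : ∀ j ∈ s, |x j| ≤ 1) (hy : ∀ j ∈ s, |y j| ≤ 1) :
    |∏ j ∈ s, x j - ∏ j ∈ s, y j| ≤ ∑ j ∈ s, |x j - y j| := by
  classical
  induction s using Finset.induction_on with
  | empty => simp
  | insert i s hi ih =>
    rw [Finset.prod_insert hi, Finset.prod_insert hi, Finset.sum_insert hi]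
    have ih := ih (fun j hj => hx j (Finset.mem_insert_of_mem hj))
      (fun j hj => hy j (Finset.mem_insert_of_mem hj))
    have h1 : |∏ j ∈ s, x j| ≤ 1 := by
      rw [Finset.abs_prod]
      exact Finset.prod_le_one (fun j _ => abs_nonneg _)
        (fun j hj => hx j (Finset.mem_insert_of_mem hj))
    have h2 := hy i (Finset.mem_insert_self i s)
    calc |x i * ∏ j ∈ s, x j - y i * ∏ j ∈ s, y j|
        = |(x i - y i) * ∏ j ∈ s, x j + y i * (∏ j ∈ s, x j - ∏ j ∈ s, y j)| := by ring_nf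
      _ ≤ |x i - y i| * |∏ j ∈ s, x j| + |y i| * |∏ j ∈ s, x j - ∏ j ∈ s, y j| := by
        rw [← abs_mul, ← abs_mul]; exact abs_add_le _ _
      _ ≤ |x i - y i| * 1 + 1 * ∑ j ∈ s, |x j - y j| := by gcongr
      _ = _ := by ring

/-- If `D` decreases by `η a` in every step, up to a convergent perturbation, then `D` converges;
if moreover `∑ η = ∞`, then `a` comes arbitrarily close to `0`. -/
theorem quasiFejer {D a z η : ℕ → ℝ} (hD : ∀ k, 0 ≤ D k) (ha : ∀ k, 0 ≤ a k)
    (hη : ∀ k, 0 ≤ η k)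
    (hrec : ∀ k, D (k + 1) ≤ D k - η k * a k + z k)
    (hz : ∃ l, Tendsto (fun K => ∑ k ∈ Finset.range K, z k) atTop (𝓝 l))
    (hsum : Tendsto (fun K => ∑ k ∈ Finset.range K, η k) atTop atTop) :
    (∃ l, Tendsto D atTop (𝓝 l)) ∧ ∀ ε > 0, ∃ᶠ k in atTop, a k < ε := by
  obtain ⟨l, hl⟩ := hz
  set Zs : ℕ → ℝ := fun K => ∑ k ∈ Finset.range K, z k
  set As : ℕ → ℝ := fun K => ∑ k ∈ Finset.range K, η k * a k
  have hAmono : Monotone As := by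
    refine monotone_nat_of_le_succ fun k => ?_
    simp only [As, Finset.sum_range_succ]
    nlinarith [mul_nonneg (hη k) (ha k)]
  set F : ℕ → ℝ := fun K => D K + As K - Zs K
  have hF : Antitone F := by
    refine antitone_nat_of_succ_le fun k => ?_
    simp only [F, As, Zs, Finset.sum_range_succ]
    linarith [hrec k]
  obtain ⟨B, hB⟩ := hl.bddAbove_range
  have hZB : ∀ K, Zs K ≤ B := fun K => hB ⟨K, rfl⟩
  have hAbd : ∀ K, As K ≤ F 0 + B := fun K => by
    have h1 : F K ≤ F 0 := hF (Nat.zero_le K)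
    have h2 : F K = D K + As K - Zs K := rfl
    linarith [hD K, hZB K]
  have hA := tendsto_atTop_ciSup hAmono ⟨F 0 + B, by rintro _ ⟨K, rfl⟩; exact hAbd K⟩
  have hA0 : ∀ K, 0 ≤ As K := fun K =>
    Finset.sum_nonneg fun k _ => mul_nonneg (hη k) (ha k)
  have hFl := tendsto_atTop_ciInf hF ⟨-B, by
    rintro _ ⟨K, rfl⟩
    change -B ≤ D K + As K - Zs K
    linarith [hD K, hZB K, hA0 K]⟩
  refine ⟨⟨_, ((hFl.sub hA).add hl).congr fun K => by simp only [F]; ring⟩, fun ε hε => ?_⟩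
  by_contra hcon
  rw [not_frequently, eventually_atTop] at hcon
  obtain ⟨K₀, hK₀⟩ := hcon
  have hbig : ∀ K ≥ K₀, ε * (∑ k ∈ Finset.range K, η k - ∑ k ∈ Finset.range K₀, η k) ≤ As K := by
    intro K hK
    induction K, hK using Nat.le_induction with
    | base => simpa using hA0 K₀
    | succ K hK ih =>
      simp only [As, Finset.sum_range_succ] at ih ⊢
      nlinarith [mul_le_mul_of_nonneg_left (not_lt.1 (hK₀ K hK)) (hη K)]
  have hev := (hsum.eventually_gt_atTop
    ((F 0 + B) / ε + ∑ k ∈ Finset.range K₀, η k)).and (eventually_ge_atTop K₀)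
  obtain ⟨K, hK1, hK2⟩ := hev.exists
  have h1 := (hbig K hK2).trans (hAbd K)
  have h2 : (F 0 + B) / ε < ∑ k ∈ Finset.range K, η k - ∑ k ∈ Finset.range K₀, η k := by linarith
  rw [div_lt_iff₀ hε] at h2
  linarith

/-! ### The shrunk polytope of occupancy measures -/

section SinglePlayer

variable {S A : Type*} [Fintype S] [Fintype A]

theorem rho_nonneg {q : S → A → S → ℝ} (hq : q ∈ occPolytope) (s : S) (a : A) : 0 ≤ rho q s a :=
  Finset.sum_nonneg fun s' _ => (hq.1 s a s').1

theorem rho_le_one {q : S → A → S → ℝ} (hq : q ∈ occPolytope) (s : S) (a : A) :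
    rho q s a ≤ 1 := by
  rw [← hq.2.1]
  refine le_trans ?_ (Finset.single_le_sum (f := fun s => ∑ a, ∑ s', q s a s')
    (fun s _ => Finset.sum_nonneg fun a _ => Finset.sum_nonneg fun s' _ => (hq.1 s a s').1)
    (Finset.mem_univ s))
  exact Finset.single_le_sum (f := fun a => ∑ s', q s a s')
    (fun a _ => Finset.sum_nonneg fun s' _ => (hq.1 s a s').1) (Finset.mem_univ a)

theorem sum_rho_le_one {q : S → A → S → ℝ} (hq : q ∈ occPolytope) (s : S) :
    ∑ a, rho q s a ≤ 1 := by
  rw [← hq.2.1]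
  exact Finset.single_le_sum (f := fun s => ∑ a, ∑ s', q s a s')
    (fun s _ => Finset.sum_nonneg fun a _ => Finset.sum_nonneg fun s' _ => (hq.1 s a s').1)
    (Finset.mem_univ s)

theorem mul_inducedTransition {δ : ℝ} (hδ : 0 < δ) {q : S → A → S → ℝ} (hq : q ∈ shrunk δ)
    (s : S) (a : A) (s' : S) : rho q s a * inducedTransition q s a s' = q s a s' := by
  have : rho q s a ≠ 0 := (hδ.trans_le (hq.2 s a)).ne'
  exact mul_div_cancel₀ _ this

theorem isTransition_inducedTransition {δ : ℝ} (hδ : 0 < δ) {q : S → A → S → ℝ}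
    (hq : q ∈ shrunk δ) : IsTransition (inducedTransition q) := by
  refine fun s a => ⟨fun s' => div_nonneg (hq.1.1 s a s').1 (rho_nonneg hq.1 s a), ?_⟩
  have : rho q s a ≠ 0 := (hδ.trans_le (hq.2 s a)).ne'
  simp only [inducedTransition, ← Finset.sum_div]
  exact div_self this

theorem sum_rho_pos {δ : ℝ} (hδ : 0 < δ) {q : S → A → S → ℝ} (hq : q ∈ shrunk δ) (s : S) :
    0 < ∑ a, rho q s a := by
  have hA : Nonempty A := by
    by_contra h
    rw [not_nonempty_iff] at h
    simpa using hq.1.2.1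
  exact Finset.sum_pos (fun a _ => hδ.trans_le (hq.2 s a)) Finset.univ_nonempty

theorem isStationaryPolicy_inducedPolicy {δ : ℝ} (hδ : 0 < δ) {q : S → A → S → ℝ}
    (hq : q ∈ shrunk δ) : IsStationaryPolicy (inducedPolicy q) := by
  refine fun s => ⟨fun a => div_nonneg (rho_nonneg hq.1 s a) (sum_rho_pos hδ hq s).le, ?_⟩
  simp only [inducedPolicy, ← Finset.sum_div]
  exact div_self (sum_rho_pos hδ hq s).ne'

theorem le_inducedPolicy {δ : ℝ} (hδ : 0 < δ) {q : S → A → S → ℝ} (hq : q ∈ shrunk δ)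
    (s : S) (a : A) : δ ≤ inducedPolicy q s a := by
  refine (hq.2 s a).trans ?_
  exact le_div_self (rho_nonneg hq.1 s a) (sum_rho_pos hδ hq s) (sum_rho_le_one hq.1 s)

theorem sum_mul_inducedPolicy {δ : ℝ} (hδ : 0 < δ) {q : S → A → S → ℝ} (hq : q ∈ shrunk δ)
    (s : S) (a : A) : (∑ a', rho q s a') * inducedPolicy q s a = rho q s a :=
  mul_div_cancel₀ _ (sum_rho_pos hδ hq s).ne'

theorem eq_rho_mul_of_mem_shrunkOf {δ : ℝ} (hδ : 0 < δ) {q P : S → A → S → ℝ}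
    (hq : q ∈ shrunkOf δ P) (s : S) (a : A) (s' : S) : q s a s' = rho q s a * P s a s' := by
  rw [← hq.2, mul_inducedTransition hδ hq.1]

theorem mem_occPolytopeOf_of_mem_shrunkOf {δ : ℝ} (hδ : 0 < δ) {q P : S → A → S → ℝ}
    (hq : q ∈ shrunkOf δ P) : q ∈ occPolytopeOf P :=
  ⟨hq.1.1, eq_rho_mul_of_mem_shrunkOf hδ hq⟩

theorem mem_shrunkOf_of_eq {δ : ℝ} (hδ : 0 < δ) {q P : S → A → S → ℝ}
    (hq : q ∈ shrunk δ) (h : ∀ s a s', q s a s' = rho q s a * P s a s') : q ∈ shrunkOf δ P := by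
  refine ⟨hq, ?_⟩
  ext s a s'
  have : rho q s a ≠ 0 := (hδ.trans_le (hq.2 s a)).ne'
  change q s a s' / rho q s a = _
  rw [h, mul_div_cancel_left₀ _ this]

omit [Fintype A] in
theorem continuous_rho (s : S) (a : A) : Continuous fun q : S → A → S → ℝ => rho q s a := by
  unfold rho; fun_prop

/-- Membership in `shrunk δ` as a finite system of linear inequalities and equations. -/
theorem mem_shrunk_iff {δ : ℝ} {q : S → A → S → ℝ} :
    q ∈ shrunk δ ↔ (∀ s a s', 0 ≤ q s a s') ∧ ∑ s, ∑ a, ∑ s', q s a s' = 1 ∧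
      (∀ s, ∑ s', ∑ a, q s' a s = ∑ a, ∑ s', q s a s') ∧ ∀ s a, δ ≤ rho q s a := by
  constructor
  · rintro ⟨⟨h1, h2, h3⟩, h4⟩
    exact ⟨fun s a s' => (h1 s a s').1, h2, h3, h4⟩
  · rintro ⟨h1, h2, h3, h4⟩
    refine ⟨⟨fun s a s' => ⟨h1 s a s', ?_⟩, h2, h3⟩, h4⟩
    rw [← h2]
    refine le_trans ?_ (Finset.single_le_sum (f := fun s => ∑ a, ∑ s', q s a s')
      (fun s _ => Finset.sum_nonneg fun a _ => Finset.sum_nonneg fun s' _ => h1 s a s')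
      (Finset.mem_univ s))
    refine le_trans ?_ (Finset.single_le_sum (f := fun a => ∑ s', q s a s')
      (fun a _ => Finset.sum_nonneg fun s' _ => h1 s a s') (Finset.mem_univ a))
    exact Finset.single_le_sum (f := fun s' => q s a s') (fun s' _ => h1 s a s')
      (Finset.mem_univ s')

theorem isClosed_shrunk (δ : ℝ) : IsClosed (shrunk δ : Set (S → A → S → ℝ)) := by
  have : (shrunk δ : Set (S → A → S → ℝ)) =
      {q | (∀ s a s', 0 ≤ q s a s') ∧ ∑ s, ∑ a, ∑ s', q s a s' = 1 ∧
      (∀ s, ∑ s', ∑ a, q s' a s = ∑ a, ∑ s', q s a s') ∧ ∀ s a, δ ≤ rho q s a} := by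
    ext q; exact mem_shrunk_iff
  rw [this]
  simp only [Set.ofPred_and, Set.ofPred_forall]
  refine IsClosed.inter ?_ (IsClosed.inter ?_ (IsClosed.inter ?_ ?_))
  · exact isClosed_iInter fun s => isClosed_iInter fun a => isClosed_iInter fun s' =>
      isClosed_le continuous_const (by fun_prop)
  · exact isClosed_eq (by fun_prop) continuous_const
  · exact isClosed_iInter fun s => isClosed_eq (by fun_prop) (by fun_prop)
  · exact isClosed_iInter fun s => isClosed_iInter fun a =>
      isClosed_le continuous_const (continuous_rho s a)

theorem isCompact_shrunk (δ : ℝ) : IsCompact (shrunk δ : Set (S → A → S → ℝ)) := by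
  refine (isCompact_Icc (a := (0 : S → A → S → ℝ)) (b := 1)).of_isClosed_subset
    (isClosed_shrunk δ) fun q hq => ?_
  exact ⟨fun s a s' => (hq.1.1 s a s').1, fun s a s' => (hq.1.1 s a s').2⟩

omit [Fintype A] in
theorem rho_combo (p q : S → A → S → ℝ) (c d : ℝ) (s : S) (a : A) :
    rho (c • p + d • q) s a = c * rho p s a + d * rho q s a := by
  simp [rho, Finset.sum_add_distrib, Finset.mul_sum]

theorem convex_shrunk (δ : ℝ) : Convex ℝ (shrunk δ : Set (S → A → S → ℝ)) := by
  intro p hp q hq c d hc hd hcd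
  rw [mem_shrunk_iff] at *
  refine ⟨fun s a s' => ?_, ?_, fun s => ?_, fun s a => ?_⟩
  · have h1 := hp.1 s a s'
    have h2 := hq.1 s a s'
    simp only [Pi.add_apply, Pi.smul_apply, smul_eq_mul]
    positivity
  · simp only [Pi.add_apply, Pi.smul_apply, smul_eq_mul, Finset.sum_add_distrib,
      ← Finset.mul_sum, hp.2.1, hq.2.1]
    linarith
  · simp only [Pi.add_apply, Pi.smul_apply, smul_eq_mul, Finset.sum_add_distrib,
      ← Finset.mul_sum, hp.2.2.1, hq.2.2.1]
  · rw [rho_combo]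
    calc δ = c * δ + d * δ := by rw [← add_mul, hcd, one_mul]
      _ ≤ _ := by
        gcongr
        · exact hp.2.2.2 s a
        · exact hq.2.2.2 s a

theorem shrunkIn_inter (δ : ℝ) (B O : Set (S → A → S → ℝ)) :
    shrunkIn δ (B ∩ O) = shrunkIn δ B ∩ shrunkIn δ O := by
  ext q
  constructor
  · rintro ⟨h1, h2, h3⟩; exact ⟨⟨h1, h2⟩, h1, h3⟩
  · rintro ⟨⟨h1, h2⟩, -, h3⟩; exact ⟨h1, h2, h3⟩

/-- The initial confidence set, of all transition matrices, imposes no constraint. -/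
theorem shrunkIn_isTransition {δ : ℝ} (hδ : 0 < δ) :
    shrunkIn δ {P : S → A → S → ℝ | IsTransition P} = shrunk δ := by
  ext q
  exact ⟨fun h => h.1, fun h => ⟨h, isTransition_inducedTransition hδ h⟩⟩

/-- The sets of transition matrices over which the mirror descent step is a convex problem. Since
`q ↦ P^q` is not linear, convexity of `PP` would not be the right condition: it is required of the
set of occupancy measures. -/
def IsConvexConstraint (δ : ℝ) (PP : Set (S → A → S → ℝ)) : Prop :=
  IsClosed (shrunkIn δ PP) ∧ Convex ℝ (shrunkIn δ PP)

theorem IsConvexConstraint.inter {δ : ℝ} {B O : Set (S → A → S → ℝ)}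
    (hB : IsConvexConstraint δ B) (hO : IsConvexConstraint δ O) :
    IsConvexConstraint δ (B ∩ O) := by
  unfold IsConvexConstraint
  rw [shrunkIn_inter]
  exact ⟨hB.1.inter hO.1, hB.2.inter hO.2⟩

theorem isConvexConstraint_isTransition {δ : ℝ} (hδ : 0 < δ) :
    IsConvexConstraint δ {P : S → A → S → ℝ | IsTransition P} := by
  unfold IsConvexConstraint
  rw [shrunkIn_isTransition hδ]
  exact ⟨isClosed_shrunk δ, convex_shrunk δ⟩

/-- On `shrunk δ` the box constraint on `P^q` becomes linear in `q` after multiplication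
with `ρ^q > 0`. -/
theorem mem_shrunkIn_confBox_iff {δ : ℝ} (hδ : 0 < δ) (count : S → A → S → ℕ) (rad : ℕ → ℝ)
    {q : S → A → S → ℝ} : q ∈ shrunkIn δ (confBox count rad) ↔ q ∈ shrunk δ ∧
      ∀ s a s', |q s a s' - rho q s a * ((count s a s' : ℝ) /
        max 1 ((∑ y, count s a y : ℕ) : ℝ))| ≤ rho q s a * rad (∑ y, count s a y) := by
  refine and_congr_right fun hq => forall_congr' fun s => forall_congr' fun a =>
    forall_congr' fun s' => ?_
  have hpos : 0 < rho q s a := hδ.trans_le (hq.2 s a)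
  rw [← mul_inducedTransition hδ hq s a s', ← mul_sub, abs_mul, abs_of_pos hpos]
  exact (mul_le_mul_iff_right₀ hpos).symm

theorem isConvexConstraint_confBox {δ : ℝ} (hδ : 0 < δ) (count : S → A → S → ℕ) (rad : ℕ → ℝ) :
    IsConvexConstraint δ (confBox count rad) := by
  set c : S → A → S → ℝ := fun s a s' => (count s a s' : ℝ) / max 1 ((∑ y, count s a y : ℕ) : ℝ)
    with hc
  set r : S → A → ℝ := fun s a => rad (∑ y, count s a y) with hr
  have hset : shrunkIn δ (confBox count rad) = shrunk δ ∩ {q : S → A → S → ℝ |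
      ∀ s a s', |q s a s' - rho q s a * c s a s'| ≤ rho q s a * r s a} := by
    ext q
    exact mem_shrunkIn_confBox_iff hδ count rad
  unfold IsConvexConstraint
  rw [hset]
  refine ⟨(isClosed_shrunk δ).inter ?_, (convex_shrunk δ).inter ?_⟩
  · simp only [Set.ofPred_forall]
    refine isClosed_iInter fun s => isClosed_iInter fun a => isClosed_iInter fun s' => ?_
    have := continuous_rho (S := S) (A := A) s a
    exact isClosed_le (by fun_prop) (by fun_prop)
  · intro p hp q hq x y hx hy hxy s a s'
    rw [rho_combo]
    simp only [Pi.add_apply, Pi.smul_apply, smul_eq_mul]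
    calc |x * p s a s' + y * q s a s' - (x * rho p s a + y * rho q s a) * c s a s'|
        = |x * (p s a s' - rho p s a * c s a s') + y * (q s a s' - rho q s a * c s a s')| := by
          ring_nf
      _ ≤ x * |p s a s' - rho p s a * c s a s'| + y * |q s a s' - rho q s a * c s a s'| := by
          refine (abs_add_le _ _).trans ?_
          rw [abs_mul, abs_mul, abs_of_nonneg hx, abs_of_nonneg hy]
      _ ≤ x * (rho p s a * r s a) + y * (rho q s a * r s a) := by
          gcongr
          · exact hp s a s'
          · exact hq s a s'
      _ = _ := by ring

theorem IsConvexConstraint.isCompact {δ : ℝ} {PP : Set (S → A → S → ℝ)}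
    (h : IsConvexConstraint δ PP) : IsCompact (shrunkIn δ PP) :=
  (isCompact_shrunk δ).of_isClosed_subset h.1 fun _ hq => hq.1

/-- The uniform starting point is feasible, because `δ |S| |A| ≤ 1` as soon as `shrunk δ` is
nonempty. -/
theorem uniform_mem_shrunk {δ : ℝ} (hne : (shrunk δ : Set (S → A → S → ℝ)).Nonempty) :
    (PlayerState.init : PlayerState S A).qhat ∈ shrunk δ := by
  obtain ⟨q, hq⟩ := hne
  have hS : Nonempty S := by
    by_contra h
    rw [not_nonempty_iff] at h
    simpa using hq.1.2.1
  have hA : Nonempty A := by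
    by_contra h
    rw [not_nonempty_iff] at h
    simpa using hq.1.2.1
  have hSc : (0 : ℝ) < Fintype.card S := by exact_mod_cast Fintype.card_pos
  have hAc : (0 : ℝ) < Fintype.card A := by exact_mod_cast Fintype.card_pos
  rw [mem_shrunk_iff]
  simp only [PlayerState.init, rho, Finset.sum_const, Finset.card_univ, nsmul_eq_mul]
  refine ⟨fun _ _ _ => by positivity, by field_simp, fun _ => by ring, fun _ _ => ?_⟩
  have hsum : ∑ s : S, ∑ a : A, δ ≤ ∑ s, ∑ a, rho q s a :=
    Finset.sum_le_sum fun s _ => Finset.sum_le_sum fun a _ => hq.2 s a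
  rw [show ∑ s, ∑ a, rho q s a = 1 from hq.1.2.1] at hsum
  simp only [Finset.sum_const, Finset.card_univ, nsmul_eq_mul] at hsum
  rw [show (Fintype.card S : ℝ) * (1 / ((Fintype.card A : ℝ) * (Fintype.card S : ℝ) ^ 2)) =
    1 / ((Fintype.card S : ℝ) * Fintype.card A) by field_simp, le_div_iff₀ (by positivity)]
  linarith

/-- An occupancy measure in `shrunk δ` whose transitions are close to `P` is close to
`shrunkOf δ P`, with a linear rate. -/
theorem exists_errorBound_shrunkOf {δ : ℝ} (hδ : 0 < δ) (P : S → A → S → ℝ)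
    (hne : (shrunkOf δ P).Nonempty) :
    ∃ C : ℝ, 0 ≤ C ∧ ∀ q ∈ shrunk δ, ∀ r, 0 ≤ r →
      (∀ s a s', |q s a s' - rho q s a * P s a s'| ≤ r) →
      ∃ y ∈ shrunkOf δ P, ‖q - y‖ ≤ C * r := by
  set ev : S → A → S → (S → A → S → ℝ) →L[ℝ] ℝ := fun s a s' =>
    (ContinuousLinearMap.proj (R := ℝ) (φ := fun _ : S => ℝ) s').comp
      ((ContinuousLinearMap.proj (R := ℝ) (φ := fun _ : A => S → ℝ) a).comp
        (ContinuousLinearMap.proj (R := ℝ) (φ := fun _ : S => A → S → ℝ) s)) with hev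
  have hev' : ∀ s a s' (q : S → A → S → ℝ), ev s a s' q = q s a s' := fun _ _ _ _ => rfl
  let tot : (S → A → S → ℝ) →L[ℝ] ℝ := ∑ s, ∑ a, ∑ s', ev s a s'
  let rh : S → A → (S → A → S → ℝ) →L[ℝ] ℝ := fun s a => ∑ s', ev s a s'
  let flow : S → (S → A → S → ℝ) →L[ℝ] ℝ := fun s => ∑ s', ∑ a, ev s' a s - ∑ a, ∑ s', ev s a s'
  let dev : S → A → S → (S → A → S → ℝ) →L[ℝ] ℝ := fun s a s' => ev s a s' - P s a s' • rh s a
  have htot : ∀ q, tot q = ∑ s, ∑ a, ∑ s', q s a s' := fun q => by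
    simp [tot, hev']
  have hrh : ∀ s a q, rh s a q = rho q s a := fun s a q => by
    simp [rh, hev', rho]
  have hflow : ∀ s q, flow s q = ∑ s', ∑ a, q s' a s - ∑ a, ∑ s', q s a s' := fun s q => by
    simp [flow, hev']
  have hdev : ∀ s a s' q, dev s a s' q = q s a s' - rho q s a * P s a s' := fun s a s' q => by
    simp [dev, hrh, hev', mul_comm]
  -- `shrunkOf δ P` as a system of inequalities: signs, total mass, stationarity, thresholds
  -- and `q = ρ P`, an equation being two inequalities
  let f : ((S × A × S) ⊕ Unit ⊕ Unit ⊕ S ⊕ S ⊕ (S × A) ⊕ (S × A × S) ⊕ (S × A × S)) →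
      (S → A → S → ℝ) →L[ℝ] ℝ :=
    Sum.elim (fun x => -ev x.1 x.2.1 x.2.2) <| Sum.elim (fun _ => tot) <| Sum.elim (fun _ => -tot) <|
      Sum.elim flow <| Sum.elim (fun s => -flow s) <| Sum.elim (fun x => -rh x.1 x.2) <|
        Sum.elim (fun x => dev x.1 x.2.1 x.2.2) (fun x => -dev x.1 x.2.1 x.2.2)
  let b : ((S × A × S) ⊕ Unit ⊕ Unit ⊕ S ⊕ S ⊕ (S × A) ⊕ (S × A × S) ⊕ (S × A × S)) → ℝ :=
    Sum.elim (fun _ => 0) <| Sum.elim (fun _ => 1) <| Sum.elim (fun _ => -1) <|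
      Sum.elim (fun _ => 0) <| Sum.elim (fun _ => 0) <| Sum.elim (fun _ => -δ) <|
        Sum.elim (fun _ => 0) (fun _ => 0)
  have hmem : ∀ q r, (∀ j, f j q ≤ b j + r) ↔ (∀ s a s', - q s a s' ≤ r) ∧
      (∑ s, ∑ a, ∑ s', q s a s' ≤ 1 + r) ∧ (-(∑ s, ∑ a, ∑ s', q s a s') ≤ -1 + r) ∧
      (∀ s, ∑ s', ∑ a, q s' a s - ∑ a, ∑ s', q s a s' ≤ r) ∧
      (∀ s, ∑ a, ∑ s', q s a s' - ∑ s', ∑ a, q s' a s ≤ r) ∧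
      (∀ s a, - rho q s a ≤ -δ + r) ∧
      (∀ s a s', q s a s' - rho q s a * P s a s' ≤ r) ∧
      (∀ s a s', rho q s a * P s a s' - q s a s' ≤ r) := by
    intro q r
    simp only [Sum.forall, f, b, Sum.elim_inl, Sum.elim_inr, Prod.forall,
      neg_apply, hev', htot, hflow, hrh, hdev, zero_add, neg_sub,
      forall_const]
  have hmem0 : ∀ q, (∀ j, f j q ≤ b j) ↔ q ∈ shrunkOf δ P := by
    intro q
    have := hmem q 0
    simp only [add_zero] at this
    rw [this]
    constructor
    · rintro ⟨h1, h2, h3, h4, h5, h6, h7, h8⟩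
      refine mem_shrunkOf_of_eq hδ (mem_shrunk_iff.2 ⟨fun s a s' => ?_, ?_, fun s => ?_,
        fun s a => ?_⟩) fun s a s' => ?_
      · linarith [h1 s a s']
      · linarith
      · linarith [h4 s, h5 s]
      · linarith [h6 s a]
      · linarith [h7 s a s', h8 s a s']
    · intro hq
      have h1 := mem_shrunk_iff.1 hq.1
      have h2 := eq_rho_mul_of_mem_shrunkOf hδ hq
      refine ⟨fun s a s' => by linarith [h1.1 s a s'], h1.2.1.le, by linarith [h1.2.1],
        fun s => by linarith [h1.2.2.1 s], fun s => by linarith [h1.2.2.1 s],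
        fun s a => by linarith [h1.2.2.2 s a], fun s a s' => by linarith [h2 s a s'],
        fun s a s' => by linarith [h2 s a s']⟩
  obtain ⟨C, hC0, hC⟩ := exists_errorBound f b (by
    obtain ⟨q, hq⟩ := hne
    exact ⟨q, (hmem0 q).2 hq⟩)
  refine ⟨C, hC0, fun q hq r hr hqr => ?_⟩
  obtain ⟨y, hy, hle⟩ := hC q r hr ((hmem q r).2 (by
    have h1 := mem_shrunk_iff.1 hq
    refine ⟨fun s a s' => by linarith [h1.1 s a s'], by linarith [h1.2.1], by linarith [h1.2.1],
        fun s => by linarith [h1.2.2.1 s], fun s => by linarith [h1.2.2.1 s],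
        fun s a => by linarith [h1.2.2.2 s a], fun s a s' => (le_abs_self _).trans (hqr s a s'),
        fun s a s' => ?_⟩
    have := neg_le_abs (q s a s' - rho q s a * P s a s')
    linarith [hqr s a s']))
  exact ⟨y, (hmem0 y).1 hy, hle⟩

/-! ### Bregman divergences and the mirror descent step -/

section Bregman

variable {h : (S → A → S → ℝ) → ℝ} {D : Set (S → A → S → ℝ)}

/-- Inside `D` the one-sided derivative of `h` along a segment is given by `fderivWithin`, even if
`D` has empty interior, as the shrunk polytope does. -/
theorem hasDerivWithinAt_segment (hD : Convex ℝ D) (hdiff : DifferentiableOn ℝ h D)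
    {p u : S → A → S → ℝ} (hp : p ∈ D) (hu : u ∈ D) :
    HasDerivWithinAt (fun t : ℝ => h (p + t • (u - p))) (fderivWithin ℝ h D p (u - p))
      (Set.Ioi 0) 0 := by
  have h1 : HasDerivWithinAt (fun t : ℝ => p + t • (u - p)) (u - p) (Set.Icc 0 1) 0 := by
    have := ((hasDerivAt_id (0 : ℝ)).smul_const (u - p)).const_add p
    simpa using this.hasDerivWithinAt
  have h2 : HasFDerivWithinAt h (fderivWithin ℝ h D p) D (p + (0 : ℝ) • (u - p)) := by
    simpa using (hdiff p hp).hasFDerivWithinAt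
  have h3 := h2.comp_hasDerivWithinAt (0 : ℝ) h1 (fun t ht => by
    have := hD.add_smul_sub_mem hp hu ht
    exact this)
  refine h3.mono_of_mem_nhdsWithin ?_
  exact mem_of_superset (Ioc_mem_nhdsGT one_pos) Set.Ioc_subset_Icc_self

theorem derivWithin_le_of_le {f g : ℝ → ℝ} {f' c : ℝ} (hf : HasDerivWithinAt f f' (Set.Ioi 0) 0)
    (hg : Tendsto g (𝓝[>] 0) (𝓝 c)) (hle : ∀ᶠ t in 𝓝[>] (0 : ℝ), f t ≤ f 0 + t * g t) :
    f' ≤ c := by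
  rw [hasDerivWithinAt_iff_tendsto_slope' (by simp)] at hf
  refine le_of_tendsto_of_tendsto hf hg ?_
  filter_upwards [hle, self_mem_nhdsWithin] with t ht ht0
  have ht0 : 0 < t := ht0
  rw [slope_def_field, sub_zero, div_le_iff₀ ht0]
  linarith

/-- The Bregman divergence of a strongly convex function dominates the squared distance. -/
theorem le_bregman {m : ℝ} (hconv : StrongConvexOn D m h) (hdiff : DifferentiableOn ℝ h D)
    {p q : S → A → S → ℝ} (hp : p ∈ D) (hq : q ∈ D) :
    m / 2 * ‖p - q‖ ^ 2 ≤ bregman h D p q := by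
  have hder := hasDerivWithinAt_segment hconv.1 hdiff hq hp
  have := derivWithin_le_of_le (g := fun t => h p - h q - (1 - t) * (m / 2 * ‖p - q‖ ^ 2))
    (c := h p - h q - m / 2 * ‖p - q‖ ^ 2) hder (by
      have hc : Continuous fun t : ℝ => h p - h q - (1 - t) * (m / 2 * ‖p - q‖ ^ 2) := by fun_prop
      have := (hc.tendsto 0).mono_left (nhdsWithin_le_nhds (s := Set.Ioi 0))
      simpa using this) (by
      filter_upwards [Ioc_mem_nhdsGT (one_pos (α := ℝ))] with t ht
      have h1 := hconv.2 hq hp (show (0 : ℝ) ≤ 1 - t by linarith [ht.2]) ht.1.le (by ring)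
      rw [show q + t • (p - q) = (1 - t) • q + t • p by module, zero_smul, add_zero]
      rw [norm_sub_rev q p] at h1
      simp only [smul_eq_mul] at h1
      refine h1.trans (le_of_eq ?_)
      ring)
  unfold bregman
  linarith

theorem bregman_nonneg {m : ℝ} (hm : 0 < m) (hconv : StrongConvexOn D m h)
    (hdiff : DifferentiableOn ℝ h D) {p q : S → A → S → ℝ} (hp : p ∈ D) (hq : q ∈ D) :
    0 ≤ bregman h D p q :=
  le_trans (by positivity) (le_bregman hconv hdiff hp hq)

/-- The three-point inequality: optimality of `p` in a convex set `C ⊆ D`, tested in the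
direction of `u ∈ C`. -/
theorem bregman_three_point (hD : Convex ℝ D) (hdiff : DifferentiableOn ℝ h D)
    {C : Set (S → A → S → ℝ)} (hC : Convex ℝ C) (hCD : C ⊆ D) (l : (S → A → S → ℝ) →ₗ[ℝ] ℝ)
    {p q u : S → A → S → ℝ} (hp : p ∈ C) (hu : u ∈ C)
    (hmax : IsMaxOn (fun p => l p - bregman h D p q) C p) :
    bregman h D u p ≤ bregman h D u q - bregman h D p q - l (u - p) := by
  have hder := hasDerivWithinAt_segment hD hdiff (hCD hp) (hCD hu)
  have h1 : l (u - p) + fderivWithin ℝ h D q (u - p) ≤ fderivWithin ℝ h D p (u - p) := by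
    have := derivWithin_le_of_le
      (g := fun _ => -(l (u - p) + fderivWithin ℝ h D q (u - p))) hder.neg tendsto_const_nhds (by
        filter_upwards [Ioc_mem_nhdsGT (one_pos (α := ℝ))] with t ht
        have hmem : p + t • (u - p) ∈ C := hC.add_smul_sub_mem hp hu ⟨ht.1.le, ht.2⟩
        have h2 := hmax hmem
        simp only [bregman, Set.mem_ofPred_eq] at h2
        rw [show p + t • (u - p) - q = (p - q) + t • (u - p) by module] at h2
        simp only [map_add, map_smul, smul_eq_mul] at h2
        simp only [Pi.neg_apply, zero_smul, add_zero]
        linarith)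
    linarith
  have h2 : fderivWithin ℝ h D q (u - q) =
      fderivWithin ℝ h D q (u - p) + fderivWithin ℝ h D q (p - q) := by
    rw [← map_add]; congr 1; abel
  unfold bregman
  linarith

/-- `shrunk δ` is a polytope, so near `p` it agrees with a cone with apex `p`. -/
theorem exists_reflect_mem_shrunk {δ : ℝ} {p : S → A → S → ℝ} (hp : p ∈ shrunk δ) :
    ∃ r > 0, ∀ q ∈ shrunk δ, ‖q - p‖ < r → q + (q - p) ∈ shrunk δ := by
  have hlim : Tendsto (fun q : S → A → S → ℝ => q + (q - p)) (𝓝 p) (𝓝 p) := by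
    have : Continuous fun q : S → A → S → ℝ => q + (q - p) := by fun_prop
    simpa using this.tendsto p
  have key : ∀ (f : (S → A → S → ℝ) → ℝ) (b : ℝ), Continuous f → b ≤ f p →
      (∀ q, f (q + (q - p)) = 2 * f q - f p) →
      ∀ᶠ q in 𝓝 p, b ≤ f q → b ≤ f (q + (q - p)) := by
    intro f b hf hb hlin
    rcases hb.eq_or_lt with hb | hb
    · refine Eventually.of_forall fun q hq => ?_
      rw [hlin]; linarith
    · have := ((hf.tendsto p).comp hlim).eventually (lt_mem_nhds hb)
      filter_upwards [this] with q hq _ using hq.le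
  have h1 : ∀ᶠ q in 𝓝 p, ∀ s a s', 0 ≤ q s a s' → 0 ≤ (q + (q - p)) s a s' :=
    eventually_all.2 fun s => eventually_all.2 fun a => eventually_all.2 fun s' =>
      key (fun q => q s a s') 0 (by fun_prop) (hp.1.1 s a s').1
        (fun q => by simp only [Pi.add_apply, Pi.sub_apply]; ring)
  have hrho : ∀ (q : S → A → S → ℝ) s a, rho (q + (q - p)) s a = 2 * rho q s a - rho p s a := by
    intro q s a
    simp only [rho, Pi.add_apply, Pi.sub_apply, Finset.sum_add_distrib, Finset.sum_sub_distrib]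
    ring
  have h2 : ∀ᶠ q in 𝓝 p, ∀ s a, δ ≤ rho q s a → δ ≤ rho (q + (q - p)) s a :=
    eventually_all.2 fun s => eventually_all.2 fun a =>
      key (fun q => rho q s a) δ (continuous_rho s a) (hp.2 s a) (fun q => hrho q s a)
  obtain ⟨r, hr, hball⟩ := Metric.eventually_nhds_iff.1 (h1.and h2)
  refine ⟨r, hr, fun q hq hqr => ?_⟩
  obtain ⟨h3, h4⟩ := hball (y := q) (by rwa [dist_eq_norm])
  have hp' := mem_shrunk_iff.1 hp
  have hq' := mem_shrunk_iff.1 hq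
  refine mem_shrunk_iff.2 ⟨fun s a s' => h3 s a s' (hq'.1 s a s'), ?_, fun s => ?_,
    fun s a => h4 s a (hq'.2.2.2 s a)⟩
  · simp only [Pi.add_apply, Pi.sub_apply, Finset.sum_add_distrib, Finset.sum_sub_distrib,
      hp'.2.1, hq'.2.1]
    norm_num
  · simp only [Pi.add_apply, Pi.sub_apply, Finset.sum_add_distrib, Finset.sum_sub_distrib,
      hp'.2.2.1, hq'.2.2.1]

/-- The divergence `D(p ‖ q)` tends to `0` as `q → p`, although the derivative of `h` need not be
continuous at the boundary: the derivative at `q` in the direction `q - p` is bounded by a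
difference quotient towards the reflection `q + (q - p)`, which lies in the polytope. -/
theorem bregman_small {δ m : ℝ} (hm : 0 < m) (hconv : StrongConvexOn (shrunk δ) m h)
    (hdiff : DifferentiableOn ℝ h (shrunk δ)) {p : S → A → S → ℝ} (hp : p ∈ shrunk δ)
    {ε : ℝ} (hε : 0 < ε) :
    ∃ r > 0, ∀ q ∈ shrunk δ, ‖q - p‖ < r → bregman h (shrunk δ) p q < ε := by
  obtain ⟨r₁, hr₁, href⟩ := exists_reflect_mem_shrunk hp
  obtain ⟨r₂, hr₂, hcont⟩ := Metric.continuousWithinAt_iff.1 ((hdiff p hp).continuousWithinAt)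
    (ε / 4) (by positivity)
  refine ⟨min r₁ (r₂ / 2), by positivity, fun q hq hqr => ?_⟩
  set w := q + (q - p)
  have hw : w ∈ shrunk δ := href q hq (hqr.trans_le (min_le_left _ _))
  have hq2 : ‖q - p‖ < r₂ / 2 := hqr.trans_le (min_le_right _ _)
  have h1 := hcont hq (by rw [dist_eq_norm]; linarith)
  have h2 := hcont hw (by
    rw [dist_eq_norm, show w - p = (2 : ℝ) • (q - p) by simp only [w]; module, norm_smul]
    norm_num
    linarith)
  rw [Real.dist_eq, abs_lt] at h1 h2
  have h3 := bregman_nonneg hm hconv hdiff hw hq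
  unfold bregman at h3 ⊢
  rw [show w - q = -(p - q) by simp only [w]; abel, map_neg] at h3
  linarith

end Bregman

/-- `⟨p, R⟩` for a vector `R` that does not depend on the last coordinate. -/
def pairR (R : S → A → ℝ) : (S → A → S → ℝ) →ₗ[ℝ] ℝ where
  toFun p := ∑ s, ∑ a, ∑ s', p s a s' * R s a
  map_add' p q := by
    simp only [Pi.add_apply, add_mul, Finset.sum_add_distrib]
  map_smul' c p := by
    simp only [Pi.smul_apply, smul_eq_mul, mul_assoc, Finset.mul_sum, RingHom.id_apply]

theorem pairR_apply (R : S → A → ℝ) (p : S → A → S → ℝ) :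
    pairR R p = ∑ s, ∑ a, ∑ s', p s a s' * R s a := rfl

theorem abs_pairR_le {R : S → A → ℝ} {B : ℝ} (hB : ∀ s a, |R s a| ≤ B) (p : S → A → S → ℝ) :
    |pairR R p| ≤ (Fintype.card S * (Fintype.card A * Fintype.card S) : ℝ) * B * ‖p‖ := by
  rw [pairR_apply]
  have hb : ∀ s a s', |p s a s' * R s a| ≤ B * ‖p‖ := fun s a s' => by
    rw [abs_mul, mul_comm]
    have h1 : |p s a s'| ≤ ‖p‖ :=
      ((norm_le_pi_norm (p s a) s').trans (norm_le_pi_norm (p s) a)).trans (norm_le_pi_norm p s)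
    exact mul_le_mul (hB s a) h1 (abs_nonneg _) ((abs_nonneg _).trans (hB s a))
  calc |∑ s, ∑ a, ∑ s', p s a s' * R s a| ≤ ∑ s, ∑ a, ∑ s', |p s a s' * R s a| := by
        refine (Finset.abs_sum_le_sum_abs _ _).trans (Finset.sum_le_sum fun s _ => ?_)
        refine (Finset.abs_sum_le_sum_abs _ _).trans (Finset.sum_le_sum fun a _ => ?_)
        exact Finset.abs_sum_le_sum_abs _ _
    _ ≤ ∑ s : S, ∑ a : A, ∑ s' : S, B * ‖p‖ :=
        Finset.sum_le_sum fun s _ => Finset.sum_le_sum fun a _ => Finset.sum_le_sum fun s' _ =>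
          hb s a s'
    _ = _ := by
        simp only [Finset.sum_const, Finset.card_univ, nsmul_eq_mul]; ring

theorem continuousOn_omdObjective {δ : ℝ} {h : (S → A → S → ℝ) → ℝ}
    (hdiff : DifferentiableOn ℝ h (shrunk δ)) (η : ℝ) (R : S → A → ℝ) (q : S → A → S → ℝ) :
    ContinuousOn (omdObjective δ h η R q) (shrunk δ) := by
  unfold omdObjective bregman
  have h1 := hdiff.continuousOn
  refine ContinuousOn.sub (by fun_prop) ((h1.sub continuousOn_const).sub ?_)
  exact ((fderivWithin ℝ h (shrunk δ) q).continuous.comp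
    (continuous_id.sub continuous_const)).continuousOn

theorem omdUpdate_mem_shrunk {δ : ℝ} {h : (S → A → S → ℝ) → ℝ} {η : ℝ}
    {PP : Set (S → A → S → ℝ)} {R : S → A → ℝ} {q : S → A → S → ℝ} (hq : q ∈ shrunk δ) :
    omdUpdate δ h η PP R q ∈ shrunk δ := by
  unfold omdUpdate
  split_ifs with H
  · exact H.choose_spec.1.1
  · exact hq

/-- If there is a feasible point, then the maximum in the mirror descent step is attained. -/
theorem omdUpdate_spec {δ : ℝ} {h : (S → A → S → ℝ) → ℝ}
    (hdiff : DifferentiableOn ℝ h (shrunk δ)) {η : ℝ}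
    {PP : Set (S → A → S → ℝ)} (hPP : IsConvexConstraint δ PP) (hne : (shrunkIn δ PP).Nonempty)
    {R : S → A → ℝ} {q : S → A → S → ℝ} :
    omdUpdate δ h η PP R q ∈ shrunkIn δ PP ∧
      IsMaxOn (omdObjective δ h η R q) (shrunkIn δ PP) (omdUpdate δ h η PP R q) := by
  have H : ∃ p ∈ shrunkIn δ PP, IsMaxOn (omdObjective δ h η R q) (shrunkIn δ PP) p :=
    hPP.isCompact.exists_isMaxOn hne
      ((continuousOn_omdObjective hdiff η R q).mono fun _ h => h.1)
  unfold omdUpdate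
  rw [dif_pos H]
  exact H.choose_spec

/-- One mirror descent step decreases the divergence to any feasible point `u`, up to the first
order term and an error of second order in the step size. -/
theorem bregman_omdUpdate_le {δ m : ℝ} (hm : 0 < m) {h : (S → A → S → ℝ) → ℝ}
    (hconv : StrongConvexOn (shrunk δ) m h) (hdiff : DifferentiableOn ℝ h (shrunk δ)) {η : ℝ}
    {PP : Set (S → A → S → ℝ)} (hPP : IsConvexConstraint δ PP)
    {R : S → A → ℝ} (hR : ∀ s a, |R s a| ≤ 1) {q u : S → A → S → ℝ} (hq : q ∈ shrunk δ)
    (hu : u ∈ shrunkIn δ PP) :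
    bregman h (shrunk δ) u (omdUpdate δ h η PP R q) ≤ bregman h (shrunk δ) u q
      - η * pairR R (u - q)
      + η ^ 2 * ((Fintype.card S * (Fintype.card A * Fintype.card S) : ℝ) ^ 2 / (2 * m)) := by
  obtain ⟨hp, hmax⟩ := omdUpdate_spec hdiff (η := η) hPP ⟨u, hu⟩ (R := R) (q := q)
  set p := omdUpdate δ h η PP R q
  have h1 := bregman_three_point (convex_shrunk δ) hdiff hPP.2 (fun _ h => h.1) (η • pairR R)
    (q := q) hp hu hmax
  simp only [LinearMap.smul_apply, smul_eq_mul] at h1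
  have h2 := le_bregman hconv hdiff hp.1 hq
  have h3 : pairR R (u - p) = pairR R (u - q) - pairR R (p - q) := by
    rw [← map_sub]; congr 1; abel
  have h4 := abs_pairR_le hR (p - q)
  set K : ℝ := (Fintype.card S * (Fintype.card A * Fintype.card S) : ℝ)
  rw [mul_one] at h4
  have h5 : η * pairR R (p - q) ≤ |η| * (K * ‖p - q‖) := by
    calc η * pairR R (p - q) ≤ |η * pairR R (p - q)| := le_abs_self _
      _ ≤ _ := by rw [abs_mul]; gcongr
  have h6 : |η| * (K * ‖p - q‖) ≤ m / 2 * ‖p - q‖ ^ 2 + η ^ 2 * (K ^ 2 / (2 * m)) := by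
    -- `2 x y ≤ x ^ 2 + y ^ 2`, where `‖p - q‖ ^ 2` is paid for by `D(p ‖ q)`
    have : 0 ≤ (m * ‖p - q‖ - |η| * K) ^ 2 / (2 * m) := by positivity
    have h7 : (m * ‖p - q‖ - |η| * K) ^ 2 / (2 * m) =
        m / 2 * ‖p - q‖ ^ 2 + η ^ 2 * (K ^ 2 / (2 * m)) - |η| * (K * ‖p - q‖) := by
      rw [← sq_abs η]; field_simp; ring
    linarith
  rw [h3] at h1
  linarith

end SinglePlayer

/-! ### Random variables with finitely many values -/

section FiniteValued

variable {Ω T : Type*} [Fintype T]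

theorem comp_eq_sum_indicator (g : Ω → T) (f : T → ℝ) : (fun ω => f (g ω)) =
    fun ω => ∑ v, Set.indicator {ω | g ω = v} (fun _ => f v) ω := by
  classical
  ext ω
  simp [Set.indicator_apply]

variable [MeasurableSpace Ω] {μ : Measure Ω} [IsFiniteMeasure μ] {g : Ω → T}

theorem integrable_comp_of_finite (hg : ∀ v, MeasurableSet {ω | g ω = v}) (f : T → ℝ) :
    Integrable (fun ω => f (g ω)) μ := by
  rw [comp_eq_sum_indicator]
  exact integrable_finsetSum _ fun v _ => (integrable_const _).indicator (hg v)

theorem integral_comp_of_finite (hg : ∀ v, MeasurableSet {ω | g ω = v}) (f : T → ℝ) :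
    ∫ ω, f (g ω) ∂μ = ∑ v, μ.real {ω | g ω = v} * f v := by
  rw [comp_eq_sum_indicator,
    integral_finsetSum _ fun v _ => (integrable_const _).indicator (hg v)]
  refine Finset.sum_congr rfl fun v _ => ?_
  rw [integral_indicator_const _ (hg v), smul_eq_mul]

end FiniteValued

theorem sum_sum_prod {n : ℕ} {S A : Fin n → Type*} [∀ i, Fintype (S i)] [∀ i, Fintype (A i)]
    (f : ∀ i, A i → S i → ℝ) :
    ∑ a : ∀ i, A i, ∑ s : ∀ i, S i, ∏ i, f i (a i) (s i) = ∏ i, ∑ a, ∑ s, f i a s := by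
  classical
  rw [Fintype.prod_sum]
  refine Finset.sum_congr rfl fun a _ => ?_
  rw [Fintype.prod_sum]

/-! ### The Markov property of a play -/

section Histories

variable {n : ℕ} {S A : Fin n → Type*}

/-- The quantity `F` is determined by the states and actions before the time `t` and by the state
at the time `t`, that is, just before the players act at the time `t`. -/
def PreDet {β : Type*} (t : ℕ) (F : (ℕ → (∀ i, S i) × (∀ i, A i)) → β) : Prop :=
  ∀ x y, (∀ l < t, x l = y l) → (x t).1 = (y t).1 → F x = F y

/-- The path `x` with the action at the time `t` replaced by `a` and the state at the time `t + 1`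
replaced by `s'`. -/
def extPath (x : ℕ → (∀ i, S i) × (∀ i, A i)) (t : ℕ) (a : ∀ i, A i) (s' : ∀ i, S i) :
    ℕ → (∀ i, S i) × (∀ i, A i) :=
  Function.update (Function.update x t ((x t).1, a)) (t + 1) (s', (x (t + 1)).2)

theorem extPath_lt (x : ℕ → (∀ i, S i) × (∀ i, A i)) {t l : ℕ} (a : ∀ i, A i) (s' : ∀ i, S i)
    (h : l < t) : extPath x t a s' l = x l := by
  rw [extPath, Function.update_of_ne (by omega), Function.update_of_ne (by omega)]

@[simp] theorem extPath_self (x : ℕ → (∀ i, S i) × (∀ i, A i)) (t : ℕ) (a : ∀ i, A i)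
    (s' : ∀ i, S i) : extPath x t a s' t = ((x t).1, a) := by
  rw [extPath, Function.update_of_ne (by omega), Function.update_self]

@[simp] theorem extPath_succ (x : ℕ → (∀ i, S i) × (∀ i, A i)) (t : ℕ) (a : ∀ i, A i)
    (s' : ∀ i, S i) : (extPath x t a s' (t + 1)).1 = s' := by
  rw [extPath, Function.update_self]

theorem PreDet.extPath {β : Type*} {t l : ℕ} {F : (ℕ → (∀ i, S i) × (∀ i, A i)) → β}
    (hF : PreDet l F) (hl : l ≤ t) (x : ℕ → (∀ i, S i) × (∀ i, A i)) (a : ∀ i, A i)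
    (s' : ∀ i, S i) : F (extPath x t a s') = F x := by
  refine hF _ _ (fun k hk => extPath_lt x a s' (hk.trans_le hl)) ?_
  rcases hl.eq_or_lt with rfl | h
  · simp
  · rw [extPath_lt x a s' h]

theorem PreDet.mono {β : Type*} {t l : ℕ} {F : (ℕ → (∀ i, S i) × (∀ i, A i)) → β}
    (hF : PreDet l F) (hl : l ≤ t) : PreDet t F := by
  intro x y hxy ht
  refine hF x y (fun k hk => hxy k (hk.trans_le hl)) ?_
  rcases hl.eq_or_lt with rfl | h
  · exact ht
  · rw [hxy l h]

/-- A quantity that does not look at the action at the time `t + 1` is known before the players act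
at that time. -/
theorem PreDet.of_step {β : Type*} {t : ℕ} {F : (ℕ → (∀ i, S i) × (∀ i, A i)) → β}
    (hF : ∀ x y, (∀ l ≤ t, x l = y l) → (x (t + 1)).1 = (y (t + 1)).1 → F x = F y) :
    PreDet (t + 1) F :=
  fun x y hxy ht => hF x y (fun l hl => hxy l (by omega)) ht

/-- The history just before the players act at the time `t`. -/
def hist (t : ℕ) (x : ℕ → (∀ i, S i) × (∀ i, A i)) :
    (Fin t → (∀ i, S i) × (∀ i, A i)) × (∀ i, S i) :=
  (fun l => x l, (x t).1)

theorem hist_eq_iff {t : ℕ} {x y : ℕ → (∀ i, S i) × (∀ i, A i)} :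
    hist t x = hist t y ↔ (∀ l < t, x l = y l) ∧ (x t).1 = (y t).1 := by
  simp only [hist, Prod.mk.injEq, funext_iff, Fin.forall_iff]

/-- A path with a given history. The action at the time `t` and everything after it are filled in
arbitrarily. -/
def pathOfHist (a₀ : ∀ i, A i) {t : ℕ} (z : (Fin t → (∀ i, S i) × (∀ i, A i)) × (∀ i, S i)) :
    ℕ → (∀ i, S i) × (∀ i, A i) :=
  fun l => if h : l < t then z.1 ⟨l, h⟩ else (z.2, a₀)

theorem hist_pathOfHist (a₀ : ∀ i, A i) {t : ℕ}
    (z : (Fin t → (∀ i, S i) × (∀ i, A i)) × (∀ i, S i)) : hist t (pathOfHist a₀ z) = z := by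
  unfold hist pathOfHist
  simp

theorem PreDet.eq_of_hist {β : Type*} {t : ℕ} {F : (ℕ → (∀ i, S i) × (∀ i, A i)) → β}
    (hF : PreDet t F) {x y : ℕ → (∀ i, S i) × (∀ i, A i)} (h : hist t x = hist t y) : F x = F y :=
  hF x y (hist_eq_iff.1 h).1 (hist_eq_iff.1 h).2

variable [∀ i, Fintype (S i)] [∀ i, Fintype (A i)]

/-- Probability that the players in the joint state `s`, following `π`, play `a` and move
to `s'`. -/
def Game.stepProb (G : Game n S A) (π : ∀ i, S i → A i → ℝ) (s : ∀ i, S i) (a : ∀ i, A i)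
    (s' : ∀ i, S i) : ℝ :=
  ∏ i, π i (s i) (a i) * G.P i (s i) (a i) (s' i)

/-- Expectation of `f a s'`, where `a` is the next joint action and `s'` the next joint state. -/
def Game.stepMean (G : Game n S A) (π : ∀ i, S i → A i → ℝ) (s : ∀ i, S i)
    (f : (∀ i, A i) → (∀ i, S i) → ℝ) : ℝ :=
  ∑ a, ∑ s', G.stepProb π s a s' * f a s'

section StepMean

variable (G : Game n S A) {π : ∀ i, S i → A i → ℝ} (hπ : ∀ i, IsStationaryPolicy (π i))
include hπ

theorem Game.stepProb_nonneg (s : ∀ i, S i) (a : ∀ i, A i) (s' : ∀ i, S i) :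
    0 ≤ G.stepProb π s a s' :=
  Finset.prod_nonneg fun i _ =>
    mul_nonneg ((hπ i (s i)).1 (a i)) ((G.P_isTransition i (s i) (a i)).1 (s' i))

theorem Game.stepMean_mono {s : ∀ i, S i} {f g : (∀ i, A i) → (∀ i, S i) → ℝ}
    (hfg : ∀ a s', f a s' ≤ g a s') : G.stepMean π s f ≤ G.stepMean π s g :=
  Finset.sum_le_sum fun a _ => Finset.sum_le_sum fun s' _ =>
    mul_le_mul_of_nonneg_left (hfg a s') (G.stepProb_nonneg hπ s a s')

theorem Game.sum_policy_mul_transition (i : Fin n) (s : S i) :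
    ∑ a, ∑ s', π i s a * G.P i s a s' = 1 := by
  simp only [← Finset.mul_sum, (G.P_isTransition i s _).2, mul_one, (hπ i s).2]

theorem Game.stepMean_const (s : ∀ i, S i) (c : ℝ) : G.stepMean π s (fun _ _ => c) = c := by
  simp only [Game.stepMean, ← Finset.sum_mul, Game.stepProb]
  rw [sum_sum_prod (fun i a s' => π i (s i) a * G.P i (s i) a s'),
    Finset.prod_eq_one fun i _ => G.sum_policy_mul_transition hπ i (s i), one_mul]

/-- The expectation of a quantity that concerns one player only involves only that player, because
the players act and move independently. -/
theorem Game.stepMean_single (s : ∀ i, S i) (i : Fin n) (f : A i → S i → ℝ) :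
    G.stepMean π s (fun a s' => f (a i) (s' i)) =
      ∑ a, ∑ s', π i (s i) a * G.P i (s i) a s' * f a s' := by
  classical
  set F : ∀ j, A j → S j → ℝ := fun j a s' => π j (s j) a * G.P j (s j) a s' with hF
  set F' : ∀ j, A j → S j → ℝ := Function.update F i (fun a s' => F i a s' * f a s') with hF'
  have h1 : ∀ a s', G.stepProb π s a s' * f (a i) (s' i) = ∏ j, F' j (a j) (s' j) := by
    intro a s'
    have hne : ∏ j ∈ Finset.univ.erase i, F' j (a j) (s' j) =
        ∏ j ∈ Finset.univ.erase i, F j (a j) (s' j) := Finset.prod_congr rfl fun j hj => by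
      simp only [F', Function.update_of_ne (Finset.ne_of_mem_erase hj)]
    have hi : F' i (a i) (s' i) = F i (a i) (s' i) * f (a i) (s' i) := by
      simp only [F', Function.update_self]
    rw [← Finset.mul_prod_erase Finset.univ (fun j => F' j (a j) (s' j)) (Finset.mem_univ i), hne,
      hi, Game.stepProb, ← Finset.mul_prod_erase Finset.univ _ (Finset.mem_univ i)]
    ring
  simp only [Game.stepMean, h1]
  rw [sum_sum_prod, ← Finset.mul_prod_erase Finset.univ _ (Finset.mem_univ i),
    Finset.prod_eq_one (s := Finset.univ.erase i) (fun j hj => by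
      simp only [F', Function.update_of_ne (Finset.ne_of_mem_erase hj), F]
      exact G.sum_policy_mul_transition hπ j (s j))]
  simp only [F', F, Function.update_self, mul_one]

end StepMean

theorem Game.stepMean_add (G : Game n S A) (π : ∀ i, S i → A i → ℝ) (s : ∀ i, S i)
    (f g : (∀ i, A i) → (∀ i, S i) → ℝ) :
    G.stepMean π s (fun a s' => f a s' + g a s') = G.stepMean π s f + G.stepMean π s g := by
  simp only [Game.stepMean, mul_add, Finset.sum_add_distrib]

theorem Game.stepMean_const_mul (G : Game n S A) (π : ∀ i, S i → A i → ℝ) (s : ∀ i, S i)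
    (c : ℝ) (f : (∀ i, A i) → (∀ i, S i) → ℝ) :
    G.stepMean π s (fun a s' => c * f a s') = c * G.stepMean π s f := by
  simp only [Game.stepMean, Finset.mul_sum]
  refine Finset.sum_congr rfl fun _ _ => Finset.sum_congr rfl fun _ _ => by ring

theorem Game.stepMean_sum (G : Game n S A) (π : ∀ i, S i → A i → ℝ) (s : ∀ i, S i)
    {ι : Type*} (I : Finset ι) (f : ι → (∀ i, A i) → (∀ i, S i) → ℝ) :
    G.stepMean π s (fun a s' => ∑ k ∈ I, f k a s') = ∑ k ∈ I, G.stepMean π s (f k) := by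
  classical
  induction I using Finset.induction_on with
  | empty => simp [Game.stepMean]
  | insert k I hk ih =>
    simp only [Finset.sum_insert hk, Game.stepMean_add, ih]

open Classical in
/-- Probability of the history just before the players act at the time `t`. -/
def Game.histProb (G : Game n S A)
    (pol : (ℕ → (∀ i, S i) × (∀ i, A i)) → ℕ → ∀ i, S i → A i → ℝ)
    (x : ℕ → (∀ i, S i) × (∀ i, A i)) (t : ℕ) : ℝ :=
  (if (x 0).1 = G.s0 then 1 else 0) *
    (∏ l ∈ Finset.range t, ∏ i, pol x l i ((x l).1 i) ((x l).2 i)) *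
    ∏ l ∈ Finset.range t, ∏ i, G.P i ((x l).1 i) ((x l).2 i) ((x (l + 1)).1 i)

section Play

variable {G : Game n S A} {pol : (ℕ → (∀ i, S i) × (∀ i, A i)) → ℕ → ∀ i, S i → A i → ℝ}
  (hna : ∀ t, PreDet t (fun x => pol x t)) (hpol : ∀ x t i, IsStationaryPolicy (pol x t i))

include hpol in
theorem Game.histProb_nonneg (x : ℕ → (∀ i, S i) × (∀ i, A i)) (t : ℕ) :
    0 ≤ G.histProb pol x t := by
  classical
  refine mul_nonneg (mul_nonneg ?_ ?_) ?_
  · split_ifs <;> norm_num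
  · exact Finset.prod_nonneg fun l _ => Finset.prod_nonneg fun i _ => (hpol x l i _).1 _
  · exact Finset.prod_nonneg fun l _ => Finset.prod_nonneg fun i _ =>
      (G.P_isTransition i _ _).1 _

include hna in
/-- The factor of `pathProb` that is due to the last action splits off. -/
theorem Game.pathProb_update (x : ℕ → (∀ i, S i) × (∀ i, A i)) (t : ℕ) (a : ∀ i, A i) :
    G.pathProb pol (Function.update x t ((x t).1, a)) t =
      G.histProb pol x t * ∏ i, pol x t i ((x t).1 i) (a i) := by
  set y := Function.update x t ((x t).1, a) with hy
  have hyl : ∀ l, l ≠ t → y l = x l := fun l hl => Function.update_of_ne hl _ _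
  have hy1 : ∀ l, (y l).1 = (x l).1 := fun l => by
    rcases eq_or_ne l t with rfl | h
    · simp [hy]
    · rw [hyl l h]
  have hp : ∀ l ≤ t, pol y l = pol x l := fun l hl =>
    hna l y x (fun k hk => hyl k (by omega)) (hy1 l)
  have hyt : (y t).2 = a := by simp [hy]
  have h1 : ∏ l ∈ Finset.range t, ∏ i, pol y l i ((y l).1 i) ((y l).2 i) =
      ∏ l ∈ Finset.range t, ∏ i, pol x l i ((x l).1 i) ((x l).2 i) :=
    Finset.prod_congr rfl fun l hl => by
      have hl := Finset.mem_range.1 hl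
      rw [hp l hl.le, hyl l hl.ne]
  have h2 : ∏ l ∈ Finset.range t, ∏ i, G.P i ((y l).1 i) ((y l).2 i) ((y (l + 1)).1 i) =
      ∏ l ∈ Finset.range t, ∏ i, G.P i ((x l).1 i) ((x l).2 i) ((x (l + 1)).1 i) :=
    Finset.prod_congr rfl fun l hl => by
      have hl := Finset.mem_range.1 hl
      rw [hy1 (l + 1), hyl l hl.ne]
  rw [Game.pathProb, Game.histProb, Finset.prod_range_succ, hy1 0, hp t le_rfl, hy1 t, hyt, h1, h2]
  ring

include hna in
theorem Game.histProb_extPath (x : ℕ → (∀ i, S i) × (∀ i, A i)) (t : ℕ) (a : ∀ i, A i)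
    (s' : ∀ i, S i) : G.histProb pol (extPath x t a s') (t + 1) =
      G.histProb pol x t * G.stepProb (pol x t) (x t).1 a s' := by
  set y := extPath x t a s' with hy
  have hyl : ∀ l < t, y l = x l := fun l hl => extPath_lt x a s' hl
  have hy1 : ∀ l ≤ t, (y l).1 = (x l).1 := fun l hl => by
    rcases hl.eq_or_lt with rfl | h
    · simp [hy]
    · rw [hyl l h]
  have hp : ∀ l ≤ t, pol y l = pol x l := fun l hl => (hna l).extPath hl x a s'
  have h1 : ∏ l ∈ Finset.range t, ∏ i, pol y l i ((y l).1 i) ((y l).2 i) =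
      ∏ l ∈ Finset.range t, ∏ i, pol x l i ((x l).1 i) ((x l).2 i) :=
    Finset.prod_congr rfl fun l hl => by
      have hl := Finset.mem_range.1 hl
      rw [hp l hl.le, hyl l hl]
  have h2 : ∏ l ∈ Finset.range t, ∏ i, G.P i ((y l).1 i) ((y l).2 i) ((y (l + 1)).1 i) =
      ∏ l ∈ Finset.range t, ∏ i, G.P i ((x l).1 i) ((x l).2 i) ((x (l + 1)).1 i) :=
    Finset.prod_congr rfl fun l hl => by
      have hl := Finset.mem_range.1 hl
      rw [hy1 (l + 1) hl, hyl l hl]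
  rw [Game.histProb, Game.histProb, Finset.prod_range_succ, Finset.prod_range_succ,
    hy1 0 (Nat.zero_le t), hp t le_rfl, h1, h2]
  simp only [hy, extPath_self, extPath_succ, Game.stepProb, Finset.prod_mul_distrib]
  ring

include hna in
theorem Game.preDet_stepMean {t : ℕ} {F : (ℕ → (∀ i, S i) × (∀ i, A i)) → ℝ}
    (hF : PreDet (t + 1) F) :
    PreDet t (fun x => G.stepMean (pol x t) (x t).1 (fun a s' => F (extPath x t a s'))) := by
  intro x y hxy hxyt
  simp only [hna t x y hxy hxyt, hxyt]
  congr 1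
  ext a s'
  refine hF _ _ (fun l hl => ?_) (by simp)
  rcases (Nat.lt_succ_iff.1 hl).eq_or_lt with rfl | hl
  · simp [hxyt]
  · rw [extPath_lt x a s' hl, extPath_lt y a s' hl, hxy l hl]

variable {Ω : Type*} [MeasurableSpace Ω] {μ : Measure Ω}
  {X : ℕ → Ω → (∀ i, S i) × (∀ i, A i)}

theorem Game.IsPlay.measurableSet_le (hX : G.IsPlay pol μ X) (t : ℕ)
    (x : ℕ → (∀ i, S i) × (∀ i, A i)) : MeasurableSet {ω | ∀ l ≤ t, X l ω = x l} := by
  simp only [Set.ofPred_forall]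
  exact MeasurableSet.iInter fun l => MeasurableSet.iInter fun _ => hX.meas l (x l)

omit [∀ i, Fintype (S i)] [∀ i, Fintype (A i)] [MeasurableSpace Ω] in
theorem hist_event (t : ℕ) (x : ℕ → (∀ i, S i) × (∀ i, A i)) :
    {ω | hist t (fun l => X l ω) = hist t x} =
      ⋃ a : ∀ i, A i, {ω | ∀ l ≤ t, X l ω = Function.update x t ((x t).1, a) l} := by
  ext ω
  simp only [Set.mem_ofPred_eq, Set.mem_iUnion, hist_eq_iff]
  constructor
  · rintro ⟨h1, h2⟩
    refine ⟨(X t ω).2, fun l hl => ?_⟩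
    rcases hl.eq_or_lt with rfl | hl
    · rw [Function.update_self, ← h2]
    · rw [Function.update_of_ne hl.ne, h1 l hl]
  · rintro ⟨a, ha⟩
    refine ⟨fun l hl => ?_, ?_⟩
    · rw [ha l hl.le, Function.update_of_ne hl.ne]
    · rw [ha t le_rfl, Function.update_self]

theorem Game.IsPlay.measurableSet_hist_path (hX : G.IsPlay pol μ X) (t : ℕ)
    (x : ℕ → (∀ i, S i) × (∀ i, A i)) :
    MeasurableSet {ω | hist t (fun l => X l ω) = hist t x} := by
  rw [hist_event]
  exact MeasurableSet.iUnion fun a => hX.measurableSet_le t _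

include hna hpol in
/-- The law of the history: sum the law of the path over the last action. -/
theorem Game.IsPlay.measureReal_hist (hX : G.IsPlay pol μ X) (t : ℕ)
    (x : ℕ → (∀ i, S i) × (∀ i, A i)) :
    μ.real {ω | hist t (fun l => X l ω) = hist t x} = G.histProb pol x t := by
  have h0 := G.histProb_nonneg hpol x t
  have hp0 : ∀ a : ∀ i, A i, 0 ≤ ∏ i, pol x t i ((x t).1 i) (a i) := fun a =>
    Finset.prod_nonneg fun i _ => (hpol x t i _).1 _
  have : μ {ω | hist t (fun l => X l ω) = hist t x} = ENNReal.ofReal (G.histProb pol x t) := by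
    rw [hist_event, measure_iUnion ?_ fun a => hX.measurableSet_le t _]
    · simp only [hX.law, Game.pathProb_update hna]
      rw [tsum_fintype, ← ENNReal.ofReal_sum_of_nonneg fun a _ => mul_nonneg h0 (hp0 a),
        ← Finset.mul_sum]
      congr 1
      have := Fintype.prod_sum fun i (a : A i) => pol x t i ((x t).1 i) a
      rw [← this, Finset.prod_eq_one fun i _ => (hpol x t i _).2, mul_one]
    · intro a b hab
      refine Set.disjoint_left.2 fun ω ha hb => hab ?_
      have h1 := ha t le_rfl
      have h2 := hb t le_rfl
      rw [Function.update_self] at h1 h2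
      rw [h1] at h2
      exact (Prod.mk.inj h2).2
  rw [measureReal_def, this, ENNReal.toReal_ofReal h0]

variable [IsProbabilityMeasure μ]

omit [∀ i, Fintype (S i)] [∀ i, Fintype (A i)] in
/-- There is a joint action, because the process `X` takes one at the time `0`. -/
theorem exists_action (μ : Measure Ω) [IsProbabilityMeasure μ]
    (X : ℕ → Ω → (∀ i, S i) × (∀ i, A i)) : Nonempty (∀ i, A i) := by
  have : Nonempty Ω := nonempty_of_isProbabilityMeasure μ
  exact this.map fun ω => (X 0 ω).2

theorem Game.IsPlay.measurableSet_hist (hX : G.IsPlay pol μ X) (t : ℕ)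
    (z : (Fin t → (∀ i, S i) × (∀ i, A i)) × (∀ i, S i)) :
    MeasurableSet {ω | hist t (fun l => X l ω) = z} := by
  obtain ⟨a₀⟩ := exists_action μ X
  rw [← hist_pathOfHist a₀ z]
  exact hX.measurableSet_hist_path t _

theorem Game.IsPlay.integrable (hX : G.IsPlay pol μ X) {t : ℕ}
    {F : (ℕ → (∀ i, S i) × (∀ i, A i)) → ℝ} (hF : PreDet t F) :
    Integrable (fun ω => F fun l => X l ω) μ := by
  obtain ⟨a₀⟩ := exists_action μ X
  classical
  have := integrable_comp_of_finite (μ := μ) (hX.measurableSet_hist t)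
    (fun z => F (pathOfHist a₀ z))
  refine this.congr (Eventually.of_forall fun ω => ?_)
  exact hF.eq_of_hist (hist_pathOfHist a₀ _)

theorem Game.IsPlay.measurableSet (hX : G.IsPlay pol μ X) {t : ℕ}
    {B : Set (ℕ → (∀ i, S i) × (∀ i, A i))} (hB : PreDet t (· ∈ B)) :
    MeasurableSet {ω | (fun l => X l ω) ∈ B} := by
  obtain ⟨a₀⟩ := exists_action μ X
  have : {ω | (fun l => X l ω) ∈ B} =
      ⋃ z ∈ {z : (Fin t → (∀ i, S i) × (∀ i, A i)) × (∀ i, S i) | pathOfHist a₀ z ∈ B},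
        {ω | hist t (fun l => X l ω) = z} := by
    ext ω
    simp only [Set.mem_ofPred_eq, Set.mem_iUnion, exists_prop, exists_eq_right']
    exact (hB.eq_of_hist (hist_pathOfHist a₀ _)).symm.to_iff
  rw [this]
  exact MeasurableSet.biUnion (Set.to_countable _) fun z _ => hX.measurableSet_hist t z

include hna hpol in
/-- The Markov property: integrating out the action at the time `t` and the state at the time
`t + 1`. -/
theorem Game.IsPlay.integral_step (hX : G.IsPlay pol μ X) {t : ℕ}
    {F : (ℕ → (∀ i, S i) × (∀ i, A i)) → ℝ} (hF : PreDet (t + 1) F) :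
    ∫ ω, F (fun l => X l ω) ∂μ =
      ∫ ω, G.stepMean (pol (fun l => X l ω) t) (X t ω).1
        (fun a s' => F (extPath (fun l => X l ω) t a s')) ∂μ := by
  classical
  obtain ⟨a₀⟩ := exists_action μ X
  set rep : (Fin t → (∀ i, S i) × (∀ i, A i)) × (∀ i, S i) → ℕ → (∀ i, S i) × (∀ i, A i) :=
    pathOfHist a₀ with hrep
  have hhrep : ∀ z, hist t (rep z) = z := hist_pathOfHist a₀
  have hpre := Game.preDet_stepMean (G := G) hna hF
  let g : Ω → ((Fin t → (∀ i, S i) × (∀ i, A i)) × (∀ i, S i)) × ((∀ i, A i) × (∀ i, S i)) :=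
    fun ω => (hist t (fun l => X l ω), (X t ω).2, (X (t + 1) ω).1)
  have hg : ∀ z a s', {ω | g ω = (z, a, s')} =
      {ω | hist (t + 1) (fun l => X l ω) = hist (t + 1) (extPath (rep z) t a s')} := by
    intro z a s'
    ext ω
    have hz := hhrep z
    simp only [g, Set.mem_ofPred_eq, Prod.mk.injEq, hist_eq_iff, extPath_succ]
    constructor
    · rintro ⟨h1, h2, h3⟩
      rw [← hz, hist_eq_iff] at h1
      refine ⟨fun l hl => ?_, h3⟩
      rcases (Nat.lt_succ_iff.1 hl).eq_or_lt with rfl | hl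
      · rw [extPath_self, ← h1.2, ← h2]
      · rw [extPath_lt _ a s' hl, h1.1 l hl]
    · rintro ⟨h1, h2⟩
      have ht := h1 t (Nat.lt_succ_self t)
      rw [extPath_self] at ht
      refine ⟨?_, by rw [ht], h2⟩
      rw [← hz, hist_eq_iff]
      refine ⟨fun l hl => ?_, by rw [ht]⟩
      rw [h1 l (Nat.lt_succ_of_lt hl), extPath_lt _ a s' hl]
  have hL : ∫ ω, F (fun l => X l ω) ∂μ = ∫ ω, (fun v => F (extPath (rep v.1) t v.2.1 v.2.2)) (g ω) ∂μ := by
    congr 1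
    ext ω
    have hz := hhrep (hist t (fun l => X l ω))
    rw [hist_eq_iff] at hz
    refine hF _ _ (fun l hl => ?_) (by simp [g])
    rcases (Nat.lt_succ_iff.1 hl).eq_or_lt with rfl | hl
    · simp only [g, extPath_self, hz.2]
    · simp only [g, extPath_lt _ _ _ hl, hz.1 l hl]
  have hR : ∫ ω, G.stepMean (pol (fun l => X l ω) t) (X t ω).1
        (fun a s' => F (extPath (fun l => X l ω) t a s')) ∂μ =
      ∫ ω, (fun z => G.stepMean (pol (rep z) t) (rep z t).1
        (fun a s' => F (extPath (rep z) t a s'))) (hist t (fun l => X l ω)) ∂μ := by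
    congr 1
    ext ω
    exact (hpre.eq_of_hist (hhrep (hist t (fun l => X l ω)))).symm
  rw [hL, hR, integral_comp_of_finite (g := g) ?_ (fun v => F (extPath (rep v.1) t v.2.1 v.2.2)),
    integral_comp_of_finite (hX.measurableSet_hist t)
      (fun z => G.stepMean (pol (rep z) t) (rep z t).1 (fun a s' => F (extPath (rep z) t a s'))),
    Fintype.sum_prod_type]
  · refine Finset.sum_congr rfl fun z _ => ?_
    rw [Fintype.sum_prod_type]
    have h1 : μ.real {ω | hist t (fun l => X l ω) = z} = G.histProb pol (rep z) t := by
      rw [← hX.measureReal_hist hna hpol t (rep z), hhrep]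
    rw [h1, Game.stepMean, Finset.mul_sum]
    refine Finset.sum_congr rfl fun a _ => ?_
    rw [Finset.mul_sum]
    refine Finset.sum_congr rfl fun s' _ => ?_
    rw [hg, hX.measureReal_hist hna hpol, Game.histProb_extPath hna]
    ring
  · rintro ⟨z, a, s'⟩
    rw [hg]
    exact hX.measurableSet_hist _ _

include hna hpol in
/-- Supermartingale inequality for expectations. -/
theorem Game.IsPlay.integral_succ_le (hX : G.IsPlay pol μ X) {t : ℕ}
    {F F' : (ℕ → (∀ i, S i) × (∀ i, A i)) → ℝ} (hF : PreDet t F) (hF' : PreDet (t + 1) F')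
    (hstep : ∀ x, G.stepMean (pol x t) (x t).1 (fun a s' => F' (extPath x t a s')) ≤ F x) :
    ∫ ω, F' (fun l => X l ω) ∂μ ≤ ∫ ω, F (fun l => X l ω) ∂μ := by
  rw [hX.integral_step hna hpol hF']
  exact integral_mono (hX.integrable (Game.preDet_stepMean hna hF')) (hX.integrable hF)
    fun ω => hstep _

include hna hpol in
/-- The maximal inequality for nonnegative supermartingales: `W` has to decrease on average only
as long as `B` has not occurred. -/
theorem Game.IsPlay.measure_exists_le (hX : G.IsPlay pol μ X)
    {B : ℕ → Set (ℕ → (∀ i, S i) × (∀ i, A i))} (hB : ∀ t, PreDet t (· ∈ B t))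
    {W : ℕ → (ℕ → (∀ i, S i) × (∀ i, A i)) → ℝ} (hW : ∀ t, PreDet t (W t))
    (hW0 : ∀ t x, 0 ≤ W t x) (hW1 : ∀ t, ∀ x ∈ B t, 1 ≤ W t x)
    (hstep : ∀ t, ∀ x ∉ B t,
      G.stepMean (pol x t) (x t).1 (fun a s' => W (t + 1) (extPath x t a s')) ≤ W t x)
    {w : ℝ} (hw : ∀ x, W 0 x ≤ w) :
    μ {ω | ∃ t, (fun l => X l ω) ∈ B t} ≤ ENNReal.ofReal w := by
  classical
  -- `W` stopped at the first occurrence of `B` and set to `1 ≤ W` afterwards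
  let Y : ℕ → (ℕ → (∀ i, S i) × (∀ i, A i)) → ℝ := fun t x =>
    if ∃ l < t, x ∈ B l then 1 else W t x
  have hpast : ∀ t, PreDet t (· ∈ {x | ∃ l < t, x ∈ B l}) := by
    intro t x y hxy hxyt
    simp only [Set.mem_ofPred_eq]
    refine propext (exists_congr fun l => and_congr_right fun hl => ?_)
    exact (((hB l).mono hl.le) x y hxy hxyt).to_iff
  have hY : ∀ t, PreDet t (Y t) := by
    intro t x y hxy hxyt
    have := hpast t x y hxy hxyt
    simp only [Set.mem_ofPred_eq] at this
    simp only [Y, this, hW t x y hxy hxyt]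
  have hYint : ∀ t, Integrable (fun ω => Y t fun l => X l ω) μ := fun t => hX.integrable (hY t)
  have hdec : ∀ t, ∫ ω, Y t (fun l => X l ω) ∂μ ≤ w := by
    intro t
    induction t with
    | zero =>
      calc ∫ ω, Y 0 (fun l => X l ω) ∂μ ≤ ∫ _, w ∂μ :=
            integral_mono (hYint 0) (integrable_const _) fun ω => by simpa [Y] using hw _
        _ = w := by simp
    | succ t ih =>
      refine le_trans (hX.integral_succ_le hna hpol (hY t) (hY (t + 1)) fun x => ?_) ih
      have hmem : ∀ l ≤ t, ∀ a s', extPath x t a s' ∈ B l ↔ x ∈ B l := fun l hl a s' =>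
        ((hB l).extPath hl x a s').to_iff
      by_cases h : ∃ l ≤ t, x ∈ B l
      · have h1 : ∀ a s', Y (t + 1) (extPath x t a s') = 1 := by
          intro a s'
          obtain ⟨l, hl, hxl⟩ := h
          exact if_pos ⟨l, Nat.lt_succ_of_le hl, (hmem l hl a s').2 hxl⟩
        simp only [h1, Game.stepMean_const G (hpol x t)]
        by_cases h' : ∃ l < t, x ∈ B l
        · exact (if_pos h').ge
        · have hxt : x ∈ B t := by
            obtain ⟨l, hl, hxl⟩ := h
            rcases hl.eq_or_lt with rfl | hl
            · exact hxl
            · exact absurd ⟨l, hl, hxl⟩ h'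
          simp only [Y, if_neg h']
          exact hW1 t x hxt
      · have h1 : ∀ a s', Y (t + 1) (extPath x t a s') = W (t + 1) (extPath x t a s') := by
          intro a s'
          refine if_neg ?_
          rintro ⟨l, hl, hxl⟩
          exact h ⟨l, Nat.lt_succ_iff.1 hl, (hmem l (Nat.lt_succ_iff.1 hl) a s').1 hxl⟩
        have h2 : ¬ ∃ l < t, x ∈ B l := fun ⟨l, hl, hxl⟩ => h ⟨l, hl.le, hxl⟩
        simp only [h1, Y, if_neg h2]
        exact hstep t x fun hx => h ⟨t, le_rfl, hx⟩
  have hw0 : ∀ t, μ {ω | ∃ l < t, (fun l => X l ω) ∈ B l} ≤ ENNReal.ofReal w := by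
    intro t
    have hm := hX.measurableSet (hpast t)
    have h1 : μ.real {ω | ∃ l < t, (fun l => X l ω) ∈ B l} ≤ w := by
      refine le_trans ?_ (hdec t)
      have h2 := integral_indicator_const (μ := μ) (1 : ℝ) hm
      simp only [smul_eq_mul, mul_one] at h2
      have h3 : μ.real {ω | ∃ l < t, (fun l => X l ω) ∈ B l} =
        ∫ a, ({ω | (fun l ↦ X l ω) ∈ {x | ∃ l < t, x ∈ B l}}).indicator (fun _ => (1 : ℝ)) a ∂μ :=
        h2.symm
      rw [h3]
      refine integral_mono ((integrable_const _).indicator hm) (hYint t) fun ω => ?_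
      simp only [Set.indicator_apply, Set.mem_ofPred_eq, Y]
      split_ifs
      · exact le_rfl
      · exact hW0 t _
    rw [← ENNReal.ofReal_toReal (measure_ne_top μ _)]
    exact ENNReal.ofReal_le_ofReal h1
  have hU : {ω | ∃ t, (fun l => X l ω) ∈ B t} = ⋃ t, {ω | ∃ l < t, (fun l => X l ω) ∈ B l} := by
    ext ω
    simp only [Set.mem_ofPred_eq, Set.mem_iUnion]
    exact ⟨fun ⟨t, ht⟩ => ⟨t + 1, t, Nat.lt_succ_self t, ht⟩, fun ⟨_, t, _, ht⟩ => ⟨t, ht⟩⟩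
  have hmono : Monotone fun t => {ω | ∃ l < t, (fun l => X l ω) ∈ B l} := by
    rintro t t' htt' ω ⟨l, hl, h⟩
    exact ⟨l, hl.trans_le htt', h⟩
  rw [hU, hmono.measure_iUnion]
  exact iSup_le hw0

/-- The filtration of the histories before the players act. -/
def Game.IsPlay.filtration (hX : G.IsPlay pol μ X) :
    Filtration ℕ (inferInstance : MeasurableSpace Ω) where
  seq t := MeasurableSpace.comap (fun ω => hist t fun l => X l ω) ⊤
  mono' := by
    refine monotone_nat_of_le_succ fun t => ?_
    have : (fun ω => hist t fun l => X l ω) =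
        (fun z : (Fin (t + 1) → (∀ i, S i) × (∀ i, A i)) × (∀ i, S i) =>
          ((fun l : Fin t => z.1 l.castSucc), (z.1 (Fin.last t)).1)) ∘
          fun ω => hist (t + 1) fun l => X l ω := rfl
    rw [this, ← MeasurableSpace.comap_comp]
    exact MeasurableSpace.comap_mono le_top
  le' t := by
    rintro _ ⟨B, -, rfl⟩
    have : (fun ω => hist t fun l => X l ω) ⁻¹' B =
        ⋃ z ∈ B, {ω | hist t (fun l => X l ω) = z} := by
      ext ω; simp
    rw [this]
    exact MeasurableSet.biUnion (Set.to_countable _) fun z _ => hX.measurableSet_hist t z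

include hna hpol in
/-- Martingale convergence: a process that has centred increments and is bounded in `L²` converges
almost surely. -/
theorem Game.IsPlay.ae_exists_tendsto (hX : G.IsPlay pol μ X)
    {Y : ℕ → (ℕ → (∀ i, S i) × (∀ i, A i)) → ℝ} (hY : ∀ t, PreDet t (Y t))
    (hstep : ∀ t x, G.stepMean (pol x t) (x t).1
      (fun a s' => Y (t + 1) (extPath x t a s')) = Y t x)
    {B : ℝ} (hB : ∀ t, ∫ ω, Y t (fun l => X l ω) ^ 2 ∂μ ≤ B) :
    ∀ᵐ ω ∂μ, ∃ c, Tendsto (fun t => Y t fun l => X l ω) atTop (𝓝 c) := by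
  classical
  have hint : ∀ t, Integrable (fun ω => Y t fun l => X l ω) μ := fun t => hX.integrable (hY t)
  obtain ⟨a₀⟩ := exists_action μ X
  have hmart : Martingale (fun t ω => Y t fun l => X l ω) hX.filtration μ := by
    refine martingale_of_setIntegral_eq_succ ?_ hint ?_
    · intro t
      have h1 : (fun ω => Y t fun l => X l ω) =
          (fun z => Y t (pathOfHist a₀ z)) ∘ fun ω => hist t fun l => X l ω := by
        ext ω
        exact ((hY t).eq_of_hist (hist_pathOfHist a₀ _)).symm
      have h2 : Measurable[hX.filtration t] (fun ω => Y t fun l => X l ω) := by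
        rw [h1]
        exact @Measurable.comp _ _ _ _ ⊤ _ _ _ measurable_from_top (comap_measurable _)
      exact h2.stronglyMeasurable
    · rintro t _ ⟨B, -, rfl⟩
      have hm : MeasurableSet ((fun ω => hist t fun l => X l ω) ⁻¹' B) :=
        hX.filtration.le t _ ⟨B, trivial, rfl⟩
      rw [← integral_indicator hm, ← integral_indicator hm]
      let F : (ℕ → (∀ i, S i) × (∀ i, A i)) → ℝ := fun x => if hist t x ∈ B then Y (t + 1) x else 0
      have hhist : PreDet t (fun x : ℕ → (∀ i, S i) × (∀ i, A i) => hist t x) :=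
        fun x y h1 h2 => hist_eq_iff.2 ⟨h1, h2⟩
      have hF : PreDet (t + 1) F := by
        intro x y hxy hxyt
        simp only [F, (hhist.mono (Nat.le_succ t)) x y hxy hxyt, hY (t + 1) x y hxy hxyt]
      have h1 := hX.integral_step hna hpol hF
      have h2 : ∀ x, G.stepMean (pol x t) (x t).1 (fun a s' => F (extPath x t a s')) =
          if hist t x ∈ B then Y t x else 0 := by
        intro x
        simp only [F, hhist.extPath le_rfl x]
        split_ifs
        · exact hstep t x
        · exact G.stepMean_const (hpol x t) _ 0
      have h3 : ∫ ω, F (fun l => X l ω) ∂μ =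
          ∫ ω, (if hist t (fun l => X l ω) ∈ B then Y t (fun l => X l ω) else 0) ∂μ := by
        rw [h1]
        exact integral_congr_ae (Eventually.of_forall fun ω => h2 fun l => X l ω)
      simp only [Set.indicator_apply, Set.mem_preimage]
      exact h3.symm
  have hB0 : 0 ≤ B := le_trans (integral_nonneg fun ω => sq_nonneg _) (hB 0)
  have hbdd : ∀ t, eLpNorm (fun ω => Y t fun l => X l ω) 1 μ ≤ (Real.toNNReal (1 + B) : NNReal) := by
    intro t
    rw [eLpNorm_one_eq_lintegral_enorm, ← ofReal_integral_norm_eq_lintegral_enorm (hint t)]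
    refine ENNReal.ofReal_le_ofReal ?_
    have hsq : Integrable (fun ω => Y t (fun l => X l ω) ^ 2) μ :=
      hX.integrable (t := t) (F := fun x => Y t x ^ 2) fun x y h1 h2 => by simp only [hY t x y h1 h2]
    calc ∫ ω, ‖Y t fun l => X l ω‖ ∂μ ≤ ∫ ω, (1 + Y t (fun l => X l ω) ^ 2) ∂μ := by
          refine integral_mono (hint t).norm ((integrable_const _).add hsq) fun ω => ?_
          change ‖Y t fun l => X l ω‖ ≤ 1 + Y t (fun l => X l ω) ^ 2
          rw [Real.norm_eq_abs]
          nlinarith [sq_nonneg (|Y t fun l => X l ω| - 1), sq_abs (Y t fun l => X l ω)]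
      _ = 1 + ∫ ω, Y t (fun l => X l ω) ^ 2 ∂μ := by
          rw [integral_add (integrable_const _) hsq]; simp
      _ ≤ 1 + B := by linarith [hB t]
  filter_upwards [hmart.submartingale.exists_ae_tendsto_of_bdd hbdd] with ω hω using hω

end Play

end Histories

/-! ### Invariants of the algorithm -/

section Algorithm

variable {n : ℕ} {S A : Fin n → Type*} [∀ i, Fintype (S i)] [∀ i, Fintype (A i)]
  {G : Game n S A} {θ : AlgParams n S A}

/-- The warm-up phase is over. -/
def AlgParams.Sampling (θ : AlgParams n S A) (σ : AlgState n S A) : Prop :=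
  θ.d σ.episode ≤ (σ.clock : ℝ)

/-- Number of steps of the warm-up phase of the episode `k`. -/
def AlgParams.warmup (θ : AlgParams n S A) (k : ℕ) : ℕ := ⌈θ.d k⌉₊

omit [∀ i, Fintype (S i)] [∀ i, Fintype (A i)] in
theorem AlgParams.sampling_iff (σ : AlgState n S A) :
    θ.Sampling σ ↔ θ.warmup σ.episode ≤ σ.clock :=
  Nat.ceil_le.symm

/-- The data of player `i` after one more observation, before a possible end of the episode. -/
def Game.observed (G : Game n S A) (θ : AlgParams n S A) (σ : AlgState n S A) (s : ∀ i, S i)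
    (a : ∀ i, A i) (s' : ∀ i, S i) (i : Fin n) : PlayerState (S i) (A i) :=
  (σ.player i).observe (θ.Sampling σ) (s i) (a i) (s' i) (G.r i s a)

/-- The episode ends with this step. -/
def Game.EpisodeEnds (G : Game n S A) (θ : AlgParams n S A) (σ : AlgState n S A) (s : ∀ i, S i)
    (a : ∀ i, A i) (s' : ∀ i, S i) : Prop :=
  θ.Sampling σ ∧ ∀ i, (G.observed θ σ s a s' i).todo = ∅

section Step

variable {σ : AlgState n S A} {s : ∀ i, S i} {a : ∀ i, A i} {s' : ∀ i, S i}

theorem Game.algStep_of_ends (h : G.EpisodeEnds θ σ s a s') : G.algStep θ σ s a s' =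
    { episode := σ.episode + 1
      clock := 0
      player := fun i => (G.observed θ σ s a s' i).endEpisode (θ.δ i) (θ.h i) (θ.η σ.episode)
        (θ.rad i σ.episode) } := by
  unfold Game.algStep
  exact if_pos h

theorem Game.algStep_of_not_ends (h : ¬ G.EpisodeEnds θ σ s a s') : G.algStep θ σ s a s' =
    { episode := σ.episode
      clock := σ.clock + 1
      player := G.observed θ σ s a s' } := by
  unfold Game.algStep
  exact if_neg h

@[simp] theorem Game.observed_qhat (i : Fin n) :
    (G.observed θ σ s a s' i).qhat = (σ.player i).qhat := rfl

open Classical in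
theorem Game.observed_count (i : Fin n) (x : S i) (b : A i) (y : S i) :
    (G.observed θ σ s a s' i).count x b y =
      (σ.player i).count x b y + if x = s i ∧ b = a i ∧ y = s' i then 1 else 0 := rfl

open Classical in
theorem Game.sum_observed_count (i : Fin n) (x : S i) (b : A i) :
    ∑ y, (G.observed θ σ s a s' i).count x b y =
      ∑ y, (σ.player i).count x b y + if x = s i ∧ b = a i then 1 else 0 := by
  simp only [Game.observed_count, Finset.sum_add_distrib]
  congr 1
  by_cases h : x = s i ∧ b = a i
  · simp [h]
  · rw [if_neg h]
    exact Finset.sum_eq_zero fun y _ => if_neg fun h' => h ⟨h'.1, h'.2.1⟩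

open Classical in
theorem Game.observed_R (i : Fin n) (x : S i) (b : A i) :
    (G.observed θ σ s a s' i).R x b = (σ.player i).R x b +
      if θ.Sampling σ ∧ (s i, a i) ∈ (σ.player i).todo ∧ x = s i ∧ b = a i
        then G.r i s a else 0 := rfl

theorem Game.mem_observed_todo (i : Fin n) (x : S i) (b : A i) :
    (x, b) ∈ (G.observed θ σ s a s' i).todo ↔
      (x, b) ∈ (σ.player i).todo ∧ ¬ (θ.Sampling σ ∧ x = s i ∧ b = a i) := by
  classical
  unfold Game.observed PlayerState.observe
  by_cases h : θ.Sampling σ <;> simp [h]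

/-- The count of a state-action pair goes up with a visit, in particular before the pair leaves
the list of pairs still to be visited. -/
theorem Game.sum_observed_count_of_notMem {i : Fin n} {x : S i} {b : A i}
    (h : (x, b) ∈ (σ.player i).todo) (h' : (x, b) ∉ (G.observed θ σ s a s' i).todo) :
    ∑ y, (G.observed θ σ s a s' i).count x b y = ∑ y, (σ.player i).count x b y + 1 := by
  classical
  rw [Game.mem_observed_todo] at h'
  push Not at h'
  rw [Game.sum_observed_count, if_pos (h' h).2]

end Step

/-- Facts about the data of the algorithm that hold along every path. The reward vector vanishes
at the pairs that are still to be visited, so that every entry is written at most once and stays in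
`[0, 1]`; each pair is visited in every completed episode, so that the counters grow at least like
the number of the episode. -/
structure AlgState.Valid (θ : AlgParams n S A) (σ : AlgState n S A) : Prop where
  qhat_mem : ∀ i, (σ.player i).qhat ∈ shrunk (θ.δ i)
  confSet_convex : ∀ i, IsConvexConstraint (θ.δ i) (σ.player i).confSet
  one_le_episode : 1 ≤ σ.episode
  episode_le : ∀ i s a, σ.episode ≤ ∑ y, (σ.player i).count s a y + 1
  episode_le_of_notMem : ∀ i s a, (s, a) ∉ (σ.player i).todo →
    σ.episode ≤ ∑ y, (σ.player i).count s a y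
  R_mem : ∀ i s a, (σ.player i).R s a ∈ Set.Icc (0 : ℝ) 1
  R_eq_zero : ∀ i s a, (s, a) ∈ (σ.player i).todo → (σ.player i).R s a = 0
  todo_of_clock : σ.clock = 0 → ∀ i, (σ.player i).todo = Set.univ

variable (hδ : ∀ i, 0 < θ.δ i)
  (hne : ∀ i, (shrunk (θ.δ i) : Set (S i → A i → S i → ℝ)).Nonempty)

include hδ hne in
theorem AlgState.valid_init : (AlgState.init : AlgState n S A).Valid θ where
  qhat_mem i := uniform_mem_shrunk (hne i)
  confSet_convex i := isConvexConstraint_isTransition (hδ i)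
  one_le_episode := le_rfl
  episode_le i s a := by simp [AlgState.init]
  episode_le_of_notMem i s a h := absurd (Set.mem_univ _) h
  R_mem i s a := by simp [AlgState.init, PlayerState.init]
  R_eq_zero i s a _ := rfl
  todo_of_clock _ i := rfl

theorem AlgState.Valid.observed_R_mem {σ : AlgState n S A} (hσ : σ.Valid θ) (s : ∀ i, S i)
    (a : ∀ i, A i) (s' : ∀ i, S i) (i : Fin n) (x : S i) (b : A i) :
    (G.observed θ σ s a s' i).R x b ∈ Set.Icc (0 : ℝ) 1 := by
  classical
  rw [Game.observed_R]
  split_ifs with h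
  · obtain ⟨-, h1, rfl, rfl⟩ := h
    rw [hσ.R_eq_zero i _ _ h1, zero_add]
    exact G.r_mem i s a
  · rw [add_zero]; exact hσ.R_mem i x b

include hδ in
theorem AlgState.Valid.step {σ : AlgState n S A} (hσ : σ.Valid θ) (s : ∀ i, S i)
    (a : ∀ i, A i) (s' : ∀ i, S i) : (G.algStep θ σ s a s').Valid θ := by
  classical
  have hcount : ∀ i x b, (x, b) ∉ (G.observed θ σ s a s' i).todo →
      σ.episode ≤ ∑ y, (G.observed θ σ s a s' i).count x b y := by
    intro i x b h
    by_cases hxb : (x, b) ∈ (σ.player i).todo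
    · rw [Game.sum_observed_count_of_notMem hxb h]
      exact hσ.episode_le i x b
    · rw [Game.sum_observed_count]
      exact (hσ.episode_le_of_notMem i x b hxb).trans (Nat.le_add_right _ _)
  have hcount' : ∀ i x b, σ.episode ≤ ∑ y, (G.observed θ σ s a s' i).count x b y + 1 := by
    intro i x b
    rw [Game.sum_observed_count]
    have := hσ.episode_le i x b
    omega
  by_cases hend : G.EpisodeEnds θ σ s a s'
  · rw [Game.algStep_of_ends hend]
    refine ⟨fun i => ?_, fun i => ?_, by simp, fun i x b => ?_, fun i x b h => ?_, fun i x b => ?_,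
      fun i x b _ => rfl, fun _ i => rfl⟩
    · exact omdUpdate_mem_shrunk (hσ.qhat_mem i)
    · change IsConvexConstraint (θ.δ i) (confUpdate _ (confBox _ _) (σ.player i).confSet)
      unfold confUpdate
      split_ifs
      · exact (isConvexConstraint_confBox (hδ i) _ _).inter (hσ.confSet_convex i)
      · exact isConvexConstraint_confBox (hδ i) _ _
    · refine Nat.add_le_add_right (hcount i x b ?_) 1
      rw [hend.2 i]
      exact Set.notMem_empty _
    · exact absurd (Set.mem_univ _) h
    · exact ⟨le_rfl, zero_le_one⟩
  · rw [Game.algStep_of_not_ends hend]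
    refine ⟨fun i => hσ.qhat_mem i, fun i => hσ.confSet_convex i, hσ.one_le_episode,
      hcount', hcount, fun i x b => hσ.observed_R_mem s a s' i x b, fun i x b h => ?_,
      fun h => absurd h (Nat.succ_ne_zero _)⟩
    change (G.observed θ σ s a s' i).R x b = 0
    have h := (Game.mem_observed_todo i x b).1 h
    rw [Game.observed_R, hσ.R_eq_zero i x b h.1, if_neg fun h' => h.2 ⟨h'.1, h'.2.2⟩, add_zero]

include hδ hne in
theorem Game.algState_valid (x : ℕ → (∀ i, S i) × (∀ i, A i)) (t : ℕ) :
    (G.algState θ x t).Valid θ := by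
  induction t with
  | zero => exact AlgState.valid_init hδ hne
  | succ t ih => exact ih.step hδ _ _ _

theorem Game.preDet_algState (t : ℕ) : PreDet t (fun x => G.algState θ x t) := by
  induction t with
  | zero => exact fun _ _ _ _ => rfl
  | succ t ih =>
    refine PreDet.of_step fun x y hxy hxyt => ?_
    have := ih x y (fun l hl => hxy l hl.le) (by rw [hxy t le_rfl])
    simp only [Game.algState, hxyt, hxy t le_rfl]
    simp only at this
    rw [this]

theorem Game.preDet_algPolicy (t : ℕ) : PreDet t (fun x => G.algPolicy θ x t) := by
  intro x y hxy hxyt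
  have := Game.preDet_algState (G := G) (θ := θ) t x y hxy hxyt
  simp only at this
  ext i
  simp only [Game.algPolicy, this]

@[simp] theorem Game.algState_extPath (x : ℕ → (∀ i, S i) × (∀ i, A i)) (t : ℕ) (a : ∀ i, A i)
    (s' : ∀ i, S i) : G.algState θ (extPath x t a s') (t + 1) =
      G.algStep θ (G.algState θ x t) (x t).1 a s' := by
  have := (Game.preDet_algState (G := G) (θ := θ) t).extPath le_rfl x a s'
  simp only [Game.algState, extPath_self, extPath_succ, this]

include hδ hne in
theorem Game.algPolicy_isStationaryPolicy (x : ℕ → (∀ i, S i) × (∀ i, A i)) (t : ℕ) (i : Fin n) :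
    IsStationaryPolicy (G.algPolicy θ x t i) :=
  isStationaryPolicy_inducedPolicy (hδ i) ((Game.algState_valid hδ hne x t).qhat_mem i)

/-- There are at most `t` visits up to the time `t`. -/
theorem Game.sum_count_le (x : ℕ → (∀ i, S i) × (∀ i, A i)) (t : ℕ) (i : Fin n) (s : S i)
    (a : A i) : ∑ y, ((G.algState θ x t).player i).count s a y ≤ t := by
  classical
  induction t with
  | zero => simp [Game.algState, AlgState.init, PlayerState.init]
  | succ t ih =>
    have h : ∑ y, (G.observed θ (G.algState θ x t) (x t).1 (x t).2 (x (t + 1)).1 i).count s a y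
        ≤ t + 1 := by
      rw [Game.sum_observed_count]
      split_ifs <;> omega
    simp only [Game.algState]
    by_cases hend : G.EpisodeEnds θ (G.algState θ x t) (x t).1 (x t).2 (x (t + 1)).1
    · rw [Game.algStep_of_ends hend]; exact h
    · rw [Game.algStep_of_not_ends hend]; exact h

/-! ### Episodes along a path -/

section Episodes

variable {x : ℕ → (∀ i, S i) × (∀ i, A i)}

/-- The step from the time `t` to the time `t + 1` ends an episode. -/
def Game.EndsAt (G : Game n S A) (θ : AlgParams n S A) (x : ℕ → (∀ i, S i) × (∀ i, A i))
    (t : ℕ) : Prop :=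
  G.EpisodeEnds θ (G.algState θ x t) (x t).1 (x t).2 (x (t + 1)).1

theorem Game.algState_succ_of_ends {t : ℕ} (h : G.EndsAt θ x t) :
    G.algState θ x (t + 1) =
    { episode := (G.algState θ x t).episode + 1
      clock := 0
      player := fun i => (G.observed θ (G.algState θ x t) (x t).1 (x t).2 (x (t + 1)).1
        i).endEpisode (θ.δ i) (θ.h i) (θ.η (G.algState θ x t).episode)
        (θ.rad i (G.algState θ x t).episode) } :=
  Game.algStep_of_ends h

theorem Game.algState_succ_of_not_ends {t : ℕ} (h : ¬ G.EndsAt θ x t) :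
    G.algState θ x (t + 1) =
    { episode := (G.algState θ x t).episode
      clock := (G.algState θ x t).clock + 1
      player := G.observed θ (G.algState θ x t) (x t).1 (x t).2 (x (t + 1)).1 } :=
  Game.algStep_of_not_ends h

theorem Game.episode_succ_le (t : ℕ) :
    (G.algState θ x (t + 1)).episode ≤ (G.algState θ x t).episode + 1 := by
  by_cases h : G.EndsAt θ x t
  · rw [Game.algState_succ_of_ends h]
  · rw [Game.algState_succ_of_not_ends h]; exact Nat.le_succ _

theorem Game.monotone_episode : Monotone fun t => (G.algState θ x t).episode := by
  refine monotone_nat_of_le_succ fun t => ?_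
  by_cases h : G.EndsAt θ x t
  · rw [Game.algState_succ_of_ends h]; exact Nat.le_succ _
  · rw [Game.algState_succ_of_not_ends h]

theorem Game.episode_le (t : ℕ) : (G.algState θ x t).episode ≤ t + 1 := by
  induction t with
  | zero => exact le_rfl
  | succ t ih => exact (Game.episode_succ_le t).trans (Nat.add_le_add_right ih 1)

/-- The first time of the episode `k`, with the junk value `0` if the episode is never reached. -/
def Game.start (G : Game n S A) (θ : AlgParams n S A) (x : ℕ → (∀ i, S i) × (∀ i, A i))
    (k : ℕ) : ℕ := sInf {t | (G.algState θ x t).episode = k}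

theorem Game.start_one : G.start θ x 1 = 0 :=
  Nat.sInf_eq_zero.2 (Or.inl rfl)

theorem Game.episode_start {k : ℕ} (hk : ∃ t, (G.algState θ x t).episode = k) :
    (G.algState θ x (G.start θ x k)).episode = k :=
  Nat.sInf_mem (s := {t | (G.algState θ x t).episode = k}) hk

theorem Game.episode_lt_of_lt_start {k t : ℕ} (hk : ∃ t, (G.algState θ x t).episode = k)
    (ht : t < G.start θ x k) : (G.algState θ x t).episode < k := by
  refine lt_of_le_of_ne ?_ (Nat.notMem_of_lt_sInf (s := {t | (G.algState θ x t).episode = k}) ht)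
  rw [← Game.episode_start hk]
  exact Game.monotone_episode ht.le

theorem Game.le_start {k : ℕ} (hk : ∃ t, (G.algState θ x t).episode = k) :
    k ≤ G.start θ x k + 1 := by
  have := Game.episode_le (G := G) (θ := θ) (x := x) (G.start θ x k)
  rwa [Game.episode_start hk] at this

/-- Every episode but the first starts right after the end of the previous one. -/
theorem Game.exists_end {k : ℕ} (hk1 : 1 ≤ k) (hk : ∃ t, (G.algState θ x t).episode = k + 1) :
    ∃ e, G.start θ x (k + 1) = e + 1 ∧ (G.algState θ x e).episode = k ∧ G.EndsAt θ x e := by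
  have hE := Game.episode_start hk
  have hpos : G.start θ x (k + 1) ≠ 0 := by
    intro h0
    rw [h0] at hE
    change 1 = k + 1 at hE
    omega
  obtain ⟨e, he⟩ : ∃ e, G.start θ x (k + 1) = e + 1 := Nat.exists_eq_succ_of_ne_zero hpos
  have hlt := Game.episode_lt_of_lt_start hk (t := e) (by omega)
  rw [he] at hE
  have hs := Game.episode_succ_le (G := G) (θ := θ) (x := x) e
  refine ⟨e, he, by omega, ?_⟩
  by_contra h
  rw [Game.algState_succ_of_not_ends h] at hE
  simp only at hE
  omega

theorem Game.clock_start {k : ℕ} (hk1 : 1 ≤ k) (hk : ∃ t, (G.algState θ x t).episode = k) :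
    (G.algState θ x (G.start θ x k)).clock = 0 := by
  rcases hk1.eq_or_lt with rfl | h
  · rw [Game.start_one]; rfl
  · obtain ⟨j, rfl⟩ := Nat.exists_eq_add_of_lt h
    obtain ⟨e, he, -, hend⟩ := Game.exists_end (k := 1 + j) (by omega) hk
    rw [he, Game.algState_succ_of_ends hend]

/-- Within an episode the clock runs, and the occupancy measures and the confidence sets do not
change. -/
theorem Game.within_episode {k : ℕ} (hk1 : 1 ≤ k) (hk : ∃ t, (G.algState θ x t).episode = k)
    {j : ℕ} (hj : (G.algState θ x (G.start θ x k + j)).episode = k) :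
    (G.algState θ x (G.start θ x k + j)).clock = j ∧
    (∀ i, ((G.algState θ x (G.start θ x k + j)).player i).qhat =
      ((G.algState θ x (G.start θ x k)).player i).qhat) ∧
    (∀ i, ((G.algState θ x (G.start θ x k + j)).player i).confSet =
      ((G.algState θ x (G.start θ x k)).player i).confSet) := by
  induction j with
  | zero => exact ⟨Game.clock_start hk1 hk, fun _ => rfl, fun _ => rfl⟩
  | succ j ih =>
    have h1 : (G.algState θ x (G.start θ x k + j)).episode = k := by
      have hmono := Game.monotone_episode (G := G) (θ := θ) (x := x)
      exact le_antisymm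
        ((hmono (show G.start θ x k + j ≤ G.start θ x k + (j + 1) by omega)).trans hj.le)
        ((Game.episode_start hk).ge.trans (hmono (Nat.le_add_right _ j)))
    obtain ⟨i1, i2, i3⟩ := ih h1
    have hne : ¬ G.EndsAt θ x (G.start θ x k + j) := by
      intro h
      rw [← add_assoc, Game.algState_succ_of_ends h] at hj
      simp only at hj
      omega
    rw [← add_assoc, Game.algState_succ_of_not_ends hne]
    exact ⟨by simp only [i1], fun i => (i2 i), fun i => (i3 i)⟩

theorem Game.exists_eq_start_add {k t : ℕ} (ht : (G.algState θ x t).episode = k) :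
    ∃ j, t = G.start θ x k + j :=
  Nat.exists_eq_add_of_le (Nat.sInf_le ht)

end Episodes

end Algorithm

/-! ### Concentration of the transition counts -/

/-- The Borel-Cantelli lemma; nothing is required of `s 0`. -/
theorem ae_eventually_notMem_of_le {Ω : Type*} [MeasurableSpace Ω] {μ : Measure Ω}
    {s : ℕ → Set Ω} {f : ℕ → ℝ} (hf : Summable f) (hf0 : ∀ k, 0 ≤ f k)
    (h : ∀ k, μ (s (k + 1)) ≤ ENNReal.ofReal (f k)) : ∀ᵐ ω ∂μ, ∀ᶠ k in atTop, ω ∉ s k := by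
  have h1 : ∑' k, μ (s (k + 1)) ≠ ⊤ := by
    refine ne_top_of_le_ne_top ?_ (ENNReal.tsum_le_tsum h)
    rw [← ENNReal.ofReal_tsum_of_nonneg hf0 hf]
    exact ENNReal.ofReal_ne_top
  filter_upwards [ae_eventually_notMem h1] with ω hω
  obtain ⟨K, hK⟩ := eventually_atTop.1 hω
  refine eventually_atTop.2 ⟨K + 1, fun k hk => ?_⟩
  obtain ⟨j, rfl⟩ := Nat.exists_eq_add_of_le' (show 1 ≤ k by omega)
  exact hK j (by omega)

/-- Hoeffding's lemma for a centred Bernoulli variable. -/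
theorem bernoulli_mgf_le {p : ℝ} (hp0 : 0 ≤ p) (hp1 : p ≤ 1) (l : ℝ) :
    p * Real.exp (l * (1 - p)) + (1 - p) * Real.exp (l * (0 - p)) ≤ Real.exp (l ^ 2 / 8) := by
  set ν : Measure ℝ := ENNReal.ofReal p • Measure.dirac 1 + ENNReal.ofReal (1 - p) • Measure.dirac 0
  have hint : ∀ f : ℝ → ℝ, ∫ y, f y ∂ν = p * f 1 + (1 - p) * f 0 := by
    intro f
    have hd : ∀ c : ℝ, Integrable f (Measure.dirac c) := fun c => integrable_dirac (by simp)
    rw [integral_add_measure ((hd 1).smul_measure ENNReal.ofReal_ne_top)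
      ((hd 0).smul_measure ENNReal.ofReal_ne_top), integral_smul_measure, integral_smul_measure,
      integral_dirac, integral_dirac, ENNReal.toReal_ofReal hp0,
      ENNReal.toReal_ofReal (sub_nonneg.2 hp1), smul_eq_mul, smul_eq_mul]
  have hprob : IsProbabilityMeasure ν := by
    refine ⟨?_⟩
    simp only [ν, Measure.add_apply, Measure.smul_apply, measure_univ, smul_eq_mul, mul_one]
    rw [← ENNReal.ofReal_add hp0 (sub_nonneg.2 hp1)]
    simp
  have hmem : ∀ᵐ y ∂ν, y ∈ Set.Icc (0 : ℝ) 1 := by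
    rw [ae_iff]
    simp [ν]
  have h := (ProbabilityTheory.hasSubgaussianMGF_of_mem_Icc (X := fun y => y)
    aemeasurable_id' hmem).mgf_le l
  rw [ProbabilityTheory.mgf, hint, hint] at h
  simp only [mul_one, mul_zero, add_zero] at h
  refine h.trans (le_of_eq ?_)
  congr 1
  simp
  ring

section Concentration

variable {n : ℕ} {S A : Fin n → Type*} [∀ i, Fintype (S i)] [∀ i, Fintype (A i)]
  {G : Game n S A} {θ : AlgParams n S A} (hδ : ∀ i, 0 < θ.δ i)
  (hne : ∀ i, (shrunk (θ.δ i) : Set (S i → A i → S i → ℝ)).Nonempty)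
  {Ω : Type*} [MeasurableSpace Ω] {μ : Measure Ω} [IsProbabilityMeasure μ]
  {X : ℕ → Ω → (∀ i, S i) × (∀ i, A i)}

theorem Game.algStep_count {σ : AlgState n S A} {s : ∀ i, S i} {a : ∀ i, A i} {s' : ∀ i, S i}
    (i : Fin n) : ((G.algStep θ σ s a s').player i).count = (G.observed θ σ s a s' i).count := by
  by_cases h : G.EpisodeEnds θ σ s a s'
  · rw [Game.algStep_of_ends h]; rfl
  · rw [Game.algStep_of_not_ends h]

/-- The transitions out of one state-action pair, centred. -/
def AlgState.deviation (G : Game n S A) (σ : AlgState n S A) (i : Fin n) (s : S i) (a : A i)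
    (s' : S i) : ℝ :=
  ((σ.player i).count s a s' : ℝ) - ((∑ y, (σ.player i).count s a y : ℕ) : ℝ) * G.P i s a s'

include hδ hne in
/-- Hoeffding's inequality at the `N`-th visit of a state-action pair, for either sign `c = ±1` of
the deviation. -/
theorem Game.IsPlay.measure_deviation_le (hX : G.IsPlay (G.algPolicy θ) μ X) (i : Fin n) (s : S i)
    (a : A i) (s' : S i) {c : ℝ} (hc : c ^ 2 = 1) {N : ℕ} (hN : 0 < N)
    {y : ℝ} (hy : 0 ≤ y) :
    μ {ω | ∃ t, ∑ z, ((G.algState θ (fun l => X l ω) t).player i).count s a z = N ∧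
      y ≤ c * (G.algState θ (fun l => X l ω) t).deviation G i s a s'} ≤
      ENNReal.ofReal (Real.exp (-(2 * y ^ 2 / N))) := by
  classical
  have hN' : (0 : ℝ) < N := by exact_mod_cast hN
  set p : ℝ := G.P i s a s' with hp
  have hPt := G.P_isTransition i s a
  have hp0 : 0 ≤ p := hPt.1 s'
  have hp1 : p ≤ 1 := by
    rw [← hPt.2]
    exact Finset.single_le_sum (f := fun z => G.P i s a z) (fun z _ => hPt.1 z) (Finset.mem_univ s')
  -- the exponent that minimizes `l ^ 2 / 8 * N - l * y`
  set l : ℝ := 4 * y / N with hl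
  -- the exponential supermartingale, normalized so that it is at least `1` on the event
  let f : AlgState n S A → ℝ := fun σ => Real.exp (l * (c * σ.deviation G i s a s') -
    l ^ 2 / 8 * ((∑ z, (σ.player i).count s a z : ℕ) : ℝ) - (l * y - l ^ 2 / 8 * N))
  have hpre := Game.preDet_algState (G := G) (θ := θ)
  refine hX.measure_exists_le (Game.preDet_algPolicy)
    (Game.algPolicy_isStationaryPolicy hδ hne)
    (B := fun t => {x | ∑ z, ((G.algState θ x t).player i).count s a z = N ∧
      y ≤ c * (G.algState θ x t).deviation G i s a s'})
    (W := fun t x => f (G.algState θ x t)) ?_ ?_ (fun t x => (Real.exp_pos _).le) ?_ ?_ ?_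
  · intro t x z h1 h2
    have := hpre t x z h1 h2
    simp only at this
    simp only [Set.mem_ofPred_eq, this]
  · intro t x z h1 h2
    exact congrArg f (hpre t x z h1 h2)
  · rintro t x ⟨h1, h2⟩
    refine Real.one_le_exp ?_
    rw [h1]
    have : 0 ≤ l := by positivity
    nlinarith [mul_le_mul_of_nonneg_left h2 this]
  · intro t x _
    simp only [Game.algState_extPath]
    set σ := G.algState θ x t
    let g : A i → S i → ℝ := fun b z => if (x t).1 i = s ∧ b = a then
      Real.exp (l * c * ((if z = s' then 1 else 0) - p) - l ^ 2 / 8) else 1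
    have hfac : ∀ b z, f (G.algStep θ σ (x t).1 b z) = f σ * g (b i) (z i) := by
      intro b z
      simp only [f, g, AlgState.deviation, Game.algStep_count]
      rw [Game.sum_observed_count, Game.observed_count]
      by_cases h : (x t).1 i = s ∧ b i = a
      · obtain ⟨h1, h2⟩ := h
        rw [if_pos (show (x t).1 i = s ∧ b i = a from ⟨h1, h2⟩),
          if_pos (show s = (x t).1 i ∧ a = b i from ⟨h1.symm, h2.symm⟩), ← Real.exp_add]
        congr 1
        by_cases h3 : z i = s'
        · rw [if_pos (show s = (x t).1 i ∧ a = b i ∧ s' = z i from ⟨h1.symm, h2.symm, h3.symm⟩),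
            if_pos h3]
          push_cast
          ring
        · rw [if_neg (show ¬ (s = (x t).1 i ∧ a = b i ∧ s' = z i) from fun h => h3 h.2.2.symm),
            if_neg h3]
          push_cast
          ring
      · rw [if_neg h,
          if_neg (show ¬ (s = (x t).1 i ∧ a = b i) from fun h' => h ⟨h'.1.symm, h'.2.symm⟩),
          if_neg (show ¬ (s = (x t).1 i ∧ a = b i ∧ s' = z i) from
            fun h' => h ⟨h'.1.symm, h'.2.1.symm⟩), add_zero, add_zero, mul_one]
    simp only [hfac]
    rw [G.stepMean_const_mul, G.stepMean_single (Game.algPolicy_isStationaryPolicy hδ hne x t)]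
    refine mul_le_of_le_one_right (Real.exp_pos _).le ?_
    set π := G.algPolicy θ x t i with hπ
    have hπs : IsStationaryPolicy π := Game.algPolicy_isStationaryPolicy hδ hne x t i
    calc ∑ b, ∑ z, π ((x t).1 i) b * G.P i ((x t).1 i) b z * g b z
        ≤ ∑ b, π ((x t).1 i) b := Finset.sum_le_sum fun b _ => ?_
      _ = 1 := (hπs _).2
    simp only [mul_assoc, ← Finset.mul_sum]
    refine mul_le_of_le_one_right ((hπs _).1 b) ?_
    by_cases h : (x t).1 i = s ∧ b = a
    · simp only [g, h.1, h.2, and_self, if_true]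
      have hsum : ∑ z, G.P i s a z * Real.exp (l * c * ((if z = s' then 1 else 0) - p) - l ^ 2 / 8)
          = (p * Real.exp (l * c * (1 - p)) + (1 - p) * Real.exp (l * c * (0 - p))) *
            Real.exp (-(l ^ 2 / 8)) := by
        rw [← Finset.add_sum_erase _ _ (Finset.mem_univ s')]
        have h1 : ∑ z ∈ Finset.univ.erase s', G.P i s a z = 1 - p := by
          rw [← hPt.2, ← Finset.add_sum_erase _ _ (Finset.mem_univ s')]; ring
        have h2 : ∑ z ∈ Finset.univ.erase s', G.P i s a z *
            Real.exp (l * c * ((if z = s' then 1 else 0) - p) - l ^ 2 / 8) =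
            ∑ z ∈ Finset.univ.erase s', G.P i s a z *
            (Real.exp (l * c * (0 - p)) * Real.exp (-(l ^ 2 / 8))) :=
          Finset.sum_congr rfl fun z hz => by
            rw [if_neg (Finset.ne_of_mem_erase hz), sub_eq_add_neg _ (l ^ 2 / 8), Real.exp_add]
        rw [h2, ← Finset.sum_mul, h1, if_pos rfl, sub_eq_add_neg _ (l ^ 2 / 8), Real.exp_add]
        ring
      rw [hsum]
      have h3 := bernoulli_mgf_le hp0 hp1 (l * c)
      rw [mul_pow, hc, mul_one] at h3
      calc _ ≤ Real.exp (l ^ 2 / 8) * Real.exp (-(l ^ 2 / 8)) := by gcongr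
        _ = 1 := by rw [← Real.exp_add, add_neg_cancel, Real.exp_zero]
    · simp only [g, if_neg h, mul_one]
      exact (G.P_isTransition i _ b).2.le
  · intro x
    simp only [f, Game.algState, AlgState.init, AlgState.deviation, PlayerState.init]
    simp only [Finset.sum_const_zero, Nat.cast_zero, zero_mul, mul_zero, sub_zero, zero_sub]
    refine Real.exp_le_exp.2 (le_of_eq ?_)
    rw [hl]; field_simp; ring

include hδ hne in
/-- Almost surely the empirical transition counts obey, from some number of visits on, a bound
that is weaker than the law of the iterated logarithm but suffices for the confidence boxes. The
constant `3/4` makes the probabilities `N ^ (-3/2)` summable. -/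
theorem Game.IsPlay.ae_deviation_le (hX : G.IsPlay (G.algPolicy θ) μ X) :
    ∀ᵐ ω ∂μ, ∀ i s a s', ∀ᶠ N : ℕ in atTop, ∀ t,
      ∑ z, ((G.algState θ (fun l => X l ω) t).player i).count s a z = N →
      |(G.algState θ (fun l => X l ω) t).deviation G i s a s'| ≤
        Real.sqrt (3 / 4 * N * Real.log N) := by
  have key : ∀ c : ℝ, c ^ 2 = 1 → ∀ i s a s', ∀ᵐ ω ∂μ, ∀ᶠ N : ℕ in atTop, ∀ t,
      ∑ z, ((G.algState θ (fun l => X l ω) t).player i).count s a z = N →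
      c * (G.algState θ (fun l => X l ω) t).deviation G i s a s' <
        Real.sqrt (3 / 4 * N * Real.log N) := by
    intro c hc i s a s'
    have hsum : Summable fun k : ℕ => ((k + 1 : ℕ) : ℝ) ^ (-(3 / 2) : ℝ) :=
      (summable_nat_add_iff 1).2 (Real.summable_nat_rpow.2 (by norm_num))
    have := ae_eventually_notMem_of_le (μ := μ) (s := fun N => {ω | ∃ t,
      ∑ z, ((G.algState θ (fun l => X l ω) t).player i).count s a z = N ∧
      Real.sqrt (3 / 4 * N * Real.log N) ≤
        c * (G.algState θ (fun l => X l ω) t).deviation G i s a s'}) hsum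
      (fun k => by positivity) (fun k => by
        refine (hX.measure_deviation_le hδ hne i s a s' hc (Nat.succ_pos k)
          (Real.sqrt_nonneg _)).trans ?_
        refine ENNReal.ofReal_le_ofReal (le_of_eq ?_)
        have hk : (0 : ℝ) < ((k + 1 : ℕ) : ℝ) := by positivity
        have hlog : 0 ≤ Real.log ((k + 1 : ℕ) : ℝ) := Real.log_natCast_nonneg _
        rw [Real.sq_sqrt (by positivity), Real.rpow_def_of_pos hk]
        congr 1
        field_simp
        ring)
    filter_upwards [this] with ω hω
    filter_upwards [hω] with N hN t ht
    by_contra! h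
    exact hN ⟨t, ht, h⟩
  have h1 := fun i s a s' => key 1 (by norm_num) i s a s'
  have h2 := fun i s a s' => key (-1) (by norm_num) i s a s'
  have h1' := ae_all_iff.2 fun i => ae_all_iff.2 fun s => ae_all_iff.2 fun a =>
    ae_all_iff.2 fun s' => h1 i s a s'
  have h2' := ae_all_iff.2 fun i => ae_all_iff.2 fun s => ae_all_iff.2 fun a =>
    ae_all_iff.2 fun s' => h2 i s a s'
  filter_upwards [h1', h2'] with ω hω1 hω2 i s a s'
  filter_upwards [hω1 i s a s', hω2 i s a s'] with N hN1 hN2 t ht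
  rw [abs_le]
  constructor
  · linarith [hN2 t ht]
  · linarith [hN1 t ht]

end Concentration

/-! ### Contracting chains -/

section SinglePlayer

variable {S A : Type*} [Fintype S] [Fintype A]

/-- Every chain induced by a stationary policy contracts the `ℓ¹` distance by the factor `β`. -/
def Contracts (P : S → A → S → ℝ) (β : ℝ) : Prop :=
  ∀ π : S → A → ℝ, IsStationaryPolicy π → ∀ ν ν' : S → ℝ, IsDistribution ν → IsDistribution ν' →
    ∑ s', |∑ s, (ν s - ν' s) * inducedChain P π s s'| ≤ β * ∑ s, |ν s - ν' s|

/-- The measure `ν` after one step of the chain `K`. -/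
def push (K : S → S → ℝ) (ν : S → ℝ) (s' : S) : ℝ := ∑ s, ν s * K s s'

section Chain

variable {P : S → A → S → ℝ} {π : S → A → ℝ}

theorem inducedChain_nonneg (hP : IsTransition P) (hπ : IsStationaryPolicy π) (s s' : S) :
    0 ≤ inducedChain P π s s' :=
  Finset.sum_nonneg fun a _ => mul_nonneg ((hP s a).1 s') ((hπ s).1 a)

theorem sum_inducedChain (hP : IsTransition P) (hπ : IsStationaryPolicy π) (s : S) :
    ∑ s', inducedChain P π s s' = 1 := by
  unfold inducedChain
  rw [Finset.sum_comm]
  simp only [← Finset.sum_mul, (hP s _).2, one_mul, (hπ s).2]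

theorem IsDistribution.push (hP : IsTransition P) (hπ : IsStationaryPolicy π) {ν : S → ℝ}
    (hν : IsDistribution ν) : IsDistribution (push (inducedChain P π) ν) := by
  refine ⟨fun s' => Finset.sum_nonneg fun s _ =>
    mul_nonneg (hν.1 s) (inducedChain_nonneg hP hπ s s'), ?_⟩
  unfold LearnGame.push
  rw [Finset.sum_comm]
  simp only [← Finset.mul_sum, sum_inducedChain hP hπ, mul_one, hν.2]

theorem IsDistribution.iterate_push (hP : IsTransition P) (hπ : IsStationaryPolicy π) {ν : S → ℝ}
    (hν : IsDistribution ν) (j : ℕ) :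
    IsDistribution ((LearnGame.push (inducedChain P π))^[j] ν) := by
  induction j with
  | zero => exact hν
  | succ j ih => rw [Function.iterate_succ_apply']; exact ih.push hP hπ

theorem isDistribution_single [DecidableEq S] (s : S) :
    IsDistribution (fun y : S => if y = s then (1 : ℝ) else 0) :=
  ⟨fun y => by dsimp only; split_ifs <;> norm_num, by simp⟩

omit [Fintype A] in
theorem IsDistribution.le_one {ν : S → ℝ} (hν : IsDistribution ν) (s : S) : ν s ≤ 1 := by
  rw [← hν.2]
  exact Finset.single_le_sum (fun s _ => hν.1 s) (Finset.mem_univ s)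

theorem IsDistribution.l1_dist_le_two {ν ν' : S → ℝ} (hν : IsDistribution ν)
    (hν' : IsDistribution ν') : ∑ s, |ν s - ν' s| ≤ 2 := by
  calc ∑ s, |ν s - ν' s| ≤ ∑ s, (ν s + ν' s) := Finset.sum_le_sum fun s _ => by
        rw [abs_le]
        constructor <;> linarith [hν.1 s, hν'.1 s]
    _ = 2 := by rw [Finset.sum_add_distrib, hν.2, hν'.2]; norm_num

theorem Contracts.push_dist_le {β : ℝ} (hc : Contracts P β) (hπ : IsStationaryPolicy π)
    {ν ν' : S → ℝ} (hν : IsDistribution ν) (hν' : IsDistribution ν') :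
    ∑ s, |push (inducedChain P π) ν s - push (inducedChain P π) ν' s| ≤
      β * ∑ s, |ν s - ν' s| := by
  refine le_trans (le_of_eq ?_) (hc π hπ ν ν' hν hν')
  simp only [push, sub_mul, Finset.sum_sub_distrib]

/-- A distribution that is stationary up to `r` attracts the chain up to `r / (1 - β)`. -/
theorem Contracts.iterate_push_dist_le {β : ℝ} (hc : Contracts P β) (hβ0 : 0 ≤ β) (hβ1 : β < 1)
    (hP : IsTransition P) (hπ : IsStationaryPolicy π) {ν ν' : S → ℝ} (hν : IsDistribution ν)
    (hν' : IsDistribution ν') {r : ℝ}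
    (hr : ∑ s, |push (inducedChain P π) ν' s - ν' s| ≤ r) (j : ℕ) :
    ∑ s, |(push (inducedChain P π))^[j] ν s - ν' s| ≤ β ^ j * 2 + r / (1 - β) := by
  have hr0 : 0 ≤ r := (Finset.sum_nonneg fun _ _ => abs_nonneg _).trans hr
  have h1β : 0 < 1 - β := by linarith
  induction j with
  | zero =>
    have := hν.l1_dist_le_two hν'
    have h2 : 0 ≤ r / (1 - β) := by positivity
    simpa using this.trans (by linarith)
  | succ j ih =>
    rw [Function.iterate_succ_apply']
    have h1 := hc.push_dist_le hπ (hν.iterate_push hP hπ j) hν'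
    calc ∑ s, |push (inducedChain P π) ((push (inducedChain P π))^[j] ν) s - ν' s|
        ≤ ∑ s, (|push (inducedChain P π) ((push (inducedChain P π))^[j] ν) s -
            push (inducedChain P π) ν' s| + |push (inducedChain P π) ν' s - ν' s|) :=
          Finset.sum_le_sum fun s _ => abs_sub_le _ _ _
      _ ≤ β * (β ^ j * 2 + r / (1 - β)) + r := by
          rw [Finset.sum_add_distrib]
          exact add_le_add (h1.trans (mul_le_mul_of_nonneg_left ih hβ0)) hr
      _ = β ^ (j + 1) * 2 + r / (1 - β) := by field_simp; ring

/-- The state marginal of an occupancy measure of `P` is stationary under the induced policy. -/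
theorem push_sum_rho {δ : ℝ} (hδ : 0 < δ) {q : S → A → S → ℝ} (hq : q ∈ shrunk δ)
    (hqP : ∀ s a s', q s a s' = rho q s a * P s a s') (s' : S) :
    push (inducedChain P (inducedPolicy q)) (fun s => ∑ a, rho q s a) s' = ∑ a, rho q s' a := by
  have h1 : ∀ s, (∑ a, rho q s a) * inducedChain P (inducedPolicy q) s s' = ∑ a, q s a s' := by
    intro s
    unfold inducedChain
    rw [Finset.mul_sum]
    refine Finset.sum_congr rfl fun a _ => ?_
    rw [hqP s a s', ← sum_mul_inducedPolicy hδ hq s a]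
    ring
  simp only [push, h1]
  exact hq.1.2.2 s'

theorem isDistribution_sum_rho {q : S → A → S → ℝ} (hq : q ∈ occPolytope) :
    IsDistribution (fun s => ∑ a, rho q s a) :=
  ⟨fun s => Finset.sum_nonneg fun a _ => rho_nonneg hq s a, hq.2.1⟩

/-! ### Survival probabilities -/

open Classical in
/-- The chain that is killed when it plays `â` in the state `ŝ`. -/
def killedChain (P : S → A → S → ℝ) (π : S → A → ℝ) (ŝ : S) (â : A) (y y' : S) : ℝ :=
  ∑ a, P y a y' * π y a * if y = ŝ ∧ a = â then 0 else 1

/-- Probability that the pair `(ŝ, â)` does not occur in the first `j` steps. -/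
def survive (P : S → A → S → ℝ) (π : S → A → ℝ) (ŝ : S) (â : A) : ℕ → S → ℝ
  | 0 => fun _ => 1
  | j + 1 => fun y => ∑ y', killedChain P π ŝ â y y' * survive P π ŝ â j y'

variable (hP : IsTransition P) (hπ : IsStationaryPolicy π) (ŝ : S) (â : A)
include hP hπ

theorem killedChain_nonneg (y y' : S) : 0 ≤ killedChain P π ŝ â y y' := by
  classical
  refine Finset.sum_nonneg fun a _ => mul_nonneg (mul_nonneg ((hP y a).1 y') ((hπ y).1 a)) ?_
  split_ifs <;> norm_num

theorem killedChain_le (y y' : S) : killedChain P π ŝ â y y' ≤ inducedChain P π y y' := by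
  classical
  refine Finset.sum_le_sum fun a _ => mul_le_of_le_one_right
    (mul_nonneg ((hP y a).1 y') ((hπ y).1 a)) ?_
  split_ifs <;> norm_num

omit hπ in
open Classical in
theorem sum_killedChain (y : S) :
    ∑ y', killedChain P π ŝ â y y' = ∑ a, π y a * if y = ŝ ∧ a = â then 0 else 1 := by
  unfold killedChain
  rw [Finset.sum_comm]
  refine Finset.sum_congr rfl fun a _ => ?_
  simp only [mul_assoc, ← Finset.sum_mul, (hP y a).2, one_mul]

open Classical in
/-- The probability of being killed in one step. -/
theorem one_sub_sum_killedChain (y : S) :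
    1 - ∑ y', killedChain P π ŝ â y y' = if y = ŝ then π ŝ â else 0 := by
  have h1 : ∑ a, π y a * (if y = ŝ ∧ a = â then (0 : ℝ) else 1) =
      ∑ a, π y a - ∑ a, π y a * if y = ŝ ∧ a = â then 1 else 0 := by
    rw [← Finset.sum_sub_distrib]
    refine Finset.sum_congr rfl fun a _ => ?_
    split_ifs <;> ring
  rw [sum_killedChain hP, h1, (hπ y).2, sub_sub_cancel]
  by_cases h : y = ŝ
  · subst h; simp
  · simp [h]

theorem survive_nonneg (j : ℕ) (y : S) : 0 ≤ survive P π ŝ â j y := by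
  induction j generalizing y with
  | zero => exact zero_le_one
  | succ j ih =>
    exact Finset.sum_nonneg fun y' _ => mul_nonneg (killedChain_nonneg hP hπ ŝ â y y') (ih y')

theorem survive_succ_le (j : ℕ) (y : S) : survive P π ŝ â (j + 1) y ≤ survive P π ŝ â j y := by
  induction j generalizing y with
  | zero =>
    simp only [survive, mul_one]
    calc ∑ y', killedChain P π ŝ â y y' ≤ ∑ y', inducedChain P π y y' :=
          Finset.sum_le_sum fun y' _ => killedChain_le hP hπ ŝ â y y'
      _ = 1 := sum_inducedChain hP hπ y
  | succ j ih => exact Finset.sum_le_sum fun y' _ =>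
      mul_le_mul_of_nonneg_left (ih y') (killedChain_nonneg hP hπ ŝ â y y')

theorem survive_antitone (y : S) : Antitone fun j => survive P π ŝ â j y :=
  antitone_nat_of_succ_le fun j => survive_succ_le hP hπ ŝ â j y

theorem survive_le_one (j : ℕ) (y : S) : survive P π ŝ â j y ≤ 1 :=
  survive_antitone hP hπ ŝ â y (Nat.zero_le j)

/-- The Markov property of the killed chain. -/
theorem survive_add_le {l : ℕ} {w : ℝ} (hw : ∀ y, survive P π ŝ â l y ≤ w) (j : ℕ) (y : S) :
    survive P π ŝ â (j + l) y ≤ w * survive P π ŝ â j y := by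
  induction j generalizing y with
  | zero => simpa [survive] using hw y
  | succ j ih =>
    rw [show j + 1 + l = (j + l) + 1 by ring]
    simp only [survive]
    rw [Finset.mul_sum]
    refine Finset.sum_le_sum fun y' _ => ?_
    calc killedChain P π ŝ â y y' * survive P π ŝ â (j + l) y'
        ≤ killedChain P π ŝ â y y' * (w * survive P π ŝ â j y') :=
          mul_le_mul_of_nonneg_left (ih y') (killedChain_nonneg hP hπ ŝ â y y')
      _ = _ := by ring

theorem survive_mul_le {m : ℕ} {w : ℝ} (hw0 : 0 ≤ w) (hw : ∀ y, survive P π ŝ â m y ≤ w) (r : ℕ)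
    (y : S) : survive P π ŝ â (r * m) y ≤ w ^ r := by
  induction r generalizing y with
  | zero => simp [survive]
  | succ r ih =>
    rw [Nat.succ_mul, pow_succ']
    exact (survive_add_le hP hπ ŝ â hw (r * m) y).trans (mul_le_mul_of_nonneg_left (ih y) hw0)

/-- The probability of an occurrence within `j + 1` steps is at least `δ ^ (j + 1)` times the
probability `u j y` that another policy `π'` leads from `y` to `ŝ` in `j` steps, because `π` chooses
every action with probability at least `δ ≥ δ * π' y a`. -/
theorem pow_mul_le_one_sub_survive {π' : S → A → ℝ} (hπ' : IsStationaryPolicy π') {δ : ℝ}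
    (hδ : 0 ≤ δ) (hπδ : ∀ s a, δ ≤ π s a) {u : ℕ → S → ℝ}
    (hu0 : ∀ y, y ≠ ŝ → u 0 y = 0) (hu0' : u 0 ŝ = 1)
    (hu : ∀ j y, u (j + 1) y = ∑ y', inducedChain P π' y y' * u j y') (j : ℕ) (y : S) :
    δ ^ (j + 1) * u j y ≤ 1 - survive P π ŝ â (j + 1) y := by
  classical
  induction j generalizing y with
  | zero =>
    simp only [survive, mul_one, zero_add, pow_one]
    rw [one_sub_sum_killedChain hP hπ]
    split_ifs with h
    · rw [h, hu0', mul_one]; exact hπδ ŝ â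
    · rw [hu0 y h, mul_zero]
  | succ j ih =>
    have hK : ∀ y', δ * inducedChain P π' y y' ≤ inducedChain P π y y' := by
      intro y'
      unfold inducedChain
      rw [Finset.mul_sum]
      refine Finset.sum_le_sum fun a _ => ?_
      have h1 : π' y a ≤ 1 := by
        rw [← (hπ' y).2]
        exact Finset.single_le_sum (fun a _ => (hπ' y).1 a) (Finset.mem_univ a)
      calc δ * (P y a y' * π' y a) = P y a y' * (δ * π' y a) := by ring
        _ ≤ P y a y' * (δ * 1) := by
            have := (hP y a).1 y'
            gcongr
        _ ≤ P y a y' * π y a := by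
            rw [mul_one]
            exact mul_le_mul_of_nonneg_left (hπδ y a) ((hP y a).1 y')
    set v : S → ℝ := fun y' => 1 - survive P π ŝ â (j + 1) y' with hv
    have hv0 : ∀ y', 0 ≤ v y' := fun y' => sub_nonneg.2 (survive_le_one hP hπ ŝ â _ y')
    have hv1 : ∀ y', v y' ≤ 1 := fun y' => by
      have := survive_nonneg hP hπ ŝ â (j + 1) y'
      simp only [hv]; linarith
    calc δ ^ (j + 1 + 1) * u (j + 1) y
        = ∑ y', δ * inducedChain P π' y y' * (δ ^ (j + 1) * u j y') := by
          rw [hu, Finset.mul_sum]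
          exact Finset.sum_congr rfl fun y' _ => by ring
      _ ≤ ∑ y', δ * inducedChain P π' y y' * v y' := Finset.sum_le_sum fun y' _ =>
          mul_le_mul_of_nonneg_left (ih y')
            (mul_nonneg hδ (inducedChain_nonneg hP hπ' y y'))
      _ ≤ ∑ y', inducedChain P π y y' * v y' := Finset.sum_le_sum fun y' _ =>
          mul_le_mul_of_nonneg_right (hK y') (hv0 y')
      _ ≤ ∑ y', (inducedChain P π y y' - killedChain P π ŝ â y y' * (1 - v y')) :=
          Finset.sum_le_sum fun y' _ => by
            nlinarith [mul_nonneg (sub_nonneg.2 (killedChain_le hP hπ ŝ â y y'))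
              (sub_nonneg.2 (hv1 y'))]
      _ = 1 - survive P π ŝ â (j + 1 + 1) y := by
          rw [Finset.sum_sub_distrib, sum_inducedChain hP hπ]
          simp only [hv, sub_sub_cancel]
          rfl

omit hπ in
/-- Since `P` has an occupancy measure bounded below by `δ`, all policies bounded below by `δ`
visit every state-action pair within a fixed time with a probability bounded below. The policy of
that occupancy measure reaches every state with a probability close to the stationary one, which is
at least `δ`. -/
theorem exists_survive_le {δ β : ℝ} (hδ : 0 < δ) (hc : Contracts P β) (hβ0 : 0 ≤ β) (hβ1 : β < 1)
    (hne : (shrunkOf δ P).Nonempty) :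
    ∃ m : ℕ, ∃ c : ℝ, 0 < c ∧ ∀ π : S → A → ℝ, IsStationaryPolicy π → (∀ s a, δ ≤ π s a) →
      ∀ ŝ â y, survive P π ŝ â m y ≤ 1 - c := by
  classical
  obtain ⟨q, hq⟩ := hne
  have hqP := eq_rho_mul_of_mem_shrunkOf hδ hq
  set π' := inducedPolicy q with hπ'
  have hπ's : IsStationaryPolicy π' := isStationaryPolicy_inducedPolicy hδ hq.1
  set ν : S → ℝ := fun s => ∑ a, rho q s a with hν
  have hνd : IsDistribution ν := isDistribution_sum_rho hq.1.1
  obtain ⟨J, hJ⟩ := exists_pow_lt_of_lt_one (show 0 < δ / 4 by positivity) hβ1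
  refine ⟨J + 1, δ ^ (J + 1) * (δ / 2), by positivity, fun π hπ hπδ ŝ â y => ?_⟩
  have hA : Nonempty A := ⟨â⟩
  have hνδ : δ ≤ ν ŝ := (hq.1.2 ŝ â).trans
    (Finset.single_le_sum (f := fun a => rho q ŝ a) (fun a _ => rho_nonneg hq.1.1 ŝ a)
      (Finset.mem_univ â))
  let u : ℕ → S → ℝ := fun j => Nat.rec (fun y => if y = ŝ then 1 else 0)
    (fun _ f y => ∑ y', inducedChain P π' y y' * f y') j
  have hus : ∀ j y, u (j + 1) y = ∑ y', inducedChain P π' y y' * u j y' := fun _ _ => rfl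
  -- backward and forward evolution are dual
  have hdual : ∀ j (w : S → ℝ), ∑ y, w y * u j y = (push (inducedChain P π'))^[j] w ŝ := by
    intro j
    induction j with
    | zero => intro w; simp [u]
    | succ j ih =>
      intro w
      rw [Function.iterate_succ_apply, ← ih]
      simp only [hus, push, Finset.mul_sum, Finset.sum_mul]
      rw [Finset.sum_comm]
      exact Finset.sum_congr rfl fun _ _ => Finset.sum_congr rfl fun _ _ => by ring
  have huy : u J y = (push (inducedChain P π'))^[J] (fun z => if z = y then 1 else 0) ŝ := by
    rw [← hdual]; simp
  have hstat : ∑ s, |push (inducedChain P π') ν s - ν s| ≤ 0 := by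
    refine (Finset.sum_eq_zero fun s _ => ?_).le
    have := push_sum_rho hδ hq.1 hqP s
    simp only [← hν, ← hπ'] at this
    rw [this]; simp [hν]
  have hlow := hc.iterate_push_dist_le hβ0 hβ1 hP hπ's (isDistribution_single y) hνd hstat J
  have h1 := (Finset.single_le_sum (f := fun s => |(push (inducedChain P π'))^[J]
    (fun z => if z = y then 1 else 0) s - ν s|) (fun _ _ => abs_nonneg _)
    (Finset.mem_univ ŝ)).trans hlow
  rw [← huy, zero_div, add_zero] at h1
  have h2 : δ / 2 ≤ u J y := by
    have := (abs_le.1 h1).1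
    linarith
  have h3 := pow_mul_le_one_sub_survive hP hπ ŝ â hπ's hδ.le hπδ (u := u)
    (fun y hy => if_neg hy) (if_pos rfl) hus J y
  have h4 : δ ^ (J + 1) * (δ / 2) ≤ δ ^ (J + 1) * u J y := by gcongr
  linarith

end Chain

end SinglePlayer

/-! ### The length of the episodes -/

section EpisodeLength

variable {n : ℕ} {S A : Fin n → Type*} [∀ i, Fintype (S i)] [∀ i, Fintype (A i)]
  {G : Game n S A} {θ : AlgParams n S A} (hδ : ∀ i, 0 < θ.δ i)
  (hne : ∀ i, (shrunk (θ.δ i) : Set (S i → A i → S i → ℝ)).Nonempty)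

include hδ in
/-- One block length and one probability that work for all players. -/
theorem Game.exists_block {β : ℝ} (hβ0 : 0 ≤ β) (hβ1 : β < 1)
    (hc : ∀ i, Contracts (G.P i) β) (hneP : ∀ i, (shrunkOf (θ.δ i) (G.P i)).Nonempty) :
    ∃ m : ℕ, ∃ w : ℝ, 0 < w ∧ w < 1 ∧ ∀ i, ∀ π : S i → A i → ℝ, IsStationaryPolicy π →
      (∀ s a, θ.δ i ≤ π s a) → ∀ ŝ â y, survive (G.P i) π ŝ â m y ≤ w := by
  choose m c hc0 hmc using fun i =>
    exists_survive_le (G.P_isTransition i) (hδ i) (hc i) hβ0 hβ1 (hneP i)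
  obtain ⟨d, hd0, hd⟩ : ∃ d : ℝ, 0 < d ∧ ∀ i, d ≤ c i := by
    rcases isEmpty_or_nonempty (Fin n) with h | h
    · exact ⟨1, one_pos, fun i => h.elim i⟩
    · obtain ⟨i₀, hi₀⟩ := Finite.exists_min c
      exact ⟨c i₀, hc0 i₀, hi₀⟩
  refine ⟨∑ i, m i, 1 - min d (1 / 2), ?_, ?_, fun i π hπ hπδ ŝ â y => ?_⟩
  · have := min_le_right d (1 / 2 : ℝ)
    linarith
  · have : 0 < min d (1 / 2 : ℝ) := by positivity
    linarith
  · have h1 := survive_antitone (G.P_isTransition i) hπ ŝ â y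
      (Finset.single_le_sum (f := m) (fun _ _ => Nat.zero_le _) (Finset.mem_univ i))
    have h2 := hmc i π hπ hπδ ŝ â y
    have h3 := (min_le_left d (1 / 2 : ℝ)).trans (hd i)
    simp only at h1
    linarith

/-- The episode `k` is still waiting for the pair `(ŝ, â)` of player `i` after `L` steps of
sampling. -/
def AlgState.Waiting (θ : AlgParams n S A) (σ : AlgState n S A) (k L : ℕ) (i : Fin n) (ŝ : S i)
    (â : A i) : Prop :=
  σ.episode = k ∧ σ.clock = θ.warmup k + L ∧ (ŝ, â) ∈ (σ.player i).todo

open Classical in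
/-- An upper bound for the conditional probability that the episode `k` will wait for `(ŝ, â)`
for `L` steps of sampling: a uniform bound `w` before the sampling phase of the episode `k`, the
probability of not meeting the pair in the remaining steps during that phase, and `0` after it or
once the pair has been visited. -/
def Game.waitBound (G : Game n S A) (θ : AlgParams n S A) (w : ℝ) (k L : ℕ) (i : Fin n) (ŝ : S i)
    (â : A i) (σ : AlgState n S A) (y : S i) : ℝ :=
  if σ.episode < k then w else
    if σ.episode = k then
      if σ.clock < θ.warmup k then w else
        if (ŝ, â) ∈ (σ.player i).todo then
          survive (G.P i) (inducedPolicy (σ.player i).qhat) ŝ â (L - (σ.clock - θ.warmup k)) y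
        else 0
    else 0

include hδ in
theorem Game.waitBound_nonneg {w : ℝ} (hw0 : 0 ≤ w) {k L : ℕ} {i : Fin n} {ŝ : S i} {â : A i}
    {σ : AlgState n S A} (hσ : σ.Valid θ) (y : S i) : 0 ≤ G.waitBound θ w k L i ŝ â σ y := by
  unfold Game.waitBound
  have := survive_nonneg (G.P_isTransition i)
    (isStationaryPolicy_inducedPolicy (hδ i) (hσ.qhat_mem i)) ŝ â
    (L - (σ.clock - θ.warmup k)) y
  split_ifs <;> first | exact hw0 | exact this | exact le_rfl

include hδ in
theorem Game.waitBound_le {w : ℝ} (hw0 : 0 ≤ w) {k L : ℕ} {i : Fin n} {ŝ : S i} {â : A i}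
    (hw : ∀ π : S i → A i → ℝ, IsStationaryPolicy π → (∀ s a, θ.δ i ≤ π s a) →
      ∀ y, survive (G.P i) π ŝ â L y ≤ w)
    {σ : AlgState n S A} (hσ : σ.Valid θ) (hk : σ.episode = k → σ.clock ≤ θ.warmup k) (y : S i) :
    G.waitBound θ w k L i ŝ â σ y ≤ w := by
  unfold Game.waitBound
  split_ifs with h1 h2 h3 h4
  · exact le_rfl
  · exact le_rfl
  · have := hk h2
    rw [show L - (σ.clock - θ.warmup k) = L by omega]
    exact hw _ (isStationaryPolicy_inducedPolicy (hδ i) (hσ.qhat_mem i))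
      (le_inducedPolicy (hδ i) (hσ.qhat_mem i)) y
  · exact hw0
  · exact hw0

include hδ in
/-- `waitBound` is a supermartingale. -/
theorem Game.stepMean_waitBound_le {w : ℝ} (hw0 : 0 ≤ w) {k L : ℕ} {i : Fin n} {ŝ : S i} {â : A i}
    (hw : ∀ π : S i → A i → ℝ, IsStationaryPolicy π → (∀ s a, θ.δ i ≤ π s a) →
      ∀ y, survive (G.P i) π ŝ â L y ≤ w)
    {σ : AlgState n S A} (hσ : σ.Valid θ) (s : ∀ j, S j) :
    G.stepMean (fun j => inducedPolicy (σ.player j).qhat) s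
      (fun b z => G.waitBound θ w k L i ŝ â (G.algStep θ σ s b z) (z i)) ≤
      G.waitBound θ w k L i ŝ â σ (s i) := by
  classical
  have hπ : ∀ j, IsStationaryPolicy (inducedPolicy (σ.player j).qhat) := fun j =>
    isStationaryPolicy_inducedPolicy (hδ j) (hσ.qhat_mem j)
  have hlt : ∀ c : ℝ, (∀ b z, G.waitBound θ w k L i ŝ â (G.algStep θ σ s b z) (z i) ≤ c) →
      G.stepMean (fun j => inducedPolicy (σ.player j).qhat) s
        (fun b z => G.waitBound θ w k L i ŝ â (G.algStep θ σ s b z) (z i)) ≤ c := by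
    intro c hcb
    exact (G.stepMean_mono hπ hcb).trans (G.stepMean_const hπ s c).le
  rcases lt_trichotomy σ.episode k with hk | hk | hk
  · have : G.waitBound θ w k L i ŝ â σ (s i) = w := if_pos hk
    rw [this]
    refine hlt w fun b z => Game.waitBound_le hδ hw0 hw (hσ.step hδ s b z) (fun h => ?_) _
    by_cases hend : G.EpisodeEnds θ σ s b z
    · rw [Game.algStep_of_ends hend]; exact Nat.zero_le _
    · rw [Game.algStep_of_not_ends hend] at h
      exact absurd h hk.ne
  · by_cases hclock : σ.clock < θ.warmup k
    · have : G.waitBound θ w k L i ŝ â σ (s i) = w := by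
        simp only [Game.waitBound, hk, lt_irrefl, if_false, if_true, hclock]
      rw [this]
      refine hlt w fun b z => Game.waitBound_le hδ hw0 hw (hσ.step hδ s b z) (fun h => ?_) _
      have hend : ¬ G.EpisodeEnds θ σ s b z := fun hend => by
        have := (AlgParams.sampling_iff σ).1 hend.1
        rw [hk] at this
        omega
      rw [Game.algStep_of_not_ends hend]
      exact hclock
    · have hsamp : θ.Sampling σ := by
        rw [AlgParams.sampling_iff, hk]; omega
      by_cases htodo : (ŝ, â) ∈ (σ.player i).todo
      · have hσW : G.waitBound θ w k L i ŝ â σ (s i) = survive (G.P i)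
            (inducedPolicy (σ.player i).qhat) ŝ â (L - (σ.clock - θ.warmup k)) (s i) := by
          simp only [Game.waitBound, hk, lt_irrefl, if_false, if_true, hclock, htodo]
        set j := L - (σ.clock + 1 - θ.warmup k) with hj
        set π := inducedPolicy (σ.player i).qhat with hπdef
        have hb : ∀ b z, G.waitBound θ w k L i ŝ â (G.algStep θ σ s b z) (z i) ≤
            (fun (a : A i) (y : S i) => (if s i = ŝ ∧ a = â then 0 else 1) *
              survive (G.P i) π ŝ â j y) (b i) (z i) := by
          intro b z
          have hs0 := survive_nonneg (G.P_isTransition i) (hπ i) ŝ â j (z i)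
          have hr0 : (0 : ℝ) ≤ (if s i = ŝ ∧ b i = â then 0 else 1) *
              survive (G.P i) π ŝ â j (z i) := by
            split_ifs
            · simp
            · rw [one_mul]; exact hs0
          by_cases hend : G.EpisodeEnds θ σ s b z
          · rw [Game.algStep_of_ends hend]
            simp only [Game.waitBound, hk]
            rw [if_neg (by omega), if_neg (by omega)]
            exact hr0
          · rw [Game.algStep_of_not_ends hend]
            simp only [Game.waitBound, hk, lt_irrefl, if_false, if_true]
            rw [if_neg (by omega)]
            simp only [Game.mem_observed_todo, htodo, hsamp, true_and, Game.observed_qhat]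
            by_cases hhit : s i = ŝ ∧ b i = â
            · rw [if_neg (by simp [hhit.1, hhit.2])]
              exact hr0
            · rw [if_pos (fun h => hhit ⟨h.1.symm, h.2.symm⟩), if_neg hhit, one_mul]
        rw [hσW]
        refine (G.stepMean_mono hπ hb).trans ?_
        rw [G.stepMean_single hπ s i (fun (a : A i) (y : S i) =>
          (if s i = ŝ ∧ a = â then 0 else 1) * survive (G.P i) π ŝ â j y)]
        have hmean : ∑ a, ∑ y, π (s i) a * G.P i (s i) a y *
            ((if s i = ŝ ∧ a = â then 0 else 1) * survive (G.P i) π ŝ â j y) =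
            survive (G.P i) π ŝ â (j + 1) (s i) := by
          simp only [survive, killedChain, Finset.sum_mul]
          rw [Finset.sum_comm]
          exact Finset.sum_congr rfl fun _ _ => Finset.sum_congr rfl fun _ _ => by ring
        rw [hmean]
        exact survive_antitone (G.P_isTransition i) (hπ i) ŝ â (s i) (by omega)
      · have hσW : G.waitBound θ w k L i ŝ â σ (s i) = 0 := by
          simp only [Game.waitBound, hk, lt_irrefl, if_false, if_true, hclock, htodo]
        rw [hσW]
        refine hlt 0 fun b z => ?_
        by_cases hend : G.EpisodeEnds θ σ s b z
        · rw [Game.algStep_of_ends hend]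
          simp only [Game.waitBound, hk]
          rw [if_neg (by omega), if_neg (by omega)]
        · rw [Game.algStep_of_not_ends hend]
          simp only [Game.waitBound, hk, lt_irrefl, if_false, if_true]
          rw [if_neg (by omega), if_neg (by rw [Game.mem_observed_todo]; exact fun h => htodo h.1)]
  · have hσW : G.waitBound θ w k L i ŝ â σ (s i) = 0 := by
      simp only [Game.waitBound]
      rw [if_neg (by omega), if_neg (by omega)]
    rw [hσW]
    refine hlt 0 fun b z => ?_
    have hep : k < (G.algStep θ σ s b z).episode := by
      by_cases hend : G.EpisodeEnds θ σ s b z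
      · rw [Game.algStep_of_ends hend]; exact Nat.lt_succ_of_lt hk
      · rw [Game.algStep_of_not_ends hend]; exact hk
    simp only [Game.waitBound]
    rw [if_neg (by omega), if_neg (by omega)]

section Probability

variable {Ω : Type*} [MeasurableSpace Ω] {μ : Measure Ω} [IsProbabilityMeasure μ]
  {X : ℕ → Ω → (∀ i, S i) × (∀ i, A i)}

include hδ hne in
/-- The maximal inequality for the supermartingale `waitBound`. -/
theorem Game.IsPlay.measure_waiting_le (hX : G.IsPlay (G.algPolicy θ) μ X) {w : ℝ} (hw0 : 0 ≤ w)
    {k L : ℕ} {i : Fin n} {ŝ : S i} {â : A i}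
    (hw : ∀ π : S i → A i → ℝ, IsStationaryPolicy π → (∀ s a, θ.δ i ≤ π s a) →
      ∀ y, survive (G.P i) π ŝ â L y ≤ w) :
    μ {ω | ∃ t, (G.algState θ (fun l => X l ω) t).Waiting θ k L i ŝ â} ≤ ENNReal.ofReal w := by
  have hpre := Game.preDet_algState (G := G) (θ := θ)
  have hval := Game.algState_valid (G := G) hδ hne
  refine hX.measure_exists_le Game.preDet_algPolicy (Game.algPolicy_isStationaryPolicy hδ hne)
    (B := fun t => {x | (G.algState θ x t).Waiting θ k L i ŝ â})
    (W := fun t x => G.waitBound θ w k L i ŝ â (G.algState θ x t) ((x t).1 i)) ?_ ?_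
    (fun t x => Game.waitBound_nonneg hδ hw0 (hval x t) _) ?_ ?_ ?_
  · intro t x y h1 h2
    have := hpre t x y h1 h2
    simp only at this
    simp only [Set.mem_ofPred_eq, this]
  · intro t x y h1 h2
    have := hpre t x y h1 h2
    simp only at this
    simp only [this, h2]
  · rintro t x ⟨h1, h2, h3⟩
    simp only [Game.waitBound, h1, h2, h3, lt_irrefl, if_false, if_true]
    rw [if_neg (by omega), show L - (θ.warmup k + L - θ.warmup k) = 0 by omega]
    exact le_rfl
  · intro t x _
    simp only [Game.algState_extPath, extPath_succ]
    exact Game.stepMean_waitBound_le hδ hw0 hw (hval x t) (x t).1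
  · intro x
    exact Game.waitBound_le hδ hw0 hw (hval x 0) (fun _ => Nat.zero_le _) _

end Probability

/-- If the episode `k` never waits longer than `L` steps, its clock is bounded. -/
theorem Game.clock_le_of_not_waiting {x : ℕ → (∀ i, S i) × (∀ i, A i)} {k L : ℕ} (hk1 : 1 ≤ k)
    (h : ∀ i ŝ â t, ¬ (G.algState θ x t).Waiting θ k L i ŝ â) {t : ℕ}
    (ht : (G.algState θ x t).episode = k) :
    (G.algState θ x t).clock ≤ θ.warmup k + L := by
  by_contra! hlt
  have hk : ∃ t, (G.algState θ x t).episode = k := ⟨t, ht⟩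
  obtain ⟨j, rfl⟩ := Game.exists_eq_start_add ht
  have hcj := (Game.within_episode hk1 hk ht).1
  rw [hcj] at hlt
  have hmono := Game.monotone_episode (G := G) (θ := θ) (x := x)
  have hep : ∀ l ≤ j, (G.algState θ x (G.start θ x k + l)).episode = k := fun l hl =>
    le_antisymm ((hmono (by omega : G.start θ x k + l ≤ G.start θ x k + j)).trans ht.le)
      ((Game.episode_start hk).ge.trans (hmono (Nat.le_add_right _ l)))
  set t' := G.start θ x k + (θ.warmup k + L) with ht'
  have h1 : (G.algState θ x t').episode = k := hep (θ.warmup k + L) hlt.le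
  have h2 : (G.algState θ x t').clock = θ.warmup k + L := (Game.within_episode hk1 hk h1).1
  have h3 : ¬ G.EndsAt θ x t' := by
    intro hend
    have h4 : (G.algState θ x (t' + 1)).episode = k := hep (θ.warmup k + L + 1) hlt
    rw [Game.algState_succ_of_ends hend] at h4
    simp only at h4
    omega
  have hsamp : θ.Sampling (G.algState θ x t') := by
    rw [AlgParams.sampling_iff, h1, h2]; omega
  have h5 : ∃ i, (G.observed θ (G.algState θ x t') (x t').1 (x t').2 (x (t' + 1)).1 i).todo ≠ ∅ := by
    by_contra! hcon
    exact h3 ⟨hsamp, hcon⟩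
  obtain ⟨i, hi⟩ := h5
  obtain ⟨⟨ŝ, â⟩, hmem⟩ := Set.nonempty_iff_ne_empty.2 hi
  exact h i ŝ â t' ⟨h1, h2, ((Game.mem_observed_todo i ŝ â).1 hmem).1⟩

theorem Game.exists_next_episode {x : ℕ → (∀ i, S i) × (∀ i, A i)} {k L : ℕ} (hk1 : 1 ≤ k)
    (h : ∀ i ŝ â t, ¬ (G.algState θ x t).Waiting θ k L i ŝ â)
    (hk : ∃ t, (G.algState θ x t).episode = k) : ∃ t, (G.algState θ x t).episode = k + 1 := by
  by_contra! hcon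
  have hep : ∀ j, (G.algState θ x (G.start θ x k + j)).episode = k := by
    intro j
    induction j with
    | zero => exact Game.episode_start hk
    | succ j ih =>
      have h1 := Game.episode_succ_le (G := G) (θ := θ) (x := x) (G.start θ x k + j)
      have h2 := Game.monotone_episode (G := G) (θ := θ) (x := x)
        (Nat.le_succ (G.start θ x k + j))
      have h3 := hcon (G.start θ x k + j + 1)
      simp only [Nat.succ_eq_add_one] at h2
      rw [← add_assoc]
      omega
  have h1 := Game.clock_le_of_not_waiting hk1 h (hep (θ.warmup k + L + 1))
  rw [(Game.within_episode hk1 hk (hep _)).1] at h1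
  omega

theorem Game.start_succ_le {x : ℕ → (∀ i, S i) × (∀ i, A i)} {k L : ℕ} (hk1 : 1 ≤ k)
    (h : ∀ i ŝ â t, ¬ (G.algState θ x t).Waiting θ k L i ŝ â)
    (hk : ∃ t, (G.algState θ x t).episode = k) (hk' : ∃ t, (G.algState θ x t).episode = k + 1) :
    G.start θ x (k + 1) ≤ G.start θ x k + (θ.warmup k + L + 1) := by
  obtain ⟨e, he, hep, -⟩ := Game.exists_end hk1 hk'
  have h1 := Game.clock_le_of_not_waiting hk1 h hep
  obtain ⟨j, rfl⟩ := Game.exists_eq_start_add hep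
  rw [(Game.within_episode hk1 hk hep).1] at h1
  omega

/-- Logarithmic increments add up to `O(k log k)`. The exponent `4/3 > 1` is chosen to match the
constant in `ae_deviation_le`. -/
theorem eventually_le_rpow_of_step_le {T : ℕ → ℝ} {C : ℝ} (hC : 0 ≤ C) {K : ℕ}
    (hT : ∀ k ≥ K, T (k + 1) ≤ T k + C * (1 + Real.log k)) :
    ∀ᶠ k : ℕ in atTop, T (k + 1) ≤ (k : ℝ) ^ (4 / 3 : ℝ) := by
  have h1 : ∀ k ≥ K, T (k + 1) ≤ |T K| + C * (k + 1) * (1 + Real.log k) := by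
    intro k hk
    induction k, hk using Nat.le_induction with
    | base =>
      have h0 := Real.log_natCast_nonneg K
      have h2 : 0 ≤ C * K * (1 + Real.log K) := by positivity
      have h3 := le_abs_self (T K)
      linarith [hT K le_rfl]
    | succ k hk ih =>
      have h0 := Real.log_natCast_nonneg k
      have hlog : Real.log k ≤ Real.log ((k + 1 : ℕ) : ℝ) := by
        rcases Nat.eq_zero_or_pos k with rfl | hk0
        · simp
        · exact Real.log_le_log (by exact_mod_cast hk0) (by push_cast; linarith)
      have h2 := hT (k + 1) (by omega)
      have h3 : C * (k + 1) * (1 + Real.log k) ≤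
          C * (k + 1) * (1 + Real.log ((k + 1 : ℕ) : ℝ)) := by gcongr
      push_cast at *
      linarith
  have hlim : Tendsto (fun k : ℕ => (k : ℝ) ^ (1 / 12 : ℝ)) atTop atTop :=
    (tendsto_rpow_atTop (by norm_num)).comp tendsto_natCast_atTop_atTop
  filter_upwards [eventually_ge_atTop K, eventually_ge_atTop 1,
    hlim.eventually_ge_atTop (|T K| + 10 * C)] with k hkK hk1 hk
  refine (h1 k hkK).trans ?_
  have hk1' : (1 : ℝ) ≤ k := by exact_mod_cast hk1
  have hlog := Real.log_le_rpow_div (x := (k : ℝ)) (by positivity) (show (0 : ℝ) < 1 / 4 by norm_num)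
  have h14 : (1 : ℝ) ≤ (k : ℝ) ^ (1 / 4 : ℝ) := Real.one_le_rpow hk1' (by norm_num)
  have h54 : (1 : ℝ) ≤ (k : ℝ) ^ (5 / 4 : ℝ) := Real.one_le_rpow hk1' (by norm_num)
  have hsplit : (k : ℝ) * (k : ℝ) ^ (1 / 4 : ℝ) = (k : ℝ) ^ (5 / 4 : ℝ) := by
    rw [← Real.rpow_one_add' (by positivity) (by norm_num)]; norm_num
  have hsplit2 : (k : ℝ) ^ (1 / 12 : ℝ) * (k : ℝ) ^ (5 / 4 : ℝ) = (k : ℝ) ^ (4 / 3 : ℝ) := by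
    rw [← Real.rpow_add (by positivity)]; norm_num
  have h2 : (k + 1 : ℝ) * (1 + Real.log k) ≤ 10 * (k : ℝ) ^ (5 / 4 : ℝ) := by
    have h3 : 1 + Real.log k ≤ 5 * (k : ℝ) ^ (1 / 4 : ℝ) := by
      have : (k : ℝ) ^ (1 / 4 : ℝ) / (1 / 4) = 4 * (k : ℝ) ^ (1 / 4 : ℝ) := by ring
      linarith
    have h4 := Real.log_natCast_nonneg k
    calc (k + 1 : ℝ) * (1 + Real.log k) ≤ (2 * k) * (5 * (k : ℝ) ^ (1 / 4 : ℝ)) := by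
          gcongr; linarith
      _ = 10 * (k : ℝ) ^ (5 / 4 : ℝ) := by rw [← hsplit]; ring
  calc |T K| + C * (k + 1) * (1 + Real.log k)
      = |T K| + C * ((k + 1) * (1 + Real.log k)) := by ring
    _ ≤ |T K| * (k : ℝ) ^ (5 / 4 : ℝ) + C * (10 * (k : ℝ) ^ (5 / 4 : ℝ)) := by
        gcongr
        exact le_mul_of_one_le_right (abs_nonneg _) h54
    _ = (|T K| + 10 * C) * (k : ℝ) ^ (5 / 4 : ℝ) := by ring
    _ ≤ (k : ℝ) ^ (1 / 12 : ℝ) * (k : ℝ) ^ (5 / 4 : ℝ) := by gcongr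
    _ = _ := hsplit2

variable {Ω : Type*} [MeasurableSpace Ω] {μ : Measure Ω} [IsProbabilityMeasure μ]
  {X : ℕ → Ω → (∀ i, S i) × (∀ i, A i)}

include hδ hne in
/-- Almost surely all episodes are finite, and the first `k` of them take at most `k ^ (4/3)` steps
for large `k`. -/
theorem Game.IsPlay.ae_episodes (hX : G.IsPlay (G.algPolicy θ) μ X) {β τ : ℝ} (hβ0 : 0 ≤ β)
    (hβ1 : β < 1) (hc : ∀ i, Contracts (G.P i) β)
    (hneP : ∀ i, (shrunkOf (θ.δ i) (G.P i)).Nonempty) (hτ : 0 < τ)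
    (hd : ∀ k, θ.d k = 2 * τ * Real.log k) :
    ∀ᵐ ω ∂μ, (∀ k ≥ 1, ∃ t, (G.algState θ (fun l => X l ω) t).episode = k) ∧
      ∀ᶠ k : ℕ in atTop, (G.start θ (fun l => X l ω) (k + 1) : ℝ) ≤ (k : ℝ) ^ (4 / 3 : ℝ) := by
  obtain ⟨m, w, hw0, hw1, hw⟩ := Game.exists_block hδ hβ0 hβ1 hc hneP
  have hpow : ∀ (r : ℕ) i (π : S i → A i → ℝ), IsStationaryPolicy π → (∀ s a, θ.δ i ≤ π s a) →
      ∀ ŝ â y, survive (G.P i) π ŝ â (r * m) y ≤ w ^ r := fun r i π hπ hπδ ŝ â y =>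
    survive_mul_le (G.P_isTransition i) hπ ŝ â hw0.le (hw i π hπ hπδ ŝ â) r y
  have hmeas : ∀ k r i ŝ â, μ {ω | ∃ t, (G.algState θ (fun l => X l ω) t).Waiting θ k (r * m) i ŝ â}
      ≤ ENNReal.ofReal (w ^ r) := fun k r i ŝ â =>
    hX.measure_waiting_le hδ hne (by positivity) fun π hπ hπδ y => hpow r i π hπ hπδ ŝ â y
  -- every episode ends: for given `k`, waiting for `r * m` steps is summable in `r`
  have hfin : ∀ᵐ ω ∂μ, ∀ k i ŝ â, ∀ᶠ r in atTop,
      ω ∉ {ω | ∃ t, (G.algState θ (fun l => X l ω) t).Waiting θ k (r * m) i ŝ â} := by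
    refine ae_all_iff.2 fun k => ae_all_iff.2 fun i => ae_all_iff.2 fun ŝ => ae_all_iff.2 fun â => ?_
    refine ae_eventually_notMem_of_le (f := fun r => w ^ (r + 1))
      ((summable_nat_add_iff 1).2 (summable_geometric_of_lt_one hw0.le hw1))
      (fun r => by positivity) fun r => hmeas k (r + 1) i ŝ â
  -- with logarithmically many blocks, waiting is summable in `k`
  have hlw : Real.log w < 0 := Real.log_neg hw0 hw1
  set r : ℕ → ℕ := fun k => ⌈2 / (-Real.log w) * Real.log k⌉₊ with hr
  have hwr : ∀ k : ℕ, w ^ r (k + 1) ≤ ((k + 1 : ℕ) : ℝ) ^ (-2 : ℝ) := by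
    intro k
    have hk : (0 : ℝ) < ((k + 1 : ℕ) : ℝ) := by positivity
    rw [← Real.rpow_natCast, Real.rpow_def_of_pos hw0, Real.rpow_def_of_pos hk]
    refine Real.exp_le_exp.2 ?_
    have h1 := Nat.le_ceil (2 / (-Real.log w) * Real.log ((k + 1 : ℕ) : ℝ))
    have h2 := mul_le_mul_of_nonpos_left h1 hlw.le
    refine h2.trans (le_of_eq ?_)
    have hne : Real.log w ≠ 0 := hlw.ne
    rw [div_neg]
    field_simp
  have hlong : ∀ᵐ ω ∂μ, ∀ i ŝ â, ∀ᶠ k in atTop,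
      ω ∉ {ω | ∃ t, (G.algState θ (fun l => X l ω) t).Waiting θ k (r k * m) i ŝ â} := by
    refine ae_all_iff.2 fun i => ae_all_iff.2 fun ŝ => ae_all_iff.2 fun â => ?_
    exact ae_eventually_notMem_of_le (f := fun k => ((k + 1 : ℕ) : ℝ) ^ (-2 : ℝ))
      ((summable_nat_add_iff 1).2 (Real.summable_nat_rpow.2 (by norm_num)))
      (fun k => by positivity)
      fun k => (hmeas (k + 1) (r (k + 1)) i ŝ â).trans (ENNReal.ofReal_le_ofReal (hwr k))
  filter_upwards [hfin, hlong] with ω h1 h2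
  set x : ℕ → (∀ i, S i) × (∀ i, A i) := fun l => X l ω
  have hall : ∀ k ≥ 1, ∃ t, (G.algState θ x t).episode = k := by
    intro k hk
    induction k, hk using Nat.le_induction with
    | base => exact ⟨0, rfl⟩
    | succ k hk ih =>
      have : ∀ᶠ r in atTop, ∀ i ŝ â,
          ω ∉ {ω | ∃ t, (G.algState θ (fun l => X l ω) t).Waiting θ k (r * m) i ŝ â} :=
        eventually_all.2 fun i => eventually_all.2 fun ŝ => eventually_all.2 fun â => h1 k i ŝ â
      obtain ⟨r, hr⟩ := this.exists
      exact Game.exists_next_episode hk (fun i ŝ â t ht => hr i ŝ â ⟨t, ht⟩) ih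
  refine ⟨hall, ?_⟩
  have h3 : ∀ᶠ k in atTop, ∀ i ŝ â,
      ω ∉ {ω | ∃ t, (G.algState θ (fun l => X l ω) t).Waiting θ k (r k * m) i ŝ â} :=
    eventually_all.2 fun i => eventually_all.2 fun ŝ => eventually_all.2 fun â => h2 i ŝ â
  obtain ⟨K, hK⟩ := eventually_atTop.1 h3
  refine eventually_le_rpow_of_step_le (T := fun k => (G.start θ x k : ℝ))
    (C := 2 * τ + 2 + (2 / (-Real.log w) + 1) * m) (K := K + 1) ?_ fun k hk => ?_
  · have : 0 < 2 / (-Real.log w) := div_pos two_pos (by linarith)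
    positivity
  · have h4 := Game.start_succ_le (by omega) (fun i ŝ â t ht => hK k (by omega) i ŝ â ⟨t, ht⟩)
      (hall k (by omega)) (hall (k + 1) (by omega))
    have h5 : (G.start θ x (k + 1) : ℝ) ≤ G.start θ x k + (θ.warmup k + r k * m + 1) := by
      exact_mod_cast h4
    have hlog := Real.log_natCast_nonneg k
    have h6 : (θ.warmup k : ℝ) ≤ 2 * τ * Real.log k + 1 := by
      rw [← hd k]
      exact (Nat.ceil_lt_add_one (by rw [hd]; positivity)).le
    have hw2 : 0 < 2 / (-Real.log w) := div_pos two_pos (by linarith)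
    have h7 : (r k : ℝ) ≤ 2 / (-Real.log w) * Real.log k + 1 :=
      (Nat.ceil_lt_add_one (by positivity)).le
    have h8 : (r k : ℝ) * m ≤ (2 / (-Real.log w) * Real.log k + 1) * m := by gcongr
    have h9 : 0 ≤ (m : ℝ) * Real.log k := by positivity
    have h10 : 0 ≤ 2 / (-Real.log w) * m := by positivity
    refine h5.trans ?_
    nlinarith

end EpisodeLength

/-! ### The confidence sets eventually contain the true transition matrices -/

section ConfidenceSequence

variable {S A : Type*} [Fintype S] [Fintype A]

/-- An occupancy measure that is compatible with a confidence box containing `P` is almost one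
of `P`. -/
theorem abs_sub_rho_mul_le_of_mem_confBox {δ : ℝ} (hδ : 0 < δ) {count : S → A → S → ℕ}
    {rad : ℕ → ℝ} {P : S → A → S → ℝ} (hP : P ∈ confBox count rad) {q : S → A → S → ℝ}
    (hq : q ∈ shrunkIn δ (confBox count rad)) {r : ℝ}
    (hr : ∀ s a, rad (∑ y, count s a y) ≤ r) (s : S) (a : A) (s' : S) :
    |q s a s' - rho q s a * P s a s'| ≤ 2 * r := by
  have h1 := abs_le.1 (hP s a s')
  have h2 := abs_le.1 (hq.2 s a s')
  have h3 := hr s a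
  have h4 : |inducedTransition q s a s' - P s a s'| ≤ 2 * r := by
    rw [abs_le]; constructor <;> linarith
  rw [← mul_inducedTransition hδ hq.1 s a s', ← mul_sub, abs_mul,
    abs_of_nonneg (rho_nonneg hq.1.1 s a)]
  exact (mul_le_of_le_one_left (abs_nonneg _) (rho_le_one hq.1.1 s a)).trans h4

/-- If the boxes eventually contain `P` and shrink to it, then so do the confidence sets. Either
the old set is discarded at some late time, and from then on `P` is never excluded; or the
confidence sets are eventually decreasing, and by compactness they have a common
point, which can only be `P`. -/
theorem eventually_mem_confSet {δ : ℝ} (hδ : 0 < δ) {P : S → A → S → ℝ}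
    (hneP : (shrunkOf δ P).Nonempty) {Q box : ℕ → Set (S → A → S → ℝ)} {r : ℕ → ℝ} {K : ℕ}
    (hbox : ∀ k ≥ K, P ∈ box k) (hQ : ∀ k ≥ K, Q (k + 1) = confUpdate δ (box k) (Q k))
    (hconv : ∀ k ≥ K, IsConvexConstraint δ (Q k))
    (hclose : ∀ k ≥ K, ∀ q ∈ shrunkIn δ (box k), ∀ s a s', |q s a s' - rho q s a * P s a s'| ≤ r k)
    (hr : Tendsto r atTop (𝓝 0)) : ∀ᶠ k in atTop, P ∈ Q k := by
  have hkeep : ∀ k ≥ K, P ∈ Q k → P ∈ Q (k + 1) := by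
    intro k hk hPk
    obtain ⟨q, hq⟩ := hneP
    have hP : P ∈ box k ∩ Q k := ⟨hbox k hk, hPk⟩
    rw [hQ k hk, confUpdate, if_pos ⟨q, hq.1, by rw [hq.2]; exact hP⟩]
    exact hP
  by_cases hreset : ∃ k ≥ K, ¬ (shrunkIn δ (box k ∩ Q k)).Nonempty
  · obtain ⟨k, hk, hkne⟩ := hreset
    filter_upwards [eventually_ge_atTop (k + 1)] with l hl
    induction l, hl using Nat.le_induction with
    | base =>
      rw [hQ k hk, confUpdate, if_neg hkne]
      exact hbox k hk
    | succ l hl ih => exact hkeep l (by omega) ih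
  · push Not at hreset
    have hstep : ∀ k ≥ K, Q (k + 1) = box k ∩ Q k := fun k hk => by
      rw [hQ k hk, confUpdate, if_pos (hreset k hk)]
    obtain ⟨q, hq⟩ := IsCompact.nonempty_iInter_of_sequence_nonempty_isCompact_isClosed
      (fun j => shrunkIn δ (Q (K + j + 1)))
      (fun j => by
        rw [show K + (j + 1) + 1 = K + j + 1 + 1 by ring, hstep (K + j + 1) (by omega),
          shrunkIn_inter]
        exact Set.inter_subset_right)
      (fun j => by rw [hstep (K + j) (by omega)]; exact hreset _ (by omega))
      (hconv (K + 0 + 1) (by omega)).isCompact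
      (fun j => (hconv (K + j + 1) (by omega)).1)
    rw [Set.mem_iInter] at hq
    have hqP : ∀ s a s', q s a s' = rho q s a * P s a s' := by
      intro s a s'
      have h1 : ∀ᶠ k in atTop, |q s a s' - rho q s a * P s a s'| ≤ r k := by
        filter_upwards [eventually_ge_atTop K] with k hk
        obtain ⟨j, rfl⟩ := Nat.exists_eq_add_of_le hk
        have h2 := hq j
        rw [hstep (K + j) (by omega), shrunkIn_inter] at h2
        exact hclose (K + j) hk q h2.1 s a s'
      have h3 := ge_of_tendsto hr h1
      have h4 := abs_nonpos_iff.1 h3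
      linarith
    have hq2 : inducedTransition q = P := (mem_shrunkOf_of_eq hδ (hq 0).1 hqP).2
    filter_upwards [eventually_ge_atTop (K + 1)] with k hk
    obtain ⟨j, rfl⟩ := Nat.exists_eq_add_of_le hk
    have h2 := (hq j).2
    rw [hq2, show K + j + 1 = K + 1 + j by ring] at h2
    exact h2

end ConfidenceSequence

section Confidence

variable {n : ℕ} {S A : Fin n → Type*} [∀ i, Fintype (S i)] [∀ i, Fintype (A i)]
  {G : Game n S A} {θ : AlgParams n S A} (hδ : ∀ i, 0 < θ.δ i)
  (hne : ∀ i, (shrunk (θ.δ i) : Set (S i → A i → S i → ℝ)).Nonempty)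
  {x : ℕ → (∀ i, S i) × (∀ i, A i)}

/-- The occupancy measures of the episode `k` along the path `x`. -/
def Game.qhatAt (G : Game n S A) (θ : AlgParams n S A) (x : ℕ → (∀ i, S i) × (∀ i, A i)) (k : ℕ)
    (i : Fin n) : S i → A i → S i → ℝ :=
  ((G.algState θ x (G.start θ x k)).player i).qhat

/-- The confidence sets in the episode `k` along the path `x`. -/
def Game.confSetAt (G : Game n S A) (θ : AlgParams n S A) (x : ℕ → (∀ i, S i) × (∀ i, A i))
    (k : ℕ) (i : Fin n) : Set (S i → A i → S i → ℝ) :=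
  ((G.algState θ x (G.start θ x k)).player i).confSet

/-- The rewards recorded in the episode `k` along the path `x`, after the last observation of that
episode. -/
def Game.rewardAt (G : Game n S A) (θ : AlgParams n S A) (x : ℕ → (∀ i, S i) × (∀ i, A i)) (k : ℕ)
    (i : Fin n) : S i → A i → ℝ :=
  let e := G.start θ x (k + 1) - 1
  (G.observed θ (G.algState θ x e) (x e).1 (x e).2 (x (e + 1)).1 i).R

/-- The update at the end of an episode. -/
theorem Game.episode_update {k : ℕ} (hk1 : 1 ≤ k) (hk : ∃ t, (G.algState θ x t).episode = k)
    (hk' : ∃ t, (G.algState θ x t).episode = k + 1) (i : Fin n) :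
    G.confSetAt θ x (k + 1) i = confUpdate (θ.δ i)
      (confBox ((G.algState θ x (G.start θ x (k + 1))).player i).count (θ.rad i k))
      (G.confSetAt θ x k i) ∧
    G.qhatAt θ x (k + 1) i = omdUpdate (θ.δ i) (θ.h i) (θ.η k) (G.confSetAt θ x (k + 1) i)
      (G.rewardAt θ x k i) (G.qhatAt θ x k i) := by
  obtain ⟨e, he, hep, hend⟩ := Game.exists_end hk1 hk'
  obtain ⟨j, hj⟩ := Game.exists_eq_start_add hep
  have hw := Game.within_episode hk1 hk (j := j) (by rw [← hj]; exact hep)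
  rw [← hj] at hw
  have hR : G.rewardAt θ x k i =
      (G.observed θ (G.algState θ x e) (x e).1 (x e).2 (x (e + 1)).1 i).R := by
    unfold Game.rewardAt
    simp only [he, Nat.add_sub_cancel]
  have hc : G.confSetAt θ x (k + 1) i = confUpdate (θ.δ i)
      (confBox ((G.algState θ x (G.start θ x (k + 1))).player i).count (θ.rad i k))
      (G.confSetAt θ x k i) := by
    unfold Game.confSetAt
    rw [he, Game.algState_succ_of_ends hend, ← hw.2.2 i, hep]
    rfl
  refine ⟨hc, ?_⟩
  rw [hR]
  unfold Game.qhatAt Game.confSetAt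
  rw [he, Game.algState_succ_of_ends hend, ← hw.2.1 i, hep]
  rfl

include hδ hne in
theorem Game.rewardAt_mem (k : ℕ) (i : Fin n) (s : S i) (a : A i) :
    G.rewardAt θ x k i s a ∈ Set.Icc (0 : ℝ) 1 :=
  (Game.algState_valid hδ hne x _).observed_R_mem _ _ _ i s a

variable {γ : ℝ} (hγ : γ ∈ Set.Ioo (0 : ℝ) 1)
  (hrad : ∀ i k N, θ.rad i k N = Real.sqrt
    ((Real.log (2 * (n : ℝ) * (k : ℝ) ^ 2 * (Fintype.card (A i) : ℝ)
      * (Fintype.card (S i) : ℝ) ^ 2) - Real.log γ) / (2 * max 1 (N : ℝ))))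

include hrad in
/-- The confidence radius after at least `k` visits is of the order `√(log k / k)`. -/
theorem AlgParams.exists_rad_le [∀ i, Nonempty (S i)] [∀ i, Nonempty (A i)] :
    ∃ C : ℝ, 0 ≤ C ∧ ∀ k ≥ 2, ∀ i, ∀ N ≥ k, θ.rad i k N ≤ C * Real.sqrt (Real.log k / k) := by
  set c : Fin n → ℝ := fun i => Real.log (2 * (n : ℝ) * (Fintype.card (A i) : ℝ)
      * (Fintype.card (S i) : ℝ) ^ 2) - Real.log γ with hc
  have hl2 : 0 < Real.log 2 := Real.log_pos one_lt_two
  refine ⟨Real.sqrt (2 + ∑ i, |c i| / Real.log 2), by positivity, fun k hk i N hN => ?_⟩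
  have hn : (0 : ℝ) < n := by exact_mod_cast i.pos
  have hA : (0 : ℝ) < Fintype.card (A i) := by exact_mod_cast Fintype.card_pos
  have hS : (0 : ℝ) < Fintype.card (S i) := by exact_mod_cast Fintype.card_pos
  have hk0 : (2 : ℝ) ≤ k := by exact_mod_cast hk
  have hNk : (k : ℝ) ≤ N := by exact_mod_cast hN
  have hlk : Real.log 2 ≤ Real.log k := Real.log_le_log two_pos hk0
  rw [hrad, ← Real.sqrt_mul (by positivity)]
  refine Real.sqrt_le_sqrt ?_
  have h1 : Real.log (2 * (n : ℝ) * (k : ℝ) ^ 2 * (Fintype.card (A i) : ℝ)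
      * (Fintype.card (S i) : ℝ) ^ 2) - Real.log γ = 2 * Real.log k + c i := by
    rw [show 2 * (n : ℝ) * (k : ℝ) ^ 2 * (Fintype.card (A i) : ℝ) * (Fintype.card (S i) : ℝ) ^ 2 =
      (k : ℝ) ^ 2 * (2 * (n : ℝ) * (Fintype.card (A i) : ℝ) * (Fintype.card (S i) : ℝ) ^ 2) by ring,
      Real.log_mul (by positivity) (by positivity), Real.log_pow]
    push_cast
    simp only [hc]
    ring
  rw [h1]
  have h2 : |c i| / Real.log 2 ≤ ∑ i, |c i| / Real.log 2 :=
    Finset.single_le_sum (f := fun i => |c i| / Real.log 2) (fun _ _ => by positivity)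
      (Finset.mem_univ i)
  have h3 : c i ≤ |c i| / Real.log 2 * Real.log k := by
    rw [div_mul_eq_mul_div, le_div_iff₀ hl2]
    calc c i * Real.log 2 ≤ |c i| * Real.log 2 := by gcongr; exact le_abs_self _
      _ ≤ |c i| * Real.log k := by gcongr
  have h4 : |c i| / Real.log 2 * Real.log k ≤ (∑ i, |c i| / Real.log 2) * Real.log k := by
    gcongr
  have h5 : 2 * Real.log k + c i ≤ (2 + ∑ i, |c i| / Real.log 2) * Real.log k := by linarith
  have h6 : (k : ℝ) ≤ 2 * max 1 (N : ℝ) := by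
    have := le_max_right 1 (N : ℝ)
    linarith
  have h7 : 0 ≤ (2 + ∑ i, |c i| / Real.log 2) * Real.log k := by positivity
  calc (2 * Real.log k + c i) / (2 * max 1 (N : ℝ))
      ≤ (2 + ∑ i, |c i| / Real.log 2) * Real.log k / (2 * max 1 (N : ℝ)) := by gcongr
    _ ≤ (2 + ∑ i, |c i| / Real.log 2) * Real.log k / k :=
        div_le_div_of_nonneg_left h7 (by linarith) h6
    _ = _ := by ring

theorem tendsto_sqrt_log_div : Tendsto (fun k : ℕ => Real.sqrt (Real.log k / k)) atTop (𝓝 0) := by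
  have h := (Real.isLittleO_log_id_atTop.tendsto_div_nhds_zero).comp tendsto_natCast_atTop_atTop
  have h2 := (Real.continuous_sqrt.tendsto 0).comp h
  rw [Real.sqrt_zero] at h2
  exact h2

include hδ hne in
/-- Every pair has been visited in each of the first `k` episodes. -/
theorem Game.le_sum_count_start {k : ℕ} (hk : ∃ t, (G.algState θ x t).episode = k + 1) (i : Fin n)
    (s : S i) (a : A i) :
    k ≤ ∑ y, ((G.algState θ x (G.start θ x (k + 1))).player i).count s a y := by
  have := (Game.algState_valid (G := G) hδ hne x (G.start θ x (k + 1))).episode_le i s a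
  rw [Game.episode_start hk] at this
  omega

include hδ hne hγ hrad in
/-- The confidence boxes eventually contain the true transition matrices: the deviations are at most
`√(3/4 N log N)` for `N` visits, and `log N ≤ 4/3 log k` because `N` is at most the length `k ^ (4/3)`
of the first `k` episodes, so that the radius `√((log (k ^ 2) + …) / (2 N))` dominates. -/
theorem Game.eventually_mem_confBox
    (hall : ∀ k ≥ 1, ∃ t, (G.algState θ x t).episode = k)
    (hlen : ∀ᶠ k : ℕ in atTop, (G.start θ x (k + 1) : ℝ) ≤ (k : ℝ) ^ (4 / 3 : ℝ))
    (hdev : ∀ i s a s', ∀ᶠ N : ℕ in atTop, ∀ t,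
      ∑ z, ((G.algState θ x t).player i).count s a z = N →
      |(G.algState θ x t).deviation G i s a s'| ≤ Real.sqrt (3 / 4 * N * Real.log N)) :
    ∀ᶠ k in atTop, ∀ i, G.P i ∈
      confBox ((G.algState θ x (G.start θ x (k + 1))).player i).count (θ.rad i k) := by
  refine eventually_all.2 fun i => ?_
  have key : ∀ s a s', ∀ᶠ k in atTop,
      |G.P i s a s' - (((G.algState θ x (G.start θ x (k + 1))).player i).count s a s' : ℝ) /
        max 1 ((∑ y, ((G.algState θ x (G.start θ x (k + 1))).player i).count s a y : ℕ) : ℝ)| ≤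
      θ.rad i k (∑ y, ((G.algState θ x (G.start θ x (k + 1))).player i).count s a y) := by
    intro s a s'
    obtain ⟨N₀, hN₀⟩ := eventually_atTop.1 (hdev i s a s')
    filter_upwards [hlen, eventually_ge_atTop (max 1 N₀)] with k hk1 hk2
    have hkN := Game.le_sum_count_start hδ hne (x := x) (hall (k + 1) (by omega)) i s a
    have hNT := Game.sum_count_le (G := G) (θ := θ) x (G.start θ x (k + 1)) i s a
    have hd := hN₀ _ (((le_max_right 1 N₀).trans hk2).trans hkN) (G.start θ x (k + 1)) rfl
    unfold AlgState.deviation at hd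
    set N := ∑ y, ((G.algState θ x (G.start θ x (k + 1))).player i).count s a y
    set M := ((G.algState θ x (G.start θ x (k + 1))).player i).count s a s'
    have hk1' : (1 : ℝ) ≤ k := by exact_mod_cast (le_max_left 1 N₀).trans hk2
    have hkN' : (k : ℝ) ≤ N := by exact_mod_cast hkN
    have hN1 : (1 : ℝ) ≤ N := hk1'.trans hkN'
    have hN0 : (0 : ℝ) < N := by linarith
    have hNk : (N : ℝ) ≤ (k : ℝ) ^ (4 / 3 : ℝ) := le_trans (by exact_mod_cast hNT) hk1
    have hlog : Real.log N ≤ 4 / 3 * Real.log k := by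
      rw [← Real.log_rpow (by linarith)]
      exact Real.log_le_log hN0 hNk
    have hn : (1 : ℝ) ≤ n := by exact_mod_cast i.pos
    have hA : (1 : ℝ) ≤ Fintype.card (A i) := by
      exact_mod_cast (Fintype.card_pos_iff.2 ⟨a⟩ : 0 < Fintype.card (A i))
    have hS : (1 : ℝ) ≤ Fintype.card (S i) := by
      exact_mod_cast (Fintype.card_pos_iff.2 ⟨s⟩ : 0 < Fintype.card (S i))
    have hlarge : 2 * Real.log k ≤ Real.log (2 * (n : ℝ) * (k : ℝ) ^ 2 *
        (Fintype.card (A i) : ℝ) * (Fintype.card (S i) : ℝ) ^ 2) - Real.log γ := by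
      have h1 : Real.log γ ≤ 0 := Real.log_nonpos hγ.1.le hγ.2.le
      have h2 : Real.log ((k : ℝ) ^ 2) = 2 * Real.log k := by rw [Real.log_pow]; norm_num
      have hS2 : (1 : ℝ) ≤ (Fintype.card (S i) : ℝ) ^ 2 := one_le_pow₀ hS
      have hc : (1 : ℝ) ≤ 2 * n * ((Fintype.card (A i) : ℝ) * (Fintype.card (S i) : ℝ) ^ 2) :=
        one_le_mul_of_one_le_of_one_le (by linarith) (one_le_mul_of_one_le_of_one_le hA hS2)
      have h3 : (k : ℝ) ^ 2 ≤ 2 * (n : ℝ) * (k : ℝ) ^ 2 *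
          (Fintype.card (A i) : ℝ) * (Fintype.card (S i) : ℝ) ^ 2 := by
        calc (k : ℝ) ^ 2 ≤ (k : ℝ) ^ 2 *
              (2 * n * ((Fintype.card (A i) : ℝ) * (Fintype.card (S i) : ℝ) ^ 2)) :=
              le_mul_of_one_le_right (by positivity) hc
          _ = _ := by ring
      have h4 := Real.log_le_log (by positivity) h3
      linarith
    rw [max_eq_right hN1, hrad, max_eq_right hN1]
    have hPM : |G.P i s a s' - (M : ℝ) / N| = |(M : ℝ) - N * G.P i s a s'| / N := by
      rw [abs_sub_comm, ← abs_of_pos hN0, ← abs_div, abs_of_pos hN0]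
      congr 1
      field_simp
    rw [hPM, div_le_iff₀ hN0]
    refine hd.trans ?_
    rw [← Real.sqrt_sq hN0.le, ← Real.sqrt_mul' _ (by positivity), Real.sqrt_sq hN0.le]
    refine Real.sqrt_le_sqrt ?_
    have hcancel : ∀ L : ℝ, L / (2 * N) * (N : ℝ) ^ 2 = L / 2 * N := fun L => by field_simp
    rw [hcancel, mul_right_comm]
    gcongr
    linarith
  have h1 := eventually_all.2 fun s => eventually_all.2 fun a => eventually_all.2 fun s' =>
    key s a s'
  filter_upwards [h1] with k hk
  exact hk

include hδ hne hrad in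
/-- The confidence sets eventually contain the true transition matrices, and the occupancy measures
are compatible with them up to an error of the order `√(log k / k)`. -/
theorem Game.eventually_mem_confSet [∀ i, Nonempty (S i)] [∀ i, Nonempty (A i)]
    (hneP : ∀ i, (shrunkOf (θ.δ i) (G.P i)).Nonempty)
    (hdiff : ∀ i, DifferentiableOn ℝ (θ.h i) (shrunk (θ.δ i)))
    (hall : ∀ k ≥ 1, ∃ t, (G.algState θ x t).episode = k)
    (hbox : ∀ᶠ k in atTop, ∀ i, G.P i ∈
      confBox ((G.algState θ x (G.start θ x (k + 1))).player i).count (θ.rad i k)) :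
    ∃ C : ℝ, 0 ≤ C ∧ ∀ᶠ k in atTop, ∀ i, G.P i ∈ G.confSetAt θ x (k + 1) i ∧
      ∀ s a s', |G.qhatAt θ x (k + 1) i s a s' -
        rho (G.qhatAt θ x (k + 1) i) s a * G.P i s a s'| ≤ C * Real.sqrt (Real.log k / k) := by
  obtain ⟨C, hC0, hC⟩ := AlgParams.exists_rad_le hrad
  refine ⟨2 * C, by positivity, eventually_all.2 fun i => ?_⟩
  obtain ⟨K, hK⟩ := eventually_atTop.1 hbox
  set box : ℕ → Set (S i → A i → S i → ℝ) := fun k =>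
    confBox ((G.algState θ x (G.start θ x (k + 1))).player i).count (θ.rad i k) with hboxdef
  have hclose : ∀ k ≥ max 2 K, ∀ q ∈ shrunkIn (θ.δ i) (box k), ∀ s a s',
      |q s a s' - rho q s a * G.P i s a s'| ≤ 2 * (C * Real.sqrt (Real.log k / k)) := by
    intro k hk q hq
    refine abs_sub_rho_mul_le_of_mem_confBox (hδ i) (hK k ((le_max_right 2 K).trans hk) i) hq ?_
    intro s a
    exact hC k ((le_max_left 2 K).trans hk) i _
      (Game.le_sum_count_start hδ hne (hall (k + 1) (by omega)) i s a)
  have h2K : ∀ k ≥ max 2 K, 1 ≤ k := fun k hk => by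
    have := (le_max_left 2 K).trans hk
    omega
  have hupd := fun k (hk : k ≥ max 2 K) =>
    Game.episode_update (h2K k hk) (hall k (h2K k hk)) (hall (k + 1) (by omega)) i
  have hmem : ∀ᶠ k in atTop, G.P i ∈ G.confSetAt θ x k i := by
    refine LearnGame.eventually_mem_confSet (hδ i) (hneP i) (Q := fun k => G.confSetAt θ x k i)
      (box := box) (K := max 2 K) (fun k hk => hK k ((le_max_right 2 K).trans hk) i)
      (fun k hk => (hupd k hk).1)
      (fun k _ => (Game.algState_valid hδ hne x _).confSet_convex i) hclose ?_
    simpa using (tendsto_sqrt_log_div.const_mul C).const_mul 2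
  filter_upwards [(tendsto_add_atTop_nat 1).eventually hmem, eventually_ge_atTop (max 2 K)]
    with k hk hkK
  refine ⟨hk, fun s a s' => ?_⟩
  obtain ⟨q₀, hq₀⟩ := hneP i
  have hq := (omdUpdate_spec (hdiff i) (η := θ.η k) (PP := G.confSetAt θ x (k + 1) i)
    ((Game.algState_valid hδ hne x _).confSet_convex i) ⟨q₀, hq₀.1, by rw [hq₀.2]; exact hk⟩
    (R := G.rewardAt θ x k i) (q := G.qhatAt θ x k i)).1
  rw [← (hupd k hkK).2] at hq
  have hq' : G.qhatAt θ x (k + 1) i ∈ shrunkIn (θ.δ i) (box k) := by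
    refine ⟨hq.1, ?_⟩
    have h3 := hq.2
    rw [(hupd k hkK).1, confUpdate] at h3
    split_ifs at h3
    · exact h3.1
    · exact h3
  have := hclose k hkK _ hq' s a s'
  linarith

include hδ hne in
/-- One step of mirror descent, as soon as the confidence sets contain the true transition
matrices. -/
theorem Game.bregman_qhatAt_le {m : ℝ} (hm : 0 < m)
    (hconv : ∀ i, StrongConvexOn (shrunk (θ.δ i)) m (θ.h i))
    (hdiff : ∀ i, DifferentiableOn ℝ (θ.h i) (shrunk (θ.δ i)))
    (hall : ∀ k ≥ 1, ∃ t, (G.algState θ x t).episode = k) {k : ℕ} (hk : 1 ≤ k) {i : Fin n}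
    (hP : G.P i ∈ G.confSetAt θ x (k + 1) i) {u : S i → A i → S i → ℝ}
    (hu : u ∈ shrunkOf (θ.δ i) (G.P i)) :
    bregman (θ.h i) (shrunk (θ.δ i)) u (G.qhatAt θ x (k + 1) i) ≤
      bregman (θ.h i) (shrunk (θ.δ i)) u (G.qhatAt θ x k i)
      - θ.η k * pairR (G.rewardAt θ x k i) (u - G.qhatAt θ x k i)
      + θ.η k ^ 2 * ((Fintype.card (S i) * (Fintype.card (A i) * Fintype.card (S i)) : ℝ) ^ 2 /
        (2 * m)) := by
  rw [(Game.episode_update hk (hall k hk) (hall (k + 1) (by omega)) i).2]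
  refine bregman_omdUpdate_le hm (hconv i) (hdiff i)
    ((Game.algState_valid hδ hne x _).confSet_convex i) (fun s a => ?_)
    ((Game.algState_valid hδ hne x _).qhat_mem i) ⟨hu.1, by rw [hu.2]; exact hP⟩
  have := Game.rewardAt_mem (G := G) (x := x) hδ hne k i s a
  rw [abs_of_nonneg this.1]
  exact this.2

end Confidence

/-! ### Products of chains and the value of a first visit -/

section Pairing

variable {n : ℕ} {S : Fin n → Type*} [∀ i, Fintype (S i)]

/-- The integral of `f` against the product of the measures `w j`. -/
def pairing (w : ∀ j, S j → ℝ) (f : (∀ j, S j) → ℝ) : ℝ := ∑ s, (∏ j, w j (s j)) * f s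

/-- The action of the product of the kernels `κ j` on functions. -/
def jointMean (κ : ∀ j, S j → S j → ℝ) (f : (∀ j, S j) → ℝ) (s : ∀ j, S j) : ℝ :=
  ∑ s', (∏ j, κ j (s j) (s' j)) * f s'

/-- The action on functions is adjoint to the evolution of product measures. -/
theorem pairing_jointMean (κ : ∀ j, S j → S j → ℝ) (w : ∀ j, S j → ℝ) (f : (∀ j, S j) → ℝ) :
    pairing w (jointMean κ f) = pairing (fun j => push (κ j) (w j)) f := by
  classical
  simp only [pairing, jointMean, Finset.mul_sum, push]
  rw [Finset.sum_comm]
  refine Finset.sum_congr rfl fun s' _ => ?_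
  rw [Fintype.prod_sum, Finset.sum_mul]
  refine Finset.sum_congr rfl fun s _ => ?_
  rw [Finset.prod_mul_distrib]
  ring

theorem pairing_iterate_jointMean (κ : ∀ j, S j → S j → ℝ) (f : (∀ j, S j) → ℝ) (D : ℕ)
    (w : ∀ j, S j → ℝ) :
    pairing w ((jointMean κ)^[D] f) = pairing (fun j => (push (κ j))^[D] (w j)) f := by
  induction D generalizing w with
  | zero => rfl
  | succ D ih =>
    rw [Function.iterate_succ_apply', pairing_jointMean, ih]
    rfl

open Classical in
/-- Point masses give back the values of the function. -/
theorem pairing_single (s : ∀ j, S j) (f : (∀ j, S j) → ℝ) :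
    pairing (fun j y => if y = s j then 1 else 0) f = f s := by
  unfold pairing
  rw [Finset.sum_eq_single s]
  · simp
  · intro s' _ hne
    obtain ⟨j, hj⟩ := Function.ne_iff.1 hne
    rw [Finset.prod_eq_zero (Finset.mem_univ j) (if_neg hj), zero_mul]
  · exact fun h => absurd (Finset.mem_univ s) h

omit [∀ i, Fintype (S i)] in
theorem prod_update_apply (w : ∀ j, S j → ℝ) (i : Fin n) (α : S i → ℝ) (s : ∀ j, S j) :
    ∏ j, Function.update w i α j (s j) = α (s i) * ∏ j ∈ Finset.univ.erase i, w j (s j) := by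
  rw [← Finset.mul_prod_erase _ _ (Finset.mem_univ i), Function.update_self]
  congr 1
  refine Finset.prod_congr rfl fun j hj => ?_
  rw [Function.update_of_ne (Finset.ne_of_mem_erase hj)]

open Classical in
/-- The pairing is linear in each factor of the product measure. -/
theorem pairing_update (w : ∀ j, S j → ℝ) (i : Fin n) (α : S i → ℝ) (f : (∀ j, S j) → ℝ) :
    pairing (Function.update w i α) f =
      ∑ y, α y * pairing (Function.update w i fun z => if z = y then 1 else 0) f := by
  simp only [pairing, prod_update_apply, Finset.mul_sum]
  rw [Finset.sum_comm]
  refine Finset.sum_congr rfl fun s _ => ?_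
  rw [Finset.sum_eq_single (s i)]
  · simp [mul_assoc]
  · intro y _ hy
    rw [if_neg (Ne.symm hy)]
    ring
  · exact fun h => absurd (Finset.mem_univ _) h

/-- The pairing is Lipschitz in the factors, uniformly in a bounded function. -/
theorem abs_pairing_sub_le {w w' : ∀ j, S j → ℝ} {f : (∀ j, S j) → ℝ}
    (hw : ∀ j y, |w j y| ≤ 1) (hw' : ∀ j y, |w' j y| ≤ 1) (hf : ∀ s, |f s| ≤ 1) {r : ℝ}
    (hr : ∀ j y, |w j y - w' j y| ≤ r) :
    |pairing w f - pairing w' f| ≤ Fintype.card (∀ j, S j) * (n * r) := by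
  classical
  unfold pairing
  rw [← Finset.sum_sub_distrib]
  refine (Finset.abs_sum_le_sum_abs _ _).trans ?_
  calc _ ≤ ∑ _s : ∀ j, S j, (n * r : ℝ) := Finset.sum_le_sum fun s _ => by
        rw [← sub_mul, abs_mul]
        refine (mul_le_of_le_one_right (abs_nonneg _) (hf s)).trans ?_
        refine (abs_prod_sub_prod_le Finset.univ _ _ (fun j _ => hw j _)
          (fun j _ => hw' j _)).trans ?_
        refine (Finset.sum_le_sum fun j _ => hr j (s j)).trans ?_
        simp
    _ = _ := by simp

end Pairing

section SinglePlayer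

variable {S A : Type*} [Fintype S] [Fintype A]

/-- If the transition matrix of `q` is almost `P`, the state marginal of `q` is almost stationary
for the chain induced by `P`. -/
theorem sum_abs_push_sub_le {δ : ℝ} (hδ : 0 < δ) {q P : S → A → S → ℝ} (hq : q ∈ shrunk δ) {r : ℝ}
    (hr : ∀ s a s', |q s a s' - rho q s a * P s a s'| ≤ r) :
    ∑ s', |push (inducedChain P (inducedPolicy q)) (fun s => ∑ a, rho q s a) s' - ∑ a, rho q s' a|
      ≤ (Fintype.card S * (Fintype.card S * Fintype.card A) : ℝ) * r := by
  have h : ∀ s', |push (inducedChain P (inducedPolicy q)) (fun s => ∑ a, rho q s a) s' -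
      ∑ a, rho q s' a| ≤ (Fintype.card S * Fintype.card A : ℝ) * r := by
    intro s'
    have h1 : push (inducedChain P (inducedPolicy q)) (fun s => ∑ a, rho q s a) s' =
        ∑ s, ∑ a, rho q s a * P s a s' := by
      unfold push inducedChain
      refine Finset.sum_congr rfl fun s _ => ?_
      rw [Finset.mul_sum]
      refine Finset.sum_congr rfl fun a _ => ?_
      rw [← sum_mul_inducedPolicy hδ hq s a]
      ring
    have h2 : ∑ a, rho q s' a = ∑ s, ∑ a, q s a s' := (hq.1.2.2 s').symm
    rw [h1, h2, ← Finset.sum_sub_distrib]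
    simp only [← Finset.sum_sub_distrib]
    refine (Finset.abs_sum_le_sum_abs _ _).trans ?_
    calc _ ≤ ∑ _s : S, ∑ _a : A, r := Finset.sum_le_sum fun s _ =>
          (Finset.abs_sum_le_sum_abs _ _).trans (Finset.sum_le_sum fun a _ => by
            rw [abs_sub_comm]; exact hr s a s')
      _ = _ := by simp; ring
  refine (Finset.sum_le_sum fun s' _ => h s').trans (le_of_eq ?_)
  simp
  ring

end SinglePlayer

section Value

variable {n : ℕ} {S A : Fin n → Type*} [∀ i, Fintype (S i)] [∀ i, Fintype (A i)]
  (G : Game n S A) {π : ∀ i, S i → A i → ℝ}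

/-- The transition matrices of the players under the stationary policies `π`. -/
def Game.chains (G : Game n S A) (π : ∀ i, S i → A i → ℝ) (j : Fin n) : S j → S j → ℝ :=
  inducedChain (G.P j) (π j)

theorem Game.stepMean_prod (s : ∀ j, S j) (g : ∀ j, A j → ℝ) (f : (∀ j, S j) → ℝ) :
    G.stepMean π s (fun a s' => (∏ j, g j (a j)) * f s') =
      jointMean (fun j y y' => ∑ a, G.P j y a y' * π j y a * g j a) f s := by
  classical
  unfold Game.stepMean jointMean Game.stepProb
  rw [Finset.sum_comm]
  refine Finset.sum_congr rfl fun s' _ => ?_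
  rw [Fintype.prod_sum, Finset.sum_mul]
  refine Finset.sum_congr rfl fun a _ => ?_
  rw [← mul_assoc, ← Finset.prod_mul_distrib]
  congr 1
  exact Finset.prod_congr rfl fun j _ => by ring

theorem Game.stepMean_state (s : ∀ j, S j) (f : (∀ j, S j) → ℝ) :
    G.stepMean π s (fun _ s' => f s') = jointMean (G.chains π) f s := by
  have := G.stepMean_prod (π := π) s (fun _ _ => 1) f
  simp only [Finset.prod_const_one, one_mul, mul_one] at this
  exact this

open Classical in
/-- Killing the play when player `i` visits `(ŝ, â)` only affects the chain of player `i`: the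
others move on independently. -/
theorem Game.stepMean_killed (s : ∀ j, S j) (i : Fin n) (ŝ : S i) (â : A i)
    (f : (∀ j, S j) → ℝ) :
    G.stepMean π s (fun a s' => if s i = ŝ ∧ a i = â then 0 else f s') =
      jointMean (Function.update (G.chains π) i (killedChain (G.P i) (π i) ŝ â)) f s := by
  set g : ∀ j, A j → ℝ := Function.update (fun _ _ => 1) i
    (fun a => if s i = ŝ ∧ a = â then 0 else 1) with hg
  have h1 : ∀ a : ∀ j, A j, ∏ j, g j (a j) = if s i = ŝ ∧ a i = â then 0 else 1 := by
    intro a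
    rw [hg, prod_update_apply (S := A) (fun _ _ => 1)]
    simp
  have h2 := G.stepMean_prod (π := π) s g f
  simp only [h1, ite_mul, zero_mul, one_mul] at h2
  rw [h2]
  unfold jointMean
  refine Finset.sum_congr rfl fun s' _ => ?_
  congr 1
  refine Finset.prod_congr rfl fun j _ => ?_
  by_cases hj : j = i
  · subst hj
    simp only [Function.update_self, hg, killedChain]
  · simp only [Function.update_of_ne hj, hg, mul_one]
    rfl

open Classical in
/-- One step towards the first visit of the pair `(ŝ, â)` by player `i`: the reward is collected if
the pair is visited, and the value `f` of the next state otherwise. -/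
def Game.visitStep (G : Game n S A) (π : ∀ i, S i → A i → ℝ) (i : Fin n) (ŝ : S i) (â : A i)
    (f : (∀ j, S j) → ℝ) (s : ∀ j, S j) : ℝ :=
  G.stepMean π s (fun a s' => if s i = ŝ ∧ a i = â then G.r i s a else f s')

/-- Expected reward of player `i` at the first visit of `(ŝ, â)`, or `0` if it takes more than `m`
steps. -/
def Game.visitValueAux (G : Game n S A) (π : ∀ i, S i → A i → ℝ) (i : Fin n) (ŝ : S i) (â : A i)
    (m : ℕ) : (∀ j, S j) → ℝ :=
  (G.visitStep π i ŝ â)^[m] fun _ => 0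

/-- Expected reward of player `i` at the first visit of `(ŝ, â)`, as a function of the initial joint
state, if the players follow the stationary policies `π`. The values up to time `m` increase with
`m` and stay in `[0, 1]`, so that the supremum is their limit. -/
def Game.visitValue (G : Game n S A) (π : ∀ i, S i → A i → ℝ) (i : Fin n) (ŝ : S i) (â : A i)
    (s : ∀ j, S j) : ℝ :=
  ⨆ m, G.visitValueAux π i ŝ â m s

variable (hπ : ∀ i, IsStationaryPolicy (π i)) {i : Fin n} {ŝ : S i} {â : A i}
include hπ

theorem Game.visitStep_mono {f g : (∀ j, S j) → ℝ} (hfg : ∀ s, f s ≤ g s) (s : ∀ j, S j) :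
    G.visitStep π i ŝ â f s ≤ G.visitStep π i ŝ â g s :=
  G.stepMean_mono hπ fun a s' => by
    split_ifs
    · exact le_rfl
    · exact hfg s'

theorem Game.visitStep_mem {f : (∀ j, S j) → ℝ} (hf : ∀ s, f s ∈ Set.Icc (0 : ℝ) 1)
    (s : ∀ j, S j) : G.visitStep π i ŝ â f s ∈ Set.Icc (0 : ℝ) 1 := by
  classical
  constructor
  · rw [← G.stepMean_const hπ s 0]
    refine G.stepMean_mono hπ fun a s' => ?_
    split_ifs
    · exact (G.r_mem i s a).1
    · exact (hf s').1
  · rw [← G.stepMean_const hπ s 1]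
    refine G.stepMean_mono hπ fun a s' => ?_
    split_ifs
    · exact (G.r_mem i s a).2
    · exact (hf s').2

theorem Game.jointMean_mem {f : (∀ j, S j) → ℝ} (hf : ∀ s, f s ∈ Set.Icc (0 : ℝ) 1)
    (s : ∀ j, S j) : jointMean (G.chains π) f s ∈ Set.Icc (0 : ℝ) 1 := by
  rw [← Game.stepMean_state]
  constructor
  · rw [← G.stepMean_const hπ s 0]
    exact G.stepMean_mono hπ fun a s' => (hf s').1
  · rw [← G.stepMean_const hπ s 1]
    exact G.stepMean_mono hπ fun a s' => (hf s').2

theorem Game.iterate_jointMean_mem {f : (∀ j, S j) → ℝ} (hf : ∀ s, f s ∈ Set.Icc (0 : ℝ) 1)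
    (D : ℕ) : ∀ s, (jointMean (G.chains π))^[D] f s ∈ Set.Icc (0 : ℝ) 1 := by
  induction D with
  | zero => exact hf
  | succ D ih => rw [Function.iterate_succ_apply']; exact G.jointMean_mem hπ ih

theorem Game.visitValueAux_mem (m : ℕ) :
    ∀ s, G.visitValueAux π i ŝ â m s ∈ Set.Icc (0 : ℝ) 1 := by
  unfold Game.visitValueAux
  induction m with
  | zero => exact fun s => ⟨le_rfl, zero_le_one⟩
  | succ m ih => rw [Function.iterate_succ_apply']; exact G.visitStep_mem hπ ih

theorem Game.monotone_visitValueAux (s : ∀ j, S j) :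
    Monotone fun m => G.visitValueAux π i ŝ â m s := by
  refine monotone_nat_of_le_succ fun m => ?_
  induction m generalizing s with
  | zero => exact (G.visitValueAux_mem hπ 1 s).1
  | succ m ih =>
    unfold Game.visitValueAux at ih ⊢
    rw [Function.iterate_succ_apply', Function.iterate_succ_apply' _ (m + 1)]
    exact G.visitStep_mono hπ ih s

theorem Game.tendsto_visitValueAux (s : ∀ j, S j) :
    Tendsto (fun m => G.visitValueAux π i ŝ â m s) atTop (𝓝 (G.visitValue π i ŝ â s)) :=
  tendsto_atTop_ciSup (G.monotone_visitValueAux hπ s)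
    ⟨1, by rintro _ ⟨m, rfl⟩; exact (G.visitValueAux_mem hπ m s).2⟩

theorem Game.visitValue_mem (s : ∀ j, S j) : G.visitValue π i ŝ â s ∈ Set.Icc (0 : ℝ) 1 :=
  isClosed_Icc.mem_of_tendsto (G.tendsto_visitValueAux hπ s)
    (Eventually.of_forall fun m => G.visitValueAux_mem hπ m s)

/-- The first-step equation for the value of the first visit. -/
theorem Game.visitStep_visitValue (s : ∀ j, S j) :
    G.visitStep π i ŝ â (G.visitValue π i ŝ â) s = G.visitValue π i ŝ â s := by
  classical
  have h1 := (G.tendsto_visitValueAux hπ (i := i) (ŝ := ŝ) (â := â) s).comp (tendsto_add_atTop_nat 1)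
  refine tendsto_nhds_unique ?_ h1
  have h2 : ((fun m => G.visitValueAux π i ŝ â m s) ∘ fun m => m + 1) =
      fun m => G.visitStep π i ŝ â (G.visitValueAux π i ŝ â m) s := by
    ext m
    simp only [Function.comp_apply, Game.visitValueAux, Function.iterate_succ_apply']
  rw [h2]
  unfold Game.visitStep Game.stepMean
  refine tendsto_finsetSum _ fun a _ => tendsto_finsetSum _ fun s' _ => Tendsto.const_mul _ ?_
  dsimp only
  split_ifs
  · exact tendsto_const_nhds
  · exact G.tendsto_visitValueAux hπ s'

omit hπ in
open Classical in
/-- The reward collected in this step, plus what remains if the chain is killed at the visit. -/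
theorem Game.visitStep_eq (f : (∀ j, S j) → ℝ) (s : ∀ j, S j) :
    G.visitStep π i ŝ â f s =
      (∑ a : ∀ j, A j, if s i = ŝ ∧ a i = â then (∏ j, π j (s j) (a j)) * G.r i s a else 0) +
      jointMean (Function.update (G.chains π) i (killedChain (G.P i) (π i) ŝ â)) f s := by
  rw [← Game.stepMean_killed]
  unfold Game.visitStep Game.stepMean
  rw [← Finset.sum_add_distrib]
  refine Finset.sum_congr rfl fun a _ => ?_
  by_cases h : s i = ŝ ∧ a i = â
  · simp only [if_pos h, mul_zero, Finset.sum_const_zero, add_zero, Game.stepProb,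
      Finset.prod_mul_distrib, ← Finset.mul_sum, ← Finset.sum_mul]
    rw [← Fintype.prod_sum (fun j (y : S j) => G.P j (s j) (a j) y),
      Finset.prod_eq_one fun j _ => (G.P_isTransition j (s j) (a j)).2, mul_one]
  · simp only [if_neg h, zero_add]

end Value

/-! ### The recorded rewards estimate the payoff gradient -/
/-- An approximate solution of the homogeneous equation for the killed chain is small, because `m`
steps of the killed chain contract the supremum norm by the factor `w < 1`. -/
theorem abs_le_of_killedChain {S A : Type*} [Fintype S] [Fintype A] {P : S → A → S → ℝ}
    {π : S → A → ℝ} (hP : IsTransition P) (hπ : IsStationaryPolicy π) {ŝ : S} {â : A} {f : S → ℝ}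
    {e : ℝ} (hf : ∀ y, |f y - ∑ y', killedChain P π ŝ â y y' * f y'| ≤ e) {m : ℕ} {w : ℝ}
    (hw1 : w < 1) (hw : ∀ y, survive P π ŝ â m y ≤ w) (y : S) : |f y| ≤ m * e / (1 - w) := by
  have : Nonempty S := ⟨y⟩
  obtain ⟨y₀, hy₀⟩ := Finite.exists_max fun y => |f y|
  set g := |f y₀|
  have hg0 : 0 ≤ g := abs_nonneg _
  have he0 : 0 ≤ e := (abs_nonneg _).trans (hf y)
  have h1 : ∀ (k : ℕ) y, |f y| ≤ g * survive P π ŝ â k y + k * e := by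
    intro k
    induction k with
    | zero => intro y; simpa [survive] using hy₀ y
    | succ k ih =>
      intro y
      have h2 : |∑ y', killedChain P π ŝ â y y' * f y'| ≤
          g * survive P π ŝ â (k + 1) y + k * e := by
        calc |∑ y', killedChain P π ŝ â y y' * f y'|
            ≤ ∑ y', |killedChain P π ŝ â y y' * f y'| := Finset.abs_sum_le_sum_abs _ _
          _ ≤ ∑ y', killedChain P π ŝ â y y' * (g * survive P π ŝ â k y' + k * e) :=
              Finset.sum_le_sum fun y' _ => by
                have h3 := killedChain_nonneg hP hπ ŝ â y y'
                rw [abs_mul, abs_of_nonneg h3]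
                exact mul_le_mul_of_nonneg_left (ih y') h3
          _ = g * survive P π ŝ â (k + 1) y + (∑ y', killedChain P π ŝ â y y') * (k * e) := by
              simp only [survive, mul_add, Finset.sum_add_distrib, Finset.mul_sum, Finset.sum_mul]
              congr 1
              exact Finset.sum_congr rfl fun _ _ => by ring
          _ ≤ g * survive P π ŝ â (k + 1) y + 1 * (k * e) := by
              have h4 := survive_le_one hP hπ ŝ â 1 y
              simp only [survive, mul_one] at h4
              gcongr
          _ = _ := by rw [one_mul]
      have h5 := abs_le.1 (hf y)
      have h6 := abs_le.1 h2
      push_cast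
      rw [abs_le]
      constructor <;> linarith
  have h2 := h1 m y₀
  have h3 : g * survive P π ŝ â m y₀ ≤ g * w := mul_le_mul_of_nonneg_left (hw y₀) hg0
  refine (hy₀ y).trans ?_
  rw [le_div_iff₀ (by linarith)]
  change g ≤ _ at h2
  linarith

section Value

variable {n : ℕ} {S A : Fin n → Type*} [∀ i, Fintype (S i)] [∀ i, Fintype (A i)]
  (G : Game n S A) {δ : Fin n → ℝ} (hδ : ∀ j, 0 < δ j)

include hδ in
open Classical in
/-- If the state of player `i` is `y` and the states of the others have their stationary
distributions, the expected reward from playing `â` at `ŝ` is the payoff gradient, weighted with the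
probability of that event. The last index `z` of the gradient is immaterial. -/
theorem Game.pairing_reward {q : ∀ j, S j → A j → S j → ℝ} (hq : ∀ j, q j ∈ shrunk (δ j))
    (i : Fin n) (ŝ : S i) (â : A i) (y z : S i) :
    pairing (Function.update (fun j s => ∑ a, rho (q j) s a) i fun z => if z = y then 1 else 0)
      (fun s => ∑ a : ∀ j, A j, if s i = ŝ ∧ a i = â then
        (∏ j, inducedPolicy (q j) (s j) (a j)) * G.r i s a else 0) =
      (if y = ŝ then inducedPolicy (q i) ŝ â else 0) * G.payoffGrad i q ŝ â z := by
  simp only [pairing, Game.payoffGrad, prod_update_apply, Finset.mul_sum]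
  refine Finset.sum_congr rfl fun s _ => Finset.sum_congr rfl fun a _ => ?_
  by_cases h : s i = ŝ ∧ a i = â
  · rw [if_pos h, if_pos h]
    by_cases hy : y = ŝ
    · rw [if_pos (h.1.trans hy.symm), if_pos hy, one_mul,
        ← Finset.mul_prod_erase _ _ (Finset.mem_univ i), h.1, h.2]
      have h1 : ∏ j ∈ Finset.univ.erase i, ∑ s', q j (s j) (a j) s' =
          (∏ j ∈ Finset.univ.erase i, ∑ a, rho (q j) (s j) a) *
            ∏ j ∈ Finset.univ.erase i, inducedPolicy (q j) (s j) (a j) := by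
        rw [← Finset.prod_mul_distrib]
        exact Finset.prod_congr rfl fun j _ => (sum_mul_inducedPolicy (hδ j) (hq j) _ _).symm
      rw [h1]
      ring
    · rw [if_neg (fun h' => hy (h'.symm.trans h.1)), if_neg hy]
      ring
  · rw [if_neg h, if_neg h, mul_zero, mul_zero]

include hδ in
/-- If the matrices of the occupancy measures `q` are almost the true ones, then the value of the
first visit after `D` steps of warm-up is almost the virtual payoff gradient at `q`. -/
theorem Game.exists_value_estimate {β : ℝ} (hβ0 : 0 ≤ β) (hβ1 : β < 1)
    (hc : ∀ j, Contracts (G.P j) β) {m : ℕ} {w : ℝ} (hw1 : w < 1)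
    (hw : ∀ i, ∀ π : S i → A i → ℝ, IsStationaryPolicy π →
      (∀ s a, δ i ≤ π s a) → ∀ ŝ â y, survive (G.P i) π ŝ â m y ≤ w) :
    ∃ C : ℝ, 0 ≤ C ∧ ∀ q : ∀ j, S j → A j → S j → ℝ, (∀ j, q j ∈ shrunk (δ j)) → ∀ r : ℝ, 0 ≤ r →
      (∀ j s a s', |q j s a s' - rho (q j) s a * G.P j s a s'| ≤ r) → ∀ D i ŝ â z s,
      |(jointMean (G.chains fun j => inducedPolicy (q j)))^[D]
        (G.visitValue (fun j => inducedPolicy (q j)) i ŝ â) s - G.payoffGrad i q ŝ â z| ≤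
        C * (β ^ D + r) := by
  classical
  -- the two error terms below, collected into one multiple of `b + r`
  have halg : ∀ c n K b r m u v : ℝ, 0 ≤ c → 0 ≤ n → 0 ≤ K → 0 ≤ b → 0 ≤ r → 0 ≤ m → 0 < u → 0 < v →
      c * (n * (b * 2 + K * r / u)) + m * (c * (n * (K * r))) / v ≤
        (c * n * (2 + K / u) + m * (c * n * K) / v) * (b + r) := by
    intro c n K b r m u v hc hn hK hb hr hm hu hv
    have h1 : 0 ≤ (c * n * (K / u) + m * (c * n * K) / v) * b + c * n * 2 * r := by positivity
    have h2 : (c * n * (2 + K / u) + m * (c * n * K) / v) * (b + r) =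
        c * (n * (b * 2 + K * r / u)) + m * (c * (n * (K * r))) / v +
        ((c * n * (K / u) + m * (c * n * K) / v) * b + c * n * 2 * r) := by ring
    linarith
  set N : Fin n → ℝ := fun j => Fintype.card (S j) * (Fintype.card (S j) * Fintype.card (A j))
    with hN
  set K : ℝ := ∑ j, N j with hK
  have hN0 : ∀ j, 0 ≤ N j := fun j => by positivity
  have hK0 : 0 ≤ K := Finset.sum_nonneg fun j _ => hN0 j
  have hNK : ∀ j, N j ≤ K := fun j => Finset.single_le_sum (fun j _ => hN0 j) (Finset.mem_univ j)
  set c : ℝ := (Fintype.card (∀ j, S j) : ℝ) with hcdef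
  have hc0 : 0 ≤ c := Nat.cast_nonneg _
  have hβ' : 0 < 1 - β := by linarith
  have hw' : 0 < 1 - w := by linarith
  refine ⟨c * n * (2 + K / (1 - β)) + m * (c * n * K) / (1 - w), by positivity, ?_⟩
  intro q hq r hr hqr D i ŝ â z s
  set π : ∀ j, S j → A j → ℝ := fun j => inducedPolicy (q j) with hπdef
  have hπ : ∀ j, IsStationaryPolicy (π j) := fun j =>
    isStationaryPolicy_inducedPolicy (hδ j) (hq j)
  set ν : ∀ j, S j → ℝ := fun j s => ∑ a, rho (q j) s a with hν
  have hνd : ∀ j, IsDistribution (ν j) := fun j => isDistribution_sum_rho (hq j).1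
  set U := G.visitValue π i ŝ â with hU
  have hUabs : ∀ s, |U s| ≤ 1 := fun s => by
    have := G.visitValue_mem hπ (i := i) (ŝ := ŝ) (â := â) s
    rw [abs_of_nonneg this.1]; exact this.2
  set l := G.payoffGrad i q ŝ â z with hl
  have hdist1 : ∀ j (α : S j → ℝ), IsDistribution α → ∀ y, |α y| ≤ 1 := fun j α hα y => by
    rw [abs_of_nonneg (hα.1 y)]; exact hα.le_one y
  have hpush : ∀ j, ∑ y, |push (G.chains π j) (ν j) y - ν j y| ≤ K * r := fun j =>
    (sum_abs_push_sub_le (hδ j) (hq j) (hqr j)).trans (mul_le_mul_of_nonneg_right (hNK j) hr)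
  have hpt : ∀ j (f : S j → ℝ) y, |f y| ≤ ∑ y, |f y| := fun j f y =>
    Finset.single_le_sum (f := fun y => |f y|) (fun _ _ => abs_nonneg _) (Finset.mem_univ y)
  -- replace the distribution after the warm-up by the stationary one
  have h1 : |(jointMean (G.chains π))^[D] U s - pairing ν U| ≤
      c * (n * (β ^ D * 2 + K * r / (1 - β))) := by
    rw [← pairing_single s ((jointMean (G.chains π))^[D] U), pairing_iterate_jointMean]
    refine abs_pairing_sub_le (fun j => hdist1 j _ ?_) (fun j => hdist1 j _ (hνd j)) hUabs
      fun j y => ?_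
    · exact (isDistribution_single (s j)).iterate_push (G.P_isTransition j) (hπ j) D
    · refine (hpt j (fun y => (push (G.chains π j))^[D]
        (fun y => if y = s j then 1 else 0) y - ν j y) y).trans ?_
      exact (hc j).iterate_push_dist_le hβ0 hβ1 (G.P_isTransition j) (hπ j)
        (isDistribution_single (s j)) (hνd j) (hpush j) D
  -- under the stationary distribution of the other players, `i` faces a killed chain
  set F : S i → ℝ := fun y => pairing (Function.update ν i fun z => if z = y then 1 else 0) U
    with hF
  have hkill : ∀ y y', |killedChain (G.P i) (π i) ŝ â y y'| ≤ 1 := by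
    intro y y'
    rw [abs_of_nonneg (killedChain_nonneg (G.P_isTransition i) (hπ i) ŝ â y y')]
    refine (killedChain_le (G.P_isTransition i) (hπ i) ŝ â y y').trans ?_
    exact IsDistribution.le_one (ν := inducedChain (G.P i) (π i) y)
      ⟨inducedChain_nonneg (G.P_isTransition i) (hπ i) y,
        sum_inducedChain (G.P_isTransition i) (hπ i) y⟩ y'
  have hFrec : ∀ y, F y = (if y = ŝ then π i ŝ â else 0) * l +
      pairing (Function.update (fun j => push (G.chains π j) (ν j)) i
        (killedChain (G.P i) (π i) ŝ â y)) U := by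
    intro y
    have hUeq : U = fun s => (∑ a : ∀ j, A j, if s i = ŝ ∧ a i = â then
        (∏ j, π j (s j) (a j)) * G.r i s a else 0) +
        jointMean (Function.update (G.chains π) i (killedChain (G.P i) (π i) ŝ â)) U s := by
      ext s
      rw [← Game.visitStep_eq, hU, G.visitStep_visitValue hπ]
    have hadd : ∀ (α : ∀ j, S j → ℝ) (f g : (∀ j, S j) → ℝ),
        pairing α (fun s => f s + g s) = pairing α f + pairing α g := fun α f g => by
      simp only [pairing, mul_add, Finset.sum_add_distrib]
    simp only [hF]
    conv_lhs => rw [hUeq]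
    rw [hadd, Game.pairing_reward G hδ hq i ŝ â y z, pairing_jointMean]
    congr 2
    ext j y'
    by_cases hj : j = i
    · subst hj
      simp only [Function.update_self, push, ite_mul, one_mul, zero_mul, Finset.sum_ite_eq',
        Finset.mem_univ, if_true]
    · simp only [Function.update_of_ne hj]
  have hFl : ∀ y, |(F y - l) - ∑ y', killedChain (G.P i) (π i) ŝ â y y' * (F y' - l)| ≤
      c * (n * (K * r)) := by
    intro y
    have h2 : ∑ y', killedChain (G.P i) (π i) ŝ â y y' * (F y' - l) =
        pairing (Function.update ν i (killedChain (G.P i) (π i) ŝ â y)) U -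
          (∑ y', killedChain (G.P i) (π i) ŝ â y y') * l := by
      rw [pairing_update]
      simp only [mul_sub, Finset.sum_sub_distrib, Finset.sum_mul, hF]
    have h3 := one_sub_sum_killedChain (G.P_isTransition i) (hπ i) ŝ â y
    have h4 : (F y - l) - ∑ y', killedChain (G.P i) (π i) ŝ â y y' * (F y' - l) =
        pairing (Function.update (fun j => push (G.chains π j) (ν j)) i
          (killedChain (G.P i) (π i) ŝ â y)) U -
        pairing (Function.update ν i (killedChain (G.P i) (π i) ŝ â y)) U := by
      rw [h2, hFrec, ← h3]
      ring
    rw [h4]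
    refine abs_pairing_sub_le (fun j y' => ?_) (fun j y' => ?_) hUabs fun j y' => ?_
    · by_cases hj : j = i
      · subst hj; rw [Function.update_self]; exact hkill y y'
      · rw [Function.update_of_ne hj]
        exact hdist1 j _ ((hνd j).push (G.P_isTransition j) (hπ j)) y'
    · by_cases hj : j = i
      · subst hj; rw [Function.update_self]; exact hkill y y'
      · rw [Function.update_of_ne hj]
        exact hdist1 j _ (hνd j) y'
    · by_cases hj : j = i
      · subst hj
        rw [Function.update_self, Function.update_self, sub_self, abs_zero]
        positivity
      · rw [Function.update_of_ne hj, Function.update_of_ne hj]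
        exact (hpt j (fun y => push (G.chains π j) (ν j) y - ν j y) y').trans (hpush j)
  have hsmall := fun y => abs_le_of_killedChain (G.P_isTransition i) (hπ i) hFl hw1
    (hw i (π i) (hπ i) (le_inducedPolicy (hδ i) (hq i)) ŝ â) y
  have h2 : |pairing ν U - l| ≤ m * (c * (n * (K * r))) / (1 - w) := by
    have h3 : pairing ν U - l = ∑ y, ν i y * (F y - l) := by
      simp only [mul_sub, Finset.sum_sub_distrib, ← Finset.sum_mul, (hνd i).2, one_mul]
      congr 1
      rw [← pairing_update, Function.update_eq_self]
    rw [h3]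
    refine (Finset.abs_sum_le_sum_abs _ _).trans ?_
    calc ∑ y, |ν i y * (F y - l)| ≤ ∑ y, ν i y * (m * (c * (n * (K * r))) / (1 - w)) :=
          Finset.sum_le_sum fun y _ => by
            rw [abs_mul, abs_of_nonneg ((hνd i).1 y)]
            exact mul_le_mul_of_nonneg_left (hsmall y) ((hνd i).1 y)
      _ = _ := by rw [← Finset.sum_mul, (hνd i).2, one_mul]
  have hβD : 0 ≤ β ^ D := by positivity
  calc |(jointMean (G.chains π))^[D] U s - l|
      ≤ |(jointMean (G.chains π))^[D] U s - pairing ν U| + |pairing ν U - l| :=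
        abs_sub_le _ _ _
    _ ≤ c * (n * (β ^ D * 2 + K * r / (1 - β))) + m * (c * (n * (K * r))) / (1 - w) :=
        add_le_add h1 h2
    _ ≤ _ := halg c n K (β ^ D) r m (1 - β) (1 - w) hc0 n.cast_nonneg hK0 hβD hr m.cast_nonneg
        hβ' hw'

end Value

/-! ### The noise of the recorded rewards -/

section Noise

variable {n : ℕ} {S A : Fin n → Type*} [∀ i, Fintype (S i)] [∀ i, Fintype (A i)]
  {G : Game n S A} {θ : AlgParams n S A} (hδ : ∀ i, 0 < θ.δ i)
  (hne : ∀ i, (shrunk (θ.δ i) : Set (S i → A i → S i → ℝ)).Nonempty)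

/-- The policies that the learners play. -/
def AlgState.policy (σ : AlgState n S A) (j : Fin n) : S j → A j → ℝ :=
  inducedPolicy (σ.player j).qhat

/-- Expected reward at the first visit of `(ŝ, â)` after `D` steps. -/
def AlgState.delayedValue (G : Game n S A) (σ : AlgState n S A) (D : ℕ) (i : Fin n) (ŝ : S i)
    (â : A i) (s : ∀ j, S j) : ℝ :=
  (jointMean (G.chains σ.policy))^[D] (G.visitValue σ.policy i ŝ â) s

open Classical in
/-- Conditional expectation of the reward that will have been recorded for `(ŝ, â)` at the end of
the current episode, given the state of the algorithm and the joint state of the players. -/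
def Game.expReward (G : Game n S A) (θ : AlgParams n S A) (σ : AlgState n S A) (s : ∀ j, S j)
    (i : Fin n) (ŝ : S i) (â : A i) : ℝ :=
  (σ.player i).R ŝ â + if (ŝ, â) ∈ (σ.player i).todo then
    σ.delayedValue G (θ.warmup σ.episode - σ.clock) i ŝ â s else 0

open Classical in
/-- The same conditional expectation one step later, if the players play `a` and move to `s'`. -/
def Game.expRewardAfter (G : Game n S A) (θ : AlgParams n S A) (σ : AlgState n S A) (s : ∀ j, S j)
    (a : ∀ j, A j) (s' : ∀ j, S j) (i : Fin n) (ŝ : S i) (â : A i) : ℝ :=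
  (G.observed θ σ s a s' i).R ŝ â + if (ŝ, â) ∈ (G.observed θ σ s a s' i).todo then
    σ.delayedValue G (θ.warmup σ.episode - (σ.clock + 1)) i ŝ â s' else 0

section OneStep

variable {σ : AlgState n S A} {s : ∀ j, S j} {a : ∀ j, A j} {s' : ∀ j, S j} {i : Fin n}
  {ŝ : S i} {â : A i}

theorem Game.expRewardAfter_of_ends (h : G.EpisodeEnds θ σ s a s') :
    G.expRewardAfter θ σ s a s' i = (G.observed θ σ s a s' i).R := by
  ext ŝ â
  unfold Game.expRewardAfter
  rw [if_neg (by rw [h.2 i]; exact Set.notMem_empty _), add_zero]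

theorem Game.expRewardAfter_of_not_ends (h : ¬ G.EpisodeEnds θ σ s a s') :
    G.expRewardAfter θ σ s a s' i = G.expReward θ (G.algStep θ σ s a s') s' i := by
  rw [Game.algStep_of_not_ends h]
  rfl

theorem AlgState.Valid.observed_R_eq_zero (hσ : σ.Valid θ)
    (h : (ŝ, â) ∈ (G.observed θ σ s a s' i).todo) : (G.observed θ σ s a s' i).R ŝ â = 0 := by
  have h := (Game.mem_observed_todo i ŝ â).1 h
  rw [Game.observed_R, hσ.R_eq_zero i ŝ â h.1, if_neg fun h' => h.2 ⟨h'.1, h'.2.2⟩, add_zero]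

include hδ in
theorem AlgState.Valid.isStationaryPolicy_policy (hσ : σ.Valid θ) (j : Fin n) :
    IsStationaryPolicy (σ.policy j) :=
  isStationaryPolicy_inducedPolicy (hδ j) (hσ.qhat_mem j)

include hδ in
theorem AlgState.Valid.delayedValue_mem (hσ : σ.Valid θ) (D : ℕ) :
    σ.delayedValue G D i ŝ â s ∈ Set.Icc (0 : ℝ) 1 :=
  G.iterate_jointMean_mem (hσ.isStationaryPolicy_policy hδ)
    (G.visitValue_mem (hσ.isStationaryPolicy_policy hδ)) D s

include hδ in
theorem AlgState.Valid.abs_expReward_le (hσ : σ.Valid θ) : |G.expReward θ σ s i ŝ â| ≤ 1 := by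
  unfold Game.expReward
  split_ifs with h
  · have := hσ.delayedValue_mem hδ (G := G) (i := i) (ŝ := ŝ) (â := â) (s := s)
      (θ.warmup σ.episode - σ.clock)
    rw [hσ.R_eq_zero i ŝ â h, zero_add, abs_of_nonneg this.1]
    exact this.2
  · have := hσ.R_mem i ŝ â
    rw [add_zero, abs_of_nonneg this.1]
    exact this.2

include hδ in
theorem AlgState.Valid.abs_expRewardAfter_le (hσ : σ.Valid θ) :
    |G.expRewardAfter θ σ s a s' i ŝ â| ≤ 1 := by
  unfold Game.expRewardAfter
  split_ifs with h
  · have := hσ.delayedValue_mem hδ (G := G) (i := i) (ŝ := ŝ) (â := â) (s := s')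
      (θ.warmup σ.episode - (σ.clock + 1))
    rw [hσ.observed_R_eq_zero h, zero_add, abs_of_nonneg this.1]
    exact this.2
  · have := hσ.observed_R_mem (G := G) s a s' i ŝ â
    rw [add_zero, abs_of_nonneg this.1]
    exact this.2

include hδ in
/-- Within an episode the expected reward is a martingale: during the warm-up by the definition of
the delayed value, and afterwards by the first-step equation for the value of the first visit. -/
theorem AlgState.Valid.stepMean_expRewardAfter (hσ : σ.Valid θ) (s : ∀ j, S j) (i : Fin n)
    (ŝ : S i) (â : A i) :
    G.stepMean σ.policy s (fun a s' => G.expRewardAfter θ σ s a s' i ŝ â) =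
      G.expReward θ σ s i ŝ â := by
  classical
  have hπ := hσ.isStationaryPolicy_policy hδ
  have hsub : ∀ a s', (G.observed θ σ s a s' i).R ŝ â = (σ.player i).R ŝ â +
      if θ.Sampling σ ∧ (ŝ, â) ∈ (σ.player i).todo ∧ s i = ŝ ∧ a i = â then G.r i s a else 0 := by
    intro a s'
    rw [Game.observed_R]
    congr 1
    by_cases h : s i = ŝ ∧ a i = â
    · obtain ⟨rfl, rfl⟩ := h
      simp
    · rw [if_neg (fun h' => h ⟨h'.2.2.1.symm, h'.2.2.2.symm⟩), if_neg (fun h' => h h'.2.2)]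
  by_cases htodo : (ŝ, â) ∈ (σ.player i).todo
  · by_cases hsamp : θ.Sampling σ
    · have hD : θ.warmup σ.episode - σ.clock = 0 :=
        Nat.sub_eq_zero_of_le ((AlgParams.sampling_iff σ).1 hsamp)
      have hD' : θ.warmup σ.episode - (σ.clock + 1) = 0 := by omega
      have h1 : ∀ a s', G.expRewardAfter θ σ s a s' i ŝ â = (σ.player i).R ŝ â +
          if s i = ŝ ∧ a i = â then G.r i s a else G.visitValue σ.policy i ŝ â s' := by
        intro a s'
        simp only [Game.expRewardAfter, hsub, hsamp, htodo, true_and, Game.mem_observed_todo, hD',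
          AlgState.delayedValue, Function.iterate_zero, id_eq]
        by_cases h : s i = ŝ ∧ a i = â
        · rw [if_pos h, if_pos h, if_neg (by simp [h.1, h.2]), add_zero]
        · rw [if_neg h, if_neg h, if_pos (fun h' => h ⟨h'.1.symm, h'.2.symm⟩), add_zero]
      simp only [h1, Game.stepMean_add, G.stepMean_const hπ]
      unfold Game.expReward
      rw [if_pos htodo, hD]
      congr 1
      exact G.visitStep_visitValue hπ s
    · have hlt : σ.clock < θ.warmup σ.episode := by
        rw [AlgParams.sampling_iff] at hsamp; omega
      obtain ⟨D, hD⟩ : ∃ D, θ.warmup σ.episode - σ.clock = D + 1 :=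
        ⟨θ.warmup σ.episode - σ.clock - 1, by omega⟩
      have hD' : θ.warmup σ.episode - (σ.clock + 1) = D := by omega
      have h1 : ∀ a s', G.expRewardAfter θ σ s a s' i ŝ â = (σ.player i).R ŝ â +
          σ.delayedValue G D i ŝ â s' := by
        intro a s'
        simp only [Game.expRewardAfter, hsub, hsamp, htodo, false_and, if_false, add_zero,
          Game.mem_observed_todo, not_false_eq_true, and_true, if_true, hD']
      simp only [h1, Game.stepMean_add, G.stepMean_const hπ]
      unfold Game.expReward
      rw [if_pos htodo, hD, Game.stepMean_state]
      unfold AlgState.delayedValue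
      rw [Function.iterate_succ_apply']
  · have h1 : ∀ a s', G.expRewardAfter θ σ s a s' i ŝ â = (σ.player i).R ŝ â := by
      intro a s'
      simp only [Game.expRewardAfter, hsub, htodo, false_and, and_false, if_false, add_zero,
        Game.mem_observed_todo]
    simp only [h1, G.stepMean_const hπ]
    unfold Game.expReward
    rw [if_neg htodo, add_zero]

/-- The expected reward, tested in the direction from the current occupancy measures to `u`. -/
def Game.potential (G : Game n S A) (θ : AlgParams n S A) (u : ∀ i, S i → A i → S i → ℝ)
    (σ : AlgState n S A) (s : ∀ j, S j) : ℝ :=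
  ∑ i, pairR (G.expReward θ σ s i) (u i - (σ.player i).qhat)

/-- The same quantity one step later. -/
def Game.potentialAfter (G : Game n S A) (θ : AlgParams n S A) (u : ∀ i, S i → A i → S i → ℝ)
    (σ : AlgState n S A) (s : ∀ j, S j) (a : ∀ j, A j) (s' : ∀ j, S j) : ℝ :=
  ∑ i, pairR (G.expRewardAfter θ σ s a s' i) (u i - (σ.player i).qhat)

/-- A bound for the potential. -/
def potentialBound (S A : Fin n → Type*) [∀ i, Fintype (S i)] [∀ i, Fintype (A i)] : ℝ :=
  ∑ i, (Fintype.card (S i) * (Fintype.card (A i) * Fintype.card (S i)) : ℝ)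

variable {u : ∀ i, S i → A i → S i → ℝ} (hu : ∀ i, u i ∈ occPolytope)

theorem norm_sub_le_one {S A : Type*} [Fintype S] [Fintype A] {p q : S → A → S → ℝ}
    (hp : p ∈ occPolytope) (hq : q ∈ occPolytope) : ‖p - q‖ ≤ 1 := by
  refine (pi_norm_le_iff_of_nonneg zero_le_one).2 fun s => (pi_norm_le_iff_of_nonneg
    zero_le_one).2 fun a => (pi_norm_le_iff_of_nonneg zero_le_one).2 fun s' => ?_
  have h1 := hp.1 s a s'
  have h2 := hq.1 s a s'
  simp only [Pi.sub_apply, Real.norm_eq_abs, abs_le]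
  constructor <;> linarith

include hu in
theorem AlgState.Valid.abs_sum_pairR_le (hσ : σ.Valid θ) {R : ∀ i, S i → A i → ℝ}
    (hR : ∀ i s a, |R i s a| ≤ 1) :
    |∑ i, pairR (R i) (u i - (σ.player i).qhat)| ≤ potentialBound S A := by
  refine (Finset.abs_sum_le_sum_abs _ _).trans (Finset.sum_le_sum fun i _ => ?_)
  refine (abs_pairR_le (hR i) _).trans ?_
  rw [mul_one]
  exact mul_le_of_le_one_right (by positivity) (norm_sub_le_one (hu i) (hσ.qhat_mem i).1)

include hδ hu in
theorem AlgState.Valid.abs_potential_le (hσ : σ.Valid θ) :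
    |G.potential θ u σ s| ≤ potentialBound S A :=
  hσ.abs_sum_pairR_le hu fun _ _ _ => hσ.abs_expReward_le hδ

include hδ hu in
theorem AlgState.Valid.abs_potentialAfter_le (hσ : σ.Valid θ) :
    |G.potentialAfter θ u σ s a s'| ≤ potentialBound S A :=
  hσ.abs_sum_pairR_le hu fun _ _ _ => hσ.abs_expRewardAfter_le hδ

include hδ in
theorem AlgState.Valid.stepMean_potentialAfter (hσ : σ.Valid θ) (s : ∀ j, S j) :
    G.stepMean σ.policy s (fun a s' => G.potentialAfter θ u σ s a s') = G.potential θ u σ s := by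
  simp only [Game.potentialAfter, Game.potential, pairR_apply, Game.stepMean_sum,
    Game.stepMean_const_mul, hσ.stepMean_expRewardAfter hδ]

theorem Game.potentialAfter_of_not_ends (h : ¬ G.EpisodeEnds θ σ s a s') :
    G.potentialAfter θ u σ s a s' = G.potential θ u (G.algStep θ σ s a s') s' := by
  unfold Game.potentialAfter Game.potential
  simp only [Game.expRewardAfter_of_not_ends h]
  rw [Game.algStep_of_not_ends h]
  rfl

end OneStep

/-- The accumulated noise of the recorded rewards, weighted with the step sizes. -/
def Game.noise (G : Game n S A) (θ : AlgParams n S A) (u : ∀ i, S i → A i → S i → ℝ) (t : ℕ)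
    (x : ℕ → (∀ i, S i) × (∀ i, A i)) : ℝ :=
  ∑ l ∈ Finset.range t, θ.η (G.algState θ x l).episode *
    (G.potentialAfter θ u (G.algState θ x l) (x l).1 (x l).2 (x (l + 1)).1 -
      G.potential θ u (G.algState θ x l) (x l).1)

variable {u : ∀ i, S i → A i → S i → ℝ} (hu : ∀ i, u i ∈ occPolytope)

theorem Game.preDet_noise (t : ℕ) : PreDet t (G.noise θ u t) := by
  intro x y h1 h2
  refine Finset.sum_congr rfl fun l hl => ?_
  have hl := Finset.mem_range.1 hl
  have h3 := Game.preDet_algState (G := G) (θ := θ) l x y (fun k hk => h1 k (hk.trans hl))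
    (by rw [h1 l hl])
  simp only at h3
  have h4 : (x (l + 1)).1 = (y (l + 1)).1 := by
    rcases (Nat.succ_le_of_lt hl).eq_or_lt with h | h
    · rw [Nat.succ_eq_add_one] at h; rw [h]; exact h2
    · rw [h1 (l + 1) h]
  rw [h3, h1 l hl, h4]

theorem Game.noise_extPath (t : ℕ) (x : ℕ → (∀ i, S i) × (∀ i, A i)) (a : ∀ i, A i)
    (s' : ∀ i, S i) : G.noise θ u (t + 1) (extPath x t a s') = G.noise θ u t x +
      θ.η (G.algState θ x t).episode *
      (G.potentialAfter θ u (G.algState θ x t) (x t).1 a s' -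
        G.potential θ u (G.algState θ x t) (x t).1) := by
  have h1 := (Game.preDet_noise (G := G) (θ := θ) (u := u) t).extPath le_rfl x a s'
  have h2 := (Game.preDet_algState (G := G) (θ := θ) t).extPath le_rfl x a s'
  rw [← h1]
  unfold Game.noise
  rw [Finset.sum_range_succ]
  simp only [extPath_self, extPath_succ, h2]

/-- A compensated square of the noise. It decreases on average: the increments of the noise within
an episode telescope to first order in the potential, whose square is subtracted; every new episode
costs the square of its step size. -/
def Game.noiseSq (G : Game n S A) (θ : AlgParams n S A) (u : ∀ i, S i → A i → S i → ℝ) (t : ℕ)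
    (x : ℕ → (∀ i, S i) × (∀ i, A i)) : ℝ :=
  G.noise θ u t x ^ 2 -
    θ.η (G.algState θ x t).episode ^ 2 * G.potential θ u (G.algState θ x t) (x t).1 ^ 2 -
    potentialBound S A ^ 2 * ∑ j ∈ Finset.range ((G.algState θ x t).episode - 1), θ.η (j + 1) ^ 2

theorem Game.preDet_noiseSq (t : ℕ) : PreDet t (G.noiseSq θ u t) := by
  intro x y h1 h2
  have h3 := Game.preDet_algState (G := G) (θ := θ) t x y h1 h2
  have h4 := Game.preDet_noise (G := G) (θ := θ) (u := u) t x y h1 h2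
  simp only at h3
  unfold Game.noiseSq
  rw [h3, h4, h2]

include hδ hne hu in
/-- One step of the compensated square: the bound exceeds its previous value only by a term that
vanishes on average. -/
theorem Game.noiseSq_extPath_le (t : ℕ) (x : ℕ → (∀ i, S i) × (∀ i, A i)) (a : ∀ i, A i)
    (s' : ∀ i, S i) : G.noiseSq θ u (t + 1) (extPath x t a s') ≤ G.noiseSq θ u t x +
      2 * (G.noise θ u t x - θ.η (G.algState θ x t).episode *
        G.potential θ u (G.algState θ x t) (x t).1) * θ.η (G.algState θ x t).episode *
      (G.potentialAfter θ u (G.algState θ x t) (x t).1 a s' -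
        G.potential θ u (G.algState θ x t) (x t).1) := by
  have hval := Game.algState_valid (G := G) hδ hne x t
  unfold Game.noiseSq
  rw [Game.noise_extPath, Game.algState_extPath, extPath_succ]
  set σ := G.algState θ x t
  set M := G.noise θ u t x
  have hA := hval.abs_potentialAfter_le (G := G) (s := (x t).1) (a := a) (s' := s') hδ hu
  by_cases hend : G.EpisodeEnds θ σ (x t).1 a s'
  · have hep : (G.algStep θ σ (x t).1 a s').episode = σ.episode + 1 := by
      rw [Game.algStep_of_ends hend]
    have h1 : ∑ j ∈ Finset.range ((G.algStep θ σ (x t).1 a s').episode - 1), θ.η (j + 1) ^ 2 =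
        ∑ j ∈ Finset.range (σ.episode - 1), θ.η (j + 1) ^ 2 + θ.η σ.episode ^ 2 := by
      have h2 := hval.one_le_episode
      rw [hep, show σ.episode + 1 - 1 = (σ.episode - 1) + 1 by omega, Finset.sum_range_succ,
        show σ.episode - 1 + 1 = σ.episode by omega]
    rw [h1]
    have h3 : G.potentialAfter θ u σ (x t).1 a s' ^ 2 ≤ potentialBound S A ^ 2 :=
      sq_le_sq.2 (hA.trans (le_abs_self _))
    have h4 := mul_le_mul_of_nonneg_left h3 (sq_nonneg (θ.η σ.episode))
    have h5 : 0 ≤ θ.η (G.algStep θ σ (x t).1 a s').episode ^ 2 *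
      G.potential θ u (G.algStep θ σ (x t).1 a s') s' ^ 2 := by positivity
    nlinarith
  · have hep : (G.algStep θ σ (x t).1 a s').episode = σ.episode := by
      rw [Game.algStep_of_not_ends hend]
    rw [hep, Game.potentialAfter_of_not_ends hend]
    exact le_of_eq (by ring)

section Probability

variable {Ω : Type*} [MeasurableSpace Ω] {μ : Measure Ω} [IsProbabilityMeasure μ]
  {X : ℕ → Ω → (∀ i, S i) × (∀ i, A i)}

include hδ hne hu in
/-- The noise is bounded in `L²`. -/
theorem Game.IsPlay.integral_noise_sq_le (hX : G.IsPlay (G.algPolicy θ) μ X)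
    (hη : Summable fun k => θ.η (k + 1) ^ 2) (t : ℕ) :
    ∫ ω, G.noise θ u t (fun l => X l ω) ^ 2 ∂μ ≤
      potentialBound S A ^ 2 * ∑' k, θ.η (k + 1) ^ 2 := by
  have hpol := Game.algPolicy_isStationaryPolicy (G := G) (θ := θ) hδ hne
  have h1 : ∀ t, ∫ ω, G.noiseSq θ u t (fun l => X l ω) ∂μ ≤ 0 := by
    intro t
    induction t with
    | zero =>
      refine integral_nonpos fun ω => ?_
      have h2 : 0 ≤ θ.η 1 ^ 2 * G.potential θ u AlgState.init (X 0 ω).1 ^ 2 := by positivity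
      simp only [Game.noiseSq, Game.noise, Game.algState, AlgState.init, Finset.range_zero,
        Finset.sum_empty, Nat.sub_self, Pi.zero_apply]
      simp only [AlgState.init] at h2
      linarith
    | succ t ih =>
      refine (hX.integral_succ_le Game.preDet_algPolicy hpol (Game.preDet_noiseSq t)
        (Game.preDet_noiseSq (t + 1)) fun x => ?_).trans ih
      have hval := Game.algState_valid (G := G) hδ hne x t
      refine (G.stepMean_mono (hpol x t)
        (fun a s' => Game.noiseSq_extPath_le hδ hne hu t x a s')).trans (le_of_eq ?_)
      change G.stepMean (G.algState θ x t).policy _ _ = _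
      have h3 : ∀ b c : ℝ, G.stepMean (G.algState θ x t).policy (x t).1 (fun a s' => b + c *
          (G.potentialAfter θ u (G.algState θ x t) (x t).1 a s' -
            G.potential θ u (G.algState θ x t) (x t).1)) = b := by
        intro b c
        simp only [sub_eq_add_neg, Game.stepMean_add, Game.stepMean_const_mul,
          G.stepMean_const (hval.isStationaryPolicy_policy hδ), hval.stepMean_potentialAfter hδ]
        ring
      exact h3 _ _
  have h2 : ∀ x, G.noise θ u t x ^ 2 ≤ G.noiseSq θ u t x +
      potentialBound S A ^ 2 * ∑' k, θ.η (k + 1) ^ 2 := by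
    intro x
    have hval := Game.algState_valid (G := G) hδ hne x t
    have h3 : G.potential θ u (G.algState θ x t) (x t).1 ^ 2 ≤ potentialBound S A ^ 2 :=
      sq_le_sq.2 ((hval.abs_potential_le hδ hu).trans (le_abs_self _))
    have h4 := mul_le_mul_of_nonneg_left h3 (sq_nonneg (θ.η (G.algState θ x t).episode))
    have h5 : ∑ j ∈ Finset.range ((G.algState θ x t).episode - 1), θ.η (j + 1) ^ 2 +
        θ.η (G.algState θ x t).episode ^ 2 ≤ ∑' k, θ.η (k + 1) ^ 2 := by
      have h6 := hval.one_le_episode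
      refine le_trans (le_of_eq ?_) (hη.sum_le_tsum (Finset.range (G.algState θ x t).episode)
        fun k _ => sq_nonneg _)
      rw [show (G.algState θ x t).episode = (G.algState θ x t).episode - 1 + 1 by omega,
        Finset.sum_range_succ, Nat.add_sub_cancel]
    have h6 := mul_le_mul_of_nonneg_left h5 (sq_nonneg (potentialBound S A))
    unfold Game.noiseSq
    nlinarith
  have hsq : PreDet t fun x => G.noise θ u t x ^ 2 := fun x y h3 h4 => by
    simp only [Game.preDet_noise (G := G) (θ := θ) (u := u) t x y h3 h4]
  have hint := hX.integrable (Game.preDet_noiseSq (G := G) (θ := θ) (u := u) t)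
  calc ∫ ω, G.noise θ u t (fun l => X l ω) ^ 2 ∂μ
      ≤ ∫ ω, (G.noiseSq θ u t (fun l => X l ω) +
          potentialBound S A ^ 2 * ∑' k, θ.η (k + 1) ^ 2) ∂μ :=
        integral_mono (hX.integrable hsq) (hint.add (integrable_const _)) fun ω => h2 _
    _ = ∫ ω, G.noiseSq θ u t (fun l => X l ω) ∂μ +
          potentialBound S A ^ 2 * ∑' k, θ.η (k + 1) ^ 2 := by
        rw [integral_add hint (integrable_const _)]
        simp
    _ ≤ _ := by linarith [h1 t]

include hδ hne hu in
/-- The noise converges almost surely, by the martingale convergence theorem. -/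
theorem Game.IsPlay.ae_exists_tendsto_noise (hX : G.IsPlay (G.algPolicy θ) μ X)
    (hη : Summable fun k => θ.η (k + 1) ^ 2) :
    ∀ᵐ ω ∂μ, ∃ c, Tendsto (fun t => G.noise θ u t fun l => X l ω) atTop (𝓝 c) := by
  have hpol := Game.algPolicy_isStationaryPolicy (G := G) (θ := θ) hδ hne
  refine hX.ae_exists_tendsto Game.preDet_algPolicy hpol Game.preDet_noise (fun t x => ?_)
    (hX.integral_noise_sq_le hδ hne hu hη)
  have hval := Game.algState_valid (G := G) hδ hne x t
  simp only [Game.noise_extPath]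
  change G.stepMean (G.algState θ x t).policy _ _ = _
  simp only [sub_eq_add_neg, Game.stepMean_add, Game.stepMean_const_mul,
    G.stepMean_const (hval.isStationaryPolicy_policy hδ), hval.stepMean_potentialAfter hδ]
  ring

end Probability

/-! ### The noise along a path -/

section Path

variable {x : ℕ → (∀ i, S i) × (∀ i, A i)}

/-- Expectation at the beginning of the episode `k` of the rewards recorded in it. -/
def Game.expRewardAt (G : Game n S A) (θ : AlgParams n S A) (x : ℕ → (∀ i, S i) × (∀ i, A i))
    (k : ℕ) (i : Fin n) (ŝ : S i) (â : A i) : ℝ :=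
  (G.algState θ x (G.start θ x k)).delayedValue G (θ.warmup k) i ŝ â (x (G.start θ x k)).1

include hδ hne in
theorem Game.potential_start {k : ℕ} (hk1 : 1 ≤ k) (hk : ∃ t, (G.algState θ x t).episode = k) :
    G.potential θ u (G.algState θ x (G.start θ x k)) (x (G.start θ x k)).1 =
      ∑ i, pairR (G.expRewardAt θ x k i) (u i - G.qhatAt θ x k i) := by
  refine Finset.sum_congr rfl fun i _ => ?_
  have hval := Game.algState_valid (G := G) hδ hne x (G.start θ x k)
  have hclock := Game.clock_start hk1 hk
  have : G.expReward θ (G.algState θ x (G.start θ x k)) (x (G.start θ x k)).1 i =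
      G.expRewardAt θ x k i := by
    ext ŝ â
    have htodo : (ŝ, â) ∈ ((G.algState θ x (G.start θ x k)).player i).todo := by
      rw [hval.todo_of_clock hclock i]; exact Set.mem_univ _
    unfold Game.expReward Game.expRewardAt
    rw [if_pos htodo, hval.R_eq_zero i ŝ â htodo, zero_add, hclock, Game.episode_start hk,
      Nat.sub_zero]
  rw [this]
  rfl

/-- Within an episode the step size is constant and the increments of the noise telescope. -/
theorem Game.noise_within {k : ℕ} (hk : ∃ t, (G.algState θ x t).episode = k)
    {j : ℕ} (hj : (G.algState θ x (G.start θ x k + j)).episode = k) :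
    G.noise θ u (G.start θ x k + j) x = G.noise θ u (G.start θ x k) x + θ.η k *
      (G.potential θ u (G.algState θ x (G.start θ x k + j)) (x (G.start θ x k + j)).1 -
        G.potential θ u (G.algState θ x (G.start θ x k)) (x (G.start θ x k)).1) := by
  induction j with
  | zero => simp
  | succ j ih =>
    have h1 : (G.algState θ x (G.start θ x k + j)).episode = k := by
      have hmono := Game.monotone_episode (G := G) (θ := θ) (x := x)
      exact le_antisymm
        ((hmono (show G.start θ x k + j ≤ G.start θ x k + (j + 1) by omega)).trans hj.le)
        ((Game.episode_start hk).ge.trans (hmono (Nat.le_add_right _ j)))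
    have hne : ¬ G.EndsAt θ x (G.start θ x k + j) := by
      intro h
      rw [← add_assoc, Game.algState_succ_of_ends h] at hj
      simp only at hj
      omega
    have h2 := Game.potentialAfter_of_not_ends (u := u) hne
    have h3 := ih h1
    unfold Game.noise at h3 ⊢
    rw [← add_assoc, Finset.sum_range_succ, h3, h1, h2]
    simp only [Game.algState]
    ring

include hδ hne in
/-- Over a whole episode the noise grows by the error of the recorded rewards, compared with their
expectation at the beginning of the episode. -/
theorem Game.noise_start_succ {k : ℕ} (hk1 : 1 ≤ k) (hk : ∃ t, (G.algState θ x t).episode = k)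
    (hk' : ∃ t, (G.algState θ x t).episode = k + 1) :
    G.noise θ u (G.start θ x (k + 1)) x = G.noise θ u (G.start θ x k) x + θ.η k *
      ∑ i, pairR (G.rewardAt θ x k i - G.expRewardAt θ x k i) (u i - G.qhatAt θ x k i) := by
  obtain ⟨e, he, hep, hend⟩ := Game.exists_end hk1 hk'
  obtain ⟨j, hj⟩ := Game.exists_eq_start_add hep
  have hw := Game.within_episode hk1 hk (j := j) (by rw [← hj]; exact hep)
  have h1 := Game.noise_within (u := u) hk (j := j) (by rw [← hj]; exact hep)
  rw [← hj] at hw h1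
  have hR : ∀ i, G.rewardAt θ x k i =
      (G.observed θ (G.algState θ x e) (x e).1 (x e).2 (x (e + 1)).1 i).R := by
    intro i
    unfold Game.rewardAt
    simp only [he, Nat.add_sub_cancel]
  have h2 : G.potentialAfter θ u (G.algState θ x e) (x e).1 (x e).2 (x (e + 1)).1 =
      ∑ i, pairR (G.rewardAt θ x k i) (u i - G.qhatAt θ x k i) := by
    refine Finset.sum_congr rfl fun i _ => ?_
    rw [Game.expRewardAfter_of_ends hend, hw.2.1 i, hR i]
    rfl
  have h3 : ∑ i, pairR (G.rewardAt θ x k i - G.expRewardAt θ x k i) (u i - G.qhatAt θ x k i) =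
      ∑ i, pairR (G.rewardAt θ x k i) (u i - G.qhatAt θ x k i) -
        ∑ i, pairR (G.expRewardAt θ x k i) (u i - G.qhatAt θ x k i) := by
    simp only [pairR_apply, Pi.sub_apply, mul_sub, Finset.sum_sub_distrib]
  rw [h3, ← h2, ← Game.potential_start hδ hne hk1 hk, he]
  have h4 : G.noise θ u (e + 1) x = G.noise θ u e x + θ.η (G.algState θ x e).episode *
    (G.potentialAfter θ u (G.algState θ x e) (x e).1 (x e).2 (x (e + 1)).1 -
      G.potential θ u (G.algState θ x e) (x e).1) := Finset.sum_range_succ _ _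
  rw [h4, h1, hep]
  ring

include hδ hne in
/-- If the noise converges, so does the series of the errors of the recorded rewards. -/
theorem Game.exists_tendsto_sum_noise (hall : ∀ k ≥ 1, ∃ t, (G.algState θ x t).episode = k)
    (hM : ∃ c, Tendsto (fun t => G.noise θ u t x) atTop (𝓝 c)) :
    ∃ c, Tendsto (fun K => ∑ k ∈ Finset.range K, θ.η (k + 1) *
      ∑ i, pairR (G.rewardAt θ x (k + 1) i - G.expRewardAt θ x (k + 1) i)
        (u i - G.qhatAt θ x (k + 1) i)) atTop (𝓝 c) := by
  obtain ⟨c, hc⟩ := hM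
  refine ⟨c, ?_⟩
  have hstart : Tendsto (fun K => G.start θ x (K + 1)) atTop atTop :=
    tendsto_atTop_mono (fun K => by
      have := Game.le_start (hall (K + 1) (by omega))
      change K ≤ _
      omega) tendsto_id
  refine (hc.comp hstart).congr fun K => ?_
  simp only [Function.comp_apply]
  induction K with
  | zero => simp [Game.start_one, Game.noise]
  | succ K ih =>
    rw [Finset.sum_range_succ, ← ih]
    exact Game.noise_start_succ hδ hne (by omega) (hall (K + 1) (by omega))
      (hall (K + 1 + 1) (by omega))

end Path

end Noise

/-! ### Convergence of perturbed mirror descent -/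

section Gradient

variable {n : ℕ} {S A : Fin n → Type*} [∀ i, Fintype (S i)] [∀ i, Fintype (A i)]

theorem pairR_sub_left {S A : Type*} [Fintype S] [Fintype A] (R R' : S → A → ℝ)
    (p : S → A → S → ℝ) : pairR (R - R') p = pairR R p - pairR R' p := by
  simp only [pairR_apply, Pi.sub_apply, mul_sub, Finset.sum_sub_distrib]

theorem abs_rho_sub_le {S A : Type*} [Fintype S] [Fintype A] (p q : S → A → S → ℝ) (s : S) (a : A) :
    |rho p s a - rho q s a| ≤ Fintype.card S * ‖p - q‖ := by
  unfold rho
  rw [← Finset.sum_sub_distrib]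
  refine (Finset.abs_sum_le_sum_abs _ _).trans ?_
  calc _ ≤ ∑ _s' : S, ‖p - q‖ := Finset.sum_le_sum fun s' _ =>
        ((norm_le_pi_norm ((p - q) s a) s').trans (norm_le_pi_norm ((p - q) s) a)).trans
          (norm_le_pi_norm (p - q) s)
    _ = _ := by simp

variable (G : Game n S A)

/-- The payoff gradient as a function of the state and the action; it does not depend on the next
state, for which `s` is substituted. -/
def Game.gradR (G : Game n S A) (i : Fin n) (q : ∀ j, S j → A j → S j → ℝ) (s : S i) (a : A i) : ℝ :=
  G.payoffGrad i q s a s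

/-- The pairing of the payoff gradients at `q` with the direction from `q` to `u`. -/
def Game.gap (G : Game n S A) (u q : ∀ j, S j → A j → S j → ℝ) : ℝ :=
  ∑ i, pairR (G.gradR i q) (u i - q i)

theorem Game.gap_eq (u q : ∀ j, S j → A j → S j → ℝ) : G.gap u q =
    ∑ i, ∑ s, ∑ a, ∑ s', G.payoffGrad i q s a s' * (u i s a s' - q i s a s') := by
  refine Finset.sum_congr rfl fun i _ => Finset.sum_congr rfl fun s _ =>
    Finset.sum_congr rfl fun a _ => Finset.sum_congr rfl fun s' _ => mul_comm _ _

theorem Game.continuous_gap (u : ∀ j, S j → A j → S j → ℝ) : Continuous (G.gap u) := by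
  have : G.gap u = fun q => _ := funext (G.gap_eq u)
  rw [this]
  refine continuous_finsetSum _ fun i _ => continuous_finsetSum _ fun s _ =>
    continuous_finsetSum _ fun a _ => continuous_finsetSum _ fun s' _ => Continuous.mul ?_ ?_
  · unfold Game.payoffGrad
    refine continuous_finsetSum _ fun s _ => continuous_finsetSum _ fun a _ => ?_
    split_ifs <;> fun_prop
  · fun_prop

theorem Game.abs_gradR_le {q : ∀ j, S j → A j → S j → ℝ} (hq : ∀ j, q j ∈ occPolytope) (i : Fin n)
    (s : S i) (a : A i) :
    |G.gradR i q s a| ≤ Fintype.card (∀ j, S j) * Fintype.card (∀ j, A j) := by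
  classical
  unfold Game.gradR Game.payoffGrad
  refine (Finset.abs_sum_le_sum_abs _ _).trans ?_
  calc _ ≤ ∑ _s : ∀ j, S j, ∑ _a : ∀ j, A j, (1 : ℝ) := Finset.sum_le_sum fun s _ =>
        (Finset.abs_sum_le_sum_abs _ _).trans (Finset.sum_le_sum fun a _ => by
          split_ifs
          · have h0 : 0 ≤ ∏ j ∈ Finset.univ.erase i, ∑ s', q j (s j) (a j) s' :=
              Finset.prod_nonneg fun j _ => rho_nonneg (hq j) _ _
            have h1 : ∏ j ∈ Finset.univ.erase i, ∑ s', q j (s j) (a j) s' ≤ 1 :=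
              Finset.prod_le_one (fun j _ => rho_nonneg (hq j) _ _) fun j _ => rho_le_one (hq j) _ _
            have h2 := G.r_mem i s a
            rw [abs_of_nonneg (mul_nonneg h0 h2.1)]
            exact mul_le_one₀ h1 h2.1 h2.2
          · simp)
    _ = _ := by simp

theorem Game.abs_gradR_sub_le {p q : ∀ j, S j → A j → S j → ℝ} (hp : ∀ j, p j ∈ occPolytope)
    (hq : ∀ j, q j ∈ occPolytope) {r : ℝ} (hr : ∀ j, ‖p j - q j‖ ≤ r) (i : Fin n)
    (s : S i) (a : A i) :
    |G.gradR i p s a - G.gradR i q s a| ≤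
      Fintype.card (∀ j, S j) * Fintype.card (∀ j, A j) * ((∑ j, (Fintype.card (S j) : ℝ)) * r) := by
  classical
  have hr0 : 0 ≤ r := (norm_nonneg _).trans (hr i)
  have hsum : ∀ (s : ∀ j, S j) (a : ∀ j, A j), |(∏ j ∈ Finset.univ.erase i, ∑ s', p j (s j) (a j) s') -
      ∏ j ∈ Finset.univ.erase i, ∑ s', q j (s j) (a j) s'| ≤
      (∑ j, (Fintype.card (S j) : ℝ)) * r := by
    intro s a
    refine (abs_prod_sub_prod_le _ _ _ (fun j _ => ?_) fun j _ => ?_).trans ?_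
    · exact (abs_of_nonneg (rho_nonneg (hp j) (s j) (a j))).trans_le (rho_le_one (hp j) _ _)
    · exact (abs_of_nonneg (rho_nonneg (hq j) (s j) (a j))).trans_le (rho_le_one (hq j) _ _)
    · rw [Finset.sum_mul]
      refine (Finset.sum_le_sum_of_subset_of_nonneg (Finset.erase_subset _ _)
        fun _ _ _ => abs_nonneg _).trans (Finset.sum_le_sum fun j _ => ?_)
      exact (abs_rho_sub_le (p j) (q j) (s j) (a j)).trans
        (mul_le_mul_of_nonneg_left (hr j) (Nat.cast_nonneg _))
  unfold Game.gradR Game.payoffGrad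
  rw [← Finset.sum_sub_distrib]
  refine (Finset.abs_sum_le_sum_abs _ _).trans ?_
  calc _ ≤ ∑ _s : ∀ j, S j, ∑ _a : ∀ j, A j, (∑ j, (Fintype.card (S j) : ℝ)) * r :=
        Finset.sum_le_sum fun s _ => by
          rw [← Finset.sum_sub_distrib]
          refine (Finset.abs_sum_le_sum_abs _ _).trans (Finset.sum_le_sum fun a _ => ?_)
          split_ifs
          · have h2 := G.r_mem i s a
            rw [← sub_mul, abs_mul, abs_of_nonneg h2.1]
            exact (mul_le_of_le_one_right (abs_nonneg _) h2.2).trans (hsum s a)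
          · rw [sub_self, abs_zero]; positivity
    _ = _ := by simp; ring

/-- The gap is Lipschitz on the product of the occupancy polytopes. -/
theorem Game.exists_gap_lipschitz {u : ∀ j, S j → A j → S j → ℝ} (hu : ∀ j, u j ∈ occPolytope) :
    ∃ L : ℝ, 0 ≤ L ∧ ∀ p q : ∀ j, S j → A j → S j → ℝ, (∀ j, p j ∈ occPolytope) →
      (∀ j, q j ∈ occPolytope) → ∀ r : ℝ, 0 ≤ r → (∀ j, ‖p j - q j‖ ≤ r) →
      |G.gap u p - G.gap u q| ≤ L * r := by
  set B : ℝ := (Fintype.card (∀ j, S j) : ℝ) * (Fintype.card (∀ j, A j) : ℝ) with hB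
  set M : ℝ := ∑ j, (Fintype.card (S j) : ℝ) with hM
  set N : Fin n → ℝ := fun i => Fintype.card (S i) * (Fintype.card (A i) * Fintype.card (S i))
    with hN
  have hB0 : 0 ≤ B := by positivity
  have hM0 : 0 ≤ M := by positivity
  have hN0 : ∀ i, 0 ≤ N i := fun i => by positivity
  refine ⟨∑ i, N i * (B * M + B), Finset.sum_nonneg fun i _ => mul_nonneg (hN0 i) (by positivity),
    fun p q hp hq r hr0 hr => ?_⟩
  unfold Game.gap
  rw [← Finset.sum_sub_distrib, Finset.sum_mul]
  refine (Finset.abs_sum_le_sum_abs _ _).trans (Finset.sum_le_sum fun i _ => ?_)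
  have h1 : pairR (G.gradR i p) (u i - p i) - pairR (G.gradR i q) (u i - q i) =
      pairR (G.gradR i p - G.gradR i q) (u i - p i) - pairR (G.gradR i q) (p i - q i) := by
    rw [pairR_sub_left]
    simp only [map_sub]
    ring
  have h2 : |pairR (G.gradR i p - G.gradR i q) (u i - p i)| ≤ N i * (B * (M * r)) * 1 :=
    (abs_pairR_le (G.abs_gradR_sub_le hp hq hr i) _).trans
      (mul_le_mul_of_nonneg_left (norm_sub_le_one (hu i) (hp i))
        (mul_nonneg (hN0 i) (by positivity)))
  have h3 : |pairR (G.gradR i q) (p i - q i)| ≤ N i * B * r :=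
    (abs_pairR_le (G.abs_gradR_le hq i) _).trans
      (mul_le_mul_of_nonneg_left (hr i) (mul_nonneg (hN0 i) hB0))
  rw [h1]
  refine (abs_sub _ _).trans ((add_le_add h2 h3).trans (le_of_eq (by ring)))

theorem isCompact_shrunkOf {S A : Type*} [Fintype S] [Fintype A] {δ : ℝ} (hδ : 0 < δ)
    (P : S → A → S → ℝ) : IsCompact (shrunkOf δ P) := by
  have : shrunkOf δ P = shrunk δ ∩ {q | ∀ s a s', q s a s' = rho q s a * P s a s'} := by
    ext q
    exact ⟨fun h => ⟨h.1, eq_rho_mul_of_mem_shrunkOf hδ h⟩, fun h => mem_shrunkOf_of_eq hδ h.1 h.2⟩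
  rw [this]
  refine (isCompact_shrunk δ).inter_right ?_
  simp only [Set.ofPred_forall]
  refine isClosed_iInter fun s => isClosed_iInter fun a => isClosed_iInter fun s' => ?_
  exact isClosed_eq (by fun_prop) ((continuous_rho s a).mul continuous_const)

/-- A feasible point at which the gap is small is close to the stable equilibrium. -/
theorem Game.IsGloballyStableNash.exists_gap_lt {G : Game n S A} {δ : Fin n → ℝ}
    (hδ : ∀ j, 0 < δ j) {u : ∀ j, S j → A j → S j → ℝ} (hu : G.IsGloballyStableNash δ u) {r : ℝ}
    (hr : 0 < r) : ∃ ε > 0, ∀ q : ∀ j, S j → A j → S j → ℝ, (∀ j, q j ∈ shrunkOf (δ j) (G.P j)) →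
      G.gap u q < ε → ∀ j, ‖q j - u j‖ < r := by
  set K : Set (∀ j, S j → A j → S j → ℝ) :=
    Set.univ.pi (fun j => shrunkOf (δ j) (G.P j)) ∩ {q | r ≤ ‖q - u‖} with hK
  have hKc : IsCompact K := (isCompact_univ_pi fun j => isCompact_shrunkOf (hδ j) (G.P j)).inter_right
    (isClosed_le continuous_const (by fun_prop))
  have hout : ∀ q : ∀ j, S j → A j → S j → ℝ, (∀ j, q j ∈ shrunkOf (δ j) (G.P j)) → q ∉ K →
      ∀ j, ‖q j - u j‖ < r := by
    intro q hq hqK j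
    have h1 : ‖q - u‖ < r := by
      by_contra! h
      exact hqK ⟨fun j _ => hq j, h⟩
    exact (norm_le_pi_norm (q - u) j).trans_lt h1
  rcases K.eq_empty_or_nonempty with hKe | hKne
  · exact ⟨1, one_pos, fun q hq _ => hout q hq (by rw [hKe]; exact Set.notMem_empty _)⟩
  · obtain ⟨p, hpK, hp⟩ := hKc.exists_isMinOn hKne (G.continuous_gap u).continuousOn
    refine ⟨G.gap u p, ?_, fun q hq hlt => hout q hq fun hqK => absurd hlt (not_lt.2 (hp hqK))⟩
    have h1 := hu.2.2 p fun j => hpK.1 j (Set.mem_univ j)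
    rw [← G.gap_eq] at h1
    refine lt_of_le_of_ne h1.1 fun h0 => ?_
    have h2 := h1.2.1 h0.symm
    have h3 : r ≤ ‖p - u‖ := hpK.2
    rw [h2, sub_self, norm_zero] at h3
    linarith

/-- Mirror descent with noise and errors of summable size converges to the stable equilibrium. The
gap is nonnegative only at feasible points, so it is compared with the gap at nearby points of the
true polytopes, which Hoffman's bound provides at a distance `O(r k)`. Then the sum of the divergences
converges, and its limit is `0` because the gap is small infinitely often. -/
theorem Game.IsGloballyStableNash.tendsto_of_recursion {G : Game n S A} {δ : Fin n → ℝ}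
    (hδ : ∀ j, 0 < δ j) {u : ∀ j, S j → A j → S j → ℝ} (hu : G.IsGloballyStableNash δ u)
    {h : ∀ i, (S i → A i → S i → ℝ) → ℝ} {m : ℝ} (hm : 0 < m)
    (hconv : ∀ i, StrongConvexOn (shrunk (δ i)) m (h i))
    (hdiff : ∀ i, DifferentiableOn ℝ (h i) (shrunk (δ i)))
    {q : ℕ → ∀ j, S j → A j → S j → ℝ} (hq : ∀ k j, q k j ∈ shrunk (δ j)) {r : ℕ → ℝ}
    (hr0 : ∀ k, 0 ≤ r k) (hr : Tendsto r atTop (𝓝 0))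
    (hqr : ∀ k j s a s', |q k j s a s' - rho (q k j) s a * G.P j s a s'| ≤ r k)
    {η z : ℕ → ℝ} (hη : ∀ k, 0 ≤ η k) (hηr : Summable fun k => η k * r k)
    (hrec : ∀ k, ∑ i, bregman (h i) (shrunk (δ i)) (u i) (q (k + 1) i) ≤
      ∑ i, bregman (h i) (shrunk (δ i)) (u i) (q k i) - η k * G.gap u (q k) + z k)
    (hz : ∃ l, Tendsto (fun K => ∑ k ∈ Finset.range K, z k) atTop (𝓝 l))
    (hsum : Tendsto (fun K => ∑ k ∈ Finset.range K, η k) atTop atTop) (i : Fin n) :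
    Tendsto (fun k => q k i) atTop (𝓝 (u i)) := by
  have huP : ∀ j, u j ∈ shrunkOf (δ j) (G.P j) := hu.1.1
  obtain ⟨L, hL0, hL⟩ := G.exists_gap_lipschitz fun j => (huP j).1.1
  choose C hC0 hC using fun j => exists_errorBound_shrunkOf (hδ j) (G.P j) ⟨u j, huP j⟩
  set C' := ∑ j, C j with hC'
  have hC'0 : 0 ≤ C' := Finset.sum_nonneg fun j _ => hC0 j
  choose p hpP hpq using fun k j => hC j (q k j) (hq k j) (r k) (hr0 k) (hqr k j)
  have hpq' : ∀ k j, ‖q k j - p k j‖ ≤ C' * r k := fun k j => (hpq k j).trans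
    (mul_le_mul_of_nonneg_right
      (Finset.single_le_sum (fun j _ => hC0 j) (Finset.mem_univ j)) (hr0 k))
  have hD0 : ∀ k i, 0 ≤ bregman (h i) (shrunk (δ i)) (u i) (q k i) := fun k i =>
    bregman_nonneg hm (hconv i) (hdiff i) (huP i).1 (hq k i)
  have hgap0 : ∀ k, 0 ≤ G.gap u (p k) := fun k => by
    rw [G.gap_eq]
    exact (hu.2.2 (p k) (hpP k)).1
  set D : ℕ → ℝ := fun k => ∑ i, bregman (h i) (shrunk (δ i)) (u i) (q k i) with hDdef
  have hrec' : ∀ k, D (k + 1) ≤ D k - η k * G.gap u (p k) +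
      (z k + L * C' * (η k * r k)) := by
    intro k
    have h1 := (abs_le.1 (hL (q k) (p k) (fun j => (hq k j).1) (fun j => (hpP k j).1.1)
      (C' * r k) (mul_nonneg hC'0 (hr0 k)) (hpq' k))).1
    have h2 := mul_le_mul_of_nonneg_left h1 (hη k)
    have h3 := hrec k
    simp only [hDdef]
    linarith
  have hz' : ∃ l, Tendsto (fun K => ∑ k ∈ Finset.range K, (z k + L * C' * (η k * r k))) atTop
      (𝓝 l) := by
    obtain ⟨l, hl⟩ := hz
    refine ⟨_, (hl.add (hηr.mul_left (L * C')).hasSum.tendsto_sum_nat).congr fun K => ?_⟩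
    rw [Finset.sum_add_distrib]
  obtain ⟨⟨l, hl⟩, hfreq⟩ := quasiFejer (fun k => Finset.sum_nonneg fun i _ => hD0 k i) hgap0 hη
    hrec' hz' hsum
  have hl0 : l ≤ 0 := by
    refine le_of_forall_pos_le_add fun ε hε => ?_
    have hε' : 0 < ε / (n + 1) := by positivity
    choose ρ hρ0 hρ using fun i => bregman_small hm (hconv i) (hdiff i) (huP i).1 hε'
    obtain ⟨ρ', hρ'0, hρ'⟩ : ∃ d : ℝ, 0 < d ∧ ∀ i, d ≤ ρ i := by
      obtain ⟨i₀, hi₀⟩ := @Finite.exists_min (Fin n) ℝ _ ⟨i⟩ _ ρ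
      exact ⟨ρ i₀, hρ0 i₀, hi₀⟩
    obtain ⟨ε₁, hε₁, hclose⟩ := hu.exists_gap_lt hδ (half_pos hρ'0)
    have hr' : ∀ᶠ k in atTop, C' * r k < ρ' / 2 := by
      have := hr.const_mul C'
      rw [mul_zero] at this
      exact this.eventually_lt_const (half_pos hρ'0)
    have hf : ∃ᶠ k in atTop, D k ≤ ε := by
      refine ((hfreq ε₁ hε₁).and_eventually hr').mono ?_
      rintro k ⟨hk1, hk2⟩
      have h1 : ∀ i, bregman (h i) (shrunk (δ i)) (u i) (q k i) ≤ ε / (n + 1) := by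
        intro i
        refine (hρ i (q k i) (hq k i) (lt_of_lt_of_le ?_ (hρ' i))).le
        calc ‖q k i - u i‖ ≤ ‖q k i - p k i‖ + ‖p k i - u i‖ := norm_sub_le_norm_sub_add_norm_sub ..
          _ < ρ' / 2 + ρ' / 2 :=
              add_lt_add ((hpq' k i).trans_lt hk2) (hclose (p k) (hpP k) hk1 i)
          _ = ρ' := by ring
      calc D k ≤ ∑ _i : Fin n, ε / (n + 1) := Finset.sum_le_sum fun i _ => h1 i
        _ = n * (ε / (n + 1)) := by simp
        _ ≤ (n + 1) * (ε / (n + 1)) := by gcongr; linarith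
        _ = ε := by field_simp
    rw [zero_add]
    exact le_of_tendsto_of_frequently hl hf
  have hD : Tendsto D atTop (𝓝 0) := by
    have : l = 0 := le_antisymm hl0
      (ge_of_tendsto' hl fun k => Finset.sum_nonneg fun i _ => hD0 k i)
    rwa [this] at hl
  have hsq : Tendsto (fun k => ‖u i - q k i‖ ^ 2) atTop (𝓝 0) := by
    refine squeeze_zero (g := fun k => 2 / m * D k) (fun k => by positivity) (fun k => ?_) ?_
    · have h1 := le_bregman (hconv i) (hdiff i) (huP i).1 (hq k i)
      have h2 : bregman (h i) (shrunk (δ i)) (u i) (q k i) ≤ D k :=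
        Finset.single_le_sum (f := fun i => bregman (h i) (shrunk (δ i)) (u i) (q k i))
          (fun i _ => hD0 k i) (Finset.mem_univ i)
      rw [div_mul_eq_mul_div, le_div_iff₀ hm]
      linarith
    · simpa using hD.const_mul (2 / m)
  rw [tendsto_iff_norm_sub_tendsto_zero]
  have h1 := (Real.continuous_sqrt.tendsto 0).comp hsq
  rw [Real.sqrt_zero] at h1
  refine h1.congr fun k => ?_
  simp only [Function.comp_apply]
  rw [Real.sqrt_sq (norm_nonneg _), norm_sub_rev]

end Gradient

/-! ### Almost sure convergence of the algorithm -/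

section StepSizes

theorem sum_Icc_one_eq_sum_range (η : ℕ → ℝ) (K : ℕ) :
    ∑ k ∈ Finset.Icc 1 K, η k = ∑ k ∈ Finset.range K, η (k + 1) := by
  induction K with
  | zero => simp
  | succ K ih => rw [Finset.sum_Icc_succ_top (by omega), ih, Finset.sum_range_succ]

/-- After a negative step the partial sums could not increase any more. -/
theorem nonneg_of_antitoneOn {η : ℕ → ℝ} (hη : AntitoneOn η (Set.Ici 1))
    (hsum : Tendsto (fun K : ℕ => ∑ k ∈ Finset.Icc 1 K, η k) atTop atTop) {k : ℕ} (hk : 1 ≤ k) :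
    0 ≤ η k := by
  by_contra! hneg
  have h1 : ∀ K ≥ k, ∑ j ∈ Finset.Icc 1 K, η j ≤ ∑ j ∈ Finset.Icc 1 k, η j := by
    intro K hK
    induction K, hK using Nat.le_induction with
    | base => exact le_rfl
    | succ K hK ih =>
      rw [Finset.sum_Icc_succ_top (by omega)]
      have h2 : η (K + 1) ≤ η k := hη hk (show 1 ≤ K + 1 by omega) (by omega)
      linarith
  obtain ⟨K, h3, h4⟩ := ((hsum.eventually_gt_atTop (∑ j ∈ Finset.Icc 1 k, η j)).and
    (eventually_ge_atTop k)).exists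
  exact absurd (h1 K h4) (not_le.2 h3)

theorem sum_range_shift (f : ℕ → ℝ) (K J : ℕ) : ∑ j ∈ Finset.range J, f (j + K) =
    ∑ k ∈ Finset.range (J + K), f k - ∑ k ∈ Finset.range K, f k := by
  rw [add_comm J K, Finset.sum_range_add]
  simp only [add_comm K]
  ring

theorem exists_tendsto_sum_shift {f : ℕ → ℝ} (K : ℕ)
    (h : ∃ c, Tendsto (fun J => ∑ k ∈ Finset.range J, f k) atTop (𝓝 c)) :
    ∃ c, Tendsto (fun J => ∑ j ∈ Finset.range J, f (j + K)) atTop (𝓝 c) := by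
  obtain ⟨c, hc⟩ := h
  refine ⟨_, (((tendsto_add_atTop_iff_nat K).2 hc).sub_const
    (∑ k ∈ Finset.range K, f k)).congr fun J => ?_⟩
  rw [sum_range_shift]

theorem sqrt_log_div_le {k : ℕ} (hk : 1 ≤ k) : Real.sqrt (Real.log k / k) ≤
    2 * Real.sqrt (Real.log (k + 1 : ℕ) / (k + 1 : ℕ)) := by
  have hk' : (1 : ℝ) ≤ k := by exact_mod_cast hk
  have h4 : (2 : ℝ) = Real.sqrt 4 := by
    rw [show (4 : ℝ) = 2 ^ 2 by norm_num, Real.sqrt_sq (by norm_num)]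
  rw [h4, ← Real.sqrt_mul (by norm_num)]
  refine Real.sqrt_le_sqrt ?_
  push_cast
  have h1 : Real.log k ≤ Real.log (k + 1) := Real.log_le_log (by linarith) (by linarith)
  have h0 : 0 ≤ Real.log k := Real.log_nonneg hk'
  rw [← mul_div_assoc, div_le_div_iff₀ (by linarith) (by linarith)]
  calc Real.log k * (k + 1) ≤ Real.log (k + 1) * (4 * k) := by gcongr <;> linarith
    _ = _ := by ring

/-- The mixing error after the warm-up is at most `k⁻²`, which is negligible against the radius of
the confidence sets. -/
theorem exp_pow_ceil_le {τ : ℝ} (hτ : 0 < τ) {k : ℕ} (hk : 3 ≤ k) :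
    Real.exp (-1 / τ) ^ ⌈2 * τ * Real.log k⌉₊ ≤ Real.sqrt (Real.log k / k) := by
  have hk' : (3 : ℝ) ≤ k := by exact_mod_cast hk
  have hlog : 1 ≤ Real.log k := by
    rw [Real.le_log_iff_exp_le (by linarith)]
    exact Real.exp_one_lt_three.le.trans hk'
  have h1 : Real.exp (-1 / τ) ^ ⌈2 * τ * Real.log k⌉₊ ≤ ((k : ℝ) ^ 2)⁻¹ := by
    rw [← Real.exp_nat_mul, ← Real.exp_log (show (0 : ℝ) < ((k : ℝ) ^ 2)⁻¹ by positivity),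
      Real.log_inv, Real.log_pow]
    refine Real.exp_le_exp.2 ?_
    have h2 := Nat.le_ceil (2 * τ * Real.log k)
    have h3 : 2 * τ * Real.log k * (1 / τ) = 2 * Real.log k := by field_simp
    have h4 := mul_le_mul_of_nonneg_right h2 (show 0 ≤ 1 / τ by positivity)
    push_cast
    rw [h3] at h4
    rw [neg_div, mul_neg]
    linarith
  refine h1.trans (Real.le_sqrt_of_sq_le ?_)
  have h5 : ((k : ℝ) ^ 2)⁻¹ ^ 2 ≤ 1 / k := by
    rw [← inv_pow, ← pow_mul, one_div, inv_pow]
    exact inv_anti₀ (by linarith) (le_self_pow₀ (by linarith) (by norm_num))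
  refine h5.trans ?_
  gcongr

end StepSizes

section Convergence

variable {n : ℕ} {S A : Fin n → Type*} [∀ i, Fintype (S i)] [∀ i, Fintype (A i)]
  {G : Game n S A} {θ : AlgParams n S A} (hδ : ∀ i, 0 < θ.δ i)
  (hne : ∀ i, (shrunk (θ.δ i) : Set (S i → A i → S i → ℝ)).Nonempty)
  {x : ℕ → (∀ i, S i) × (∀ i, A i)}

include hδ hne in
/-- Convergence of the occupancy measures along a path on which all episodes are finite, the
confidence sets do not go wrong, and the noise is summable. -/
theorem Game.tendsto_qhatAt {τ : ℝ} (hτ : 0 < τ)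
    (hc : ∀ i, Contracts (G.P i) (Real.exp (-1 / τ)))
    {u : ∀ j, S j → A j → S j → ℝ} (hu : G.IsGloballyStableNash θ.δ u) {m : ℝ} (hm : 0 < m)
    (hconv : ∀ i, StrongConvexOn (shrunk (θ.δ i)) m (θ.h i))
    (hdiff : ∀ i, DifferentiableOn ℝ (θ.h i) (shrunk (θ.δ i)))
    (hη : AntitoneOn θ.η (Set.Ici 1))
    (hη_sum : Tendsto (fun K : ℕ => ∑ k ∈ Finset.Icc 1 K, θ.η k) atTop atTop)
    (hη_sq : Summable (fun k : ℕ => θ.η (k + 1) ^ 2))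
    (hη_log : Summable
      (fun k : ℕ => θ.η (k + 1) * Real.sqrt (Real.log ((k : ℝ) + 1) / ((k : ℝ) + 1))))
    (hd : ∀ k, θ.d k = 2 * τ * Real.log k)
    (hall : ∀ k ≥ 1, ∃ t, (G.algState θ x t).episode = k)
    (hconf : ∃ C : ℝ, 0 ≤ C ∧ ∀ᶠ k in atTop, ∀ i, G.P i ∈ G.confSetAt θ x (k + 1) i ∧
      ∀ s a s', |G.qhatAt θ x (k + 1) i s a s' -
        rho (G.qhatAt θ x (k + 1) i) s a * G.P i s a s'| ≤ C * Real.sqrt (Real.log k / k))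
    (hnoise : ∃ c, Tendsto (fun K => ∑ k ∈ Finset.range K, θ.η (k + 1) *
      ∑ i, pairR (G.rewardAt θ x (k + 1) i - G.expRewardAt θ x (k + 1) i)
        (u i - G.qhatAt θ x (k + 1) i)) atTop (𝓝 c)) (i : Fin n) :
    Tendsto (fun k => G.qhatAt θ x k i) atTop (𝓝 (u i)) := by
  have huP : ∀ j, u j ∈ shrunkOf (θ.δ j) (G.P j) := hu.1.1
  have hβ1 : Real.exp (-1 / τ) < 1 := by
    rw [Real.exp_lt_one_iff, neg_div]
    exact neg_neg_of_pos (by positivity)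
  obtain ⟨mb, w, hw0, hw1, hw⟩ := Game.exists_block hδ (Real.exp_pos _).le hβ1 hc
    fun j => ⟨u j, huP j⟩
  obtain ⟨Cv, hCv0, hCv⟩ := G.exists_value_estimate hδ (Real.exp_pos _).le hβ1 hc hw1 hw
  obtain ⟨C, hC0, hconf⟩ := hconf
  obtain ⟨K₀, hK₀⟩ := eventually_atTop.1 hconf
  set K := max K₀ 3 with hK
  have hKK : K₀ ≤ K := le_max_left _ _
  have hK3 : 3 ≤ K := le_max_right _ _
  have hη0 : ∀ j, 0 ≤ θ.η (j + K + 1) := fun j =>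
    nonneg_of_antitoneOn hη hη_sum (by omega)
  set ρ : ℕ → ℝ := fun j => Real.sqrt (Real.log (j + K + 1 : ℕ) / (j + K + 1 : ℕ)) with hρ
  have hρ0 : ∀ j, 0 ≤ ρ j := fun j => Real.sqrt_nonneg _
  have hq : ∀ k j, G.qhatAt θ x k j ∈ shrunk (θ.δ j) := fun k j =>
    (Game.algState_valid hδ hne x _).qhat_mem j
  have hqr : ∀ k j s a s', |G.qhatAt θ x (k + K + 1) j s a s' -
      rho (G.qhatAt θ x (k + K + 1) j) s a * G.P j s a s'| ≤ 2 * C * ρ k := by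
    intro k j s a s'
    refine ((hK₀ (k + K) (by omega) j).2 s a s').trans ?_
    have h1 := mul_le_mul_of_nonneg_left (sqrt_log_div_le (k := k + K) (by omega)) hC0
    simp only [hρ]
    linarith
  set N : ℝ := ∑ i, (Fintype.card (S i) * (Fintype.card (A i) * Fintype.card (S i)) : ℝ) with hN
  have hN0 : 0 ≤ N := Finset.sum_nonneg fun i _ => by positivity
  set c : ℝ := ∑ i, (Fintype.card (S i) * (Fintype.card (A i) * Fintype.card (S i)) : ℝ) ^ 2 /
    (2 * m) with hcdef
  set ζ : ℕ → ℝ := fun k => ∑ i, pairR (G.rewardAt θ x k i - G.expRewardAt θ x k i)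
    (u i - G.qhatAt θ x k i) with hζ
  have hηρ : Summable fun j => θ.η (j + K + 1) * ρ j := by
    refine ((summable_nat_add_iff K).2 hη_log).congr fun j => ?_
    simp only [hρ]
    push_cast
    rfl
  -- replacing the recorded rewards by the payoff gradient
  have hgap : ∀ k, |∑ i, pairR (G.rewardAt θ x (k + K + 1) i) (u i - G.qhatAt θ x (k + K + 1) i) -
      ζ (k + K + 1) - G.gap u (G.qhatAt θ x (k + K + 1))| ≤ N * (Cv * (1 + 2 * C)) * ρ k := by
    intro k
    have h1 : ∑ i, pairR (G.rewardAt θ x (k + K + 1) i) (u i - G.qhatAt θ x (k + K + 1) i) -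
        ζ (k + K + 1) - G.gap u (G.qhatAt θ x (k + K + 1)) =
        ∑ i, pairR (G.expRewardAt θ x (k + K + 1) i - G.gradR i (G.qhatAt θ x (k + K + 1)))
          (u i - G.qhatAt θ x (k + K + 1) i) := by
      simp only [hζ, Game.gap, pairR_sub_left, Finset.sum_sub_distrib]
      ring
    rw [h1, hN, Finset.sum_mul, Finset.sum_mul]
    refine (Finset.abs_sum_le_sum_abs _ _).trans (Finset.sum_le_sum fun i _ => ?_)
    have h2 : ∀ s a, |(G.expRewardAt θ x (k + K + 1) i -
        G.gradR i (G.qhatAt θ x (k + K + 1))) s a| ≤ Cv * (1 + 2 * C) * ρ k := by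
      intro s a
      refine (hCv (G.qhatAt θ x (k + K + 1)) (hq _) (2 * C * ρ k)
        (mul_nonneg (by positivity) (hρ0 k)) (hqr k) (θ.warmup (k + K + 1)) i s a s _).trans ?_
      have h3 := exp_pow_ceil_le hτ (k := k + K + 1) (by omega)
      rw [← hd] at h3
      have h4 : Real.exp (-1 / τ) ^ θ.warmup (k + K + 1) ≤ ρ k := h3
      calc Cv * (Real.exp (-1 / τ) ^ θ.warmup (k + K + 1) + 2 * C * ρ k)
          ≤ Cv * (ρ k + 2 * C * ρ k) := by gcongr
        _ = _ := by ring
    refine (abs_pairR_le h2 _).trans ?_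
    have h5 := hρ0 k
    refine (mul_le_of_le_one_right (by positivity)
      (norm_sub_le_one (huP i).1.1 (hq _ i).1)).trans (le_of_eq (by ring))
  have hshift : Tendsto (fun k => G.qhatAt θ x (k + K + 1) i) atTop (𝓝 (u i)) := by
    refine hu.tendsto_of_recursion hδ hm hconv hdiff
      (q := fun k => G.qhatAt θ x (k + K + 1)) (fun k j => hq _ j) (r := fun k => 2 * C * ρ k)
      (fun k => mul_nonneg (by positivity) (hρ0 k)) ?_ hqr
      (η := fun k => θ.η (k + K + 1))
      (z := fun k => -(θ.η (k + K + 1) * ζ (k + K + 1)) + (c * θ.η (k + K + 1) ^ 2 +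
        N * (Cv * (1 + 2 * C)) * (θ.η (k + K + 1) * ρ k))) hη0 ?_ (fun k => ?_) ?_ ?_ i
    · have h1 : Tendsto ρ atTop (𝓝 0) := by
        have := (tendsto_add_atTop_iff_nat (K + 1)).2 tendsto_sqrt_log_div
        exact this
      simpa using h1.const_mul (2 * C)
    · refine (hηρ.mul_left (2 * C)).congr fun k => ?_
      ring
    · have h1 : ∀ i, bregman (θ.h i) (shrunk (θ.δ i)) (u i) (G.qhatAt θ x (k + 1 + K + 1) i) ≤
          bregman (θ.h i) (shrunk (θ.δ i)) (u i) (G.qhatAt θ x (k + K + 1) i) -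
          θ.η (k + K + 1) * pairR (G.rewardAt θ x (k + K + 1) i)
            (u i - G.qhatAt θ x (k + K + 1) i) + θ.η (k + K + 1) ^ 2 *
          ((Fintype.card (S i) * (Fintype.card (A i) * Fintype.card (S i)) : ℝ) ^ 2 /
            (2 * m)) := by
        intro i
        rw [show k + 1 + K + 1 = k + K + 1 + 1 by ring]
        exact Game.bregman_qhatAt_le hδ hne hm hconv hdiff hall (by omega)
          (hK₀ (k + K + 1) (by omega) i).1 (huP i)
      have h2 := Finset.sum_le_sum fun i (_ : i ∈ Finset.univ) => h1 i
      rw [Finset.sum_add_distrib, Finset.sum_sub_distrib, ← Finset.mul_sum, ← Finset.mul_sum,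
        ← hcdef] at h2
      have h3 := mul_le_mul_of_nonneg_left (abs_le.1 (hgap k)).1 (hη0 k)
      refine h2.trans ?_
      linarith
    · have hn := exists_tendsto_sum_shift K hnoise
      obtain ⟨l, hl⟩ := hn
      have h1 := (((summable_nat_add_iff K).2 hη_sq).mul_left c).add
        (hηρ.mul_left (N * (Cv * (1 + 2 * C))))
      refine ⟨_, (hl.neg.add h1.hasSum.tendsto_sum_nat).congr fun J => ?_⟩
      rw [← Finset.sum_neg_distrib, ← Finset.sum_add_distrib]
    · have h1 : Tendsto (fun J => ∑ k ∈ Finset.range J, θ.η (k + 1)) atTop atTop :=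
        hη_sum.congr fun J => sum_Icc_one_eq_sum_range θ.η J
      have h2 := (tendsto_add_atTop_iff_nat K).2 h1
      refine (tendsto_atTop_add_const_right _ (-∑ k ∈ Finset.range K, θ.η (k + 1)) h2).congr
        fun J => ?_
      rw [← sub_eq_add_neg, ← sum_range_shift (fun k => θ.η (k + 1)) K J]
  exact (tendsto_add_atTop_iff_nat (K + 1)).1 hshift

/-- The induced policy depends continuously on the occupancy measure. -/
theorem tendsto_inducedPolicy {S A : Type*} [Fintype S] [Fintype A] {δ : ℝ} (hδ : 0 < δ)
    {q : ℕ → S → A → S → ℝ} {p : S → A → S → ℝ} (hp : p ∈ shrunk δ)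
    (hq : Tendsto q atTop (𝓝 p)) :
    Tendsto (fun k => inducedPolicy (q k)) atTop (𝓝 (inducedPolicy p)) := by
  rw [tendsto_pi_nhds]
  intro s
  rw [tendsto_pi_nhds]
  intro a
  have hrho : ∀ a, Tendsto (fun k => rho (q k) s a) atTop (𝓝 (rho p s a)) := fun a =>
    ((continuous_rho s a).tendsto p).comp hq
  exact (hrho a).div (tendsto_finsetSum _ fun a _ => hrho a) (sum_rho_pos hδ hp s).ne'

variable {Ω : Type*} [MeasurableSpace Ω] {μ : Measure Ω} [IsProbabilityMeasure μ]
  {X : ℕ → Ω → (∀ i, S i) × (∀ i, A i)}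

/-- Almost surely all episodes are finite and the policies converge. -/
theorem Game.IsPlay.ae_tendsto_episodePolicy (hX : G.IsPlay (G.algPolicy θ) μ X)
    (hδ : ∀ i, 0 < θ.δ i) {τ : ℝ} (hτ : 0 < τ)
    (hc : ∀ i, Contracts (G.P i) (Real.exp (-1 / τ)))
    {u : ∀ j, S j → A j → S j → ℝ} (hu : G.IsGloballyStableNash θ.δ u) {m : ℝ} (hm : 0 < m)
    (hconv : ∀ i, StrongConvexOn (shrunk (θ.δ i)) m (θ.h i))
    (hdiff : ∀ i, DifferentiableOn ℝ (θ.h i) (shrunk (θ.δ i)))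
    (hη : AntitoneOn θ.η (Set.Ici 1))
    (hη_sum : Tendsto (fun K : ℕ => ∑ k ∈ Finset.Icc 1 K, θ.η k) atTop atTop)
    (hη_sq : Summable (fun k : ℕ => θ.η (k + 1) ^ 2))
    (hη_log : Summable
      (fun k : ℕ => θ.η (k + 1) * Real.sqrt (Real.log ((k : ℝ) + 1) / ((k : ℝ) + 1))))
    (hd : ∀ k, θ.d k = 2 * τ * Real.log k) {γ : ℝ} (hγ : γ ∈ Set.Ioo (0 : ℝ) 1)
    (hrad : ∀ i k N, θ.rad i k N = Real.sqrt
      ((Real.log (2 * (n : ℝ) * (k : ℝ) ^ 2 * (Fintype.card (A i) : ℝ)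
        * (Fintype.card (S i) : ℝ) ^ 2) - Real.log γ) / (2 * max 1 (N : ℝ)))) :
    ∀ᵐ ω ∂μ, (∀ k ≥ 1, ∃ t, (G.algState θ (fun t => X t ω) t).episode = k) ∧
      Tendsto (fun k => G.episodePolicy θ (fun t => X t ω) k) atTop
        (𝓝 (fun i => inducedPolicy (u i))) := by
  have huP : ∀ j, u j ∈ shrunkOf (θ.δ j) (G.P j) := hu.1.1
  have hne : ∀ i, (shrunk (θ.δ i) : Set (S i → A i → S i → ℝ)).Nonempty := fun i =>
    ⟨u i, (huP i).1⟩
  have hneP : ∀ i, (shrunkOf (θ.δ i) (G.P i)).Nonempty := fun i => ⟨u i, huP i⟩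
  have hS : ∀ i, Nonempty (S i) := fun i => ⟨G.s0 i⟩
  have hA : ∀ i, Nonempty (A i) := by
    obtain ⟨a⟩ := exists_action μ X
    exact fun i => ⟨a i⟩
  have hβ1 : Real.exp (-1 / τ) < 1 := by
    rw [Real.exp_lt_one_iff, neg_div]
    exact neg_neg_of_pos (by positivity)
  filter_upwards [hX.ae_episodes hδ hne (Real.exp_pos _).le hβ1 hc hneP hτ hd,
    hX.ae_deviation_le hδ hne,
    hX.ae_exists_tendsto_noise hδ hne (fun j => (huP j).1.1) hη_sq] with ω h1 h2 h3
  refine ⟨h1.1, ?_⟩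
  have hbox := Game.eventually_mem_confBox hδ hne hγ hrad h1.1 h1.2 h2
  have hconf := Game.eventually_mem_confSet hδ hne hrad hneP hdiff h1.1 hbox
  have hnoise := Game.exists_tendsto_sum_noise hδ hne h1.1 h3
  rw [tendsto_pi_nhds]
  exact fun i => tendsto_inducedPolicy (hδ i) (huP i).1 (Game.tendsto_qhatAt hδ hne hτ hc hu hm hconv
    hdiff hη hη_sum hη_sq hη_log hd h1.1 hconf hnoise i)

end Convergence

/-! ### Existence of plays and of stationary distributions -/

section Existence

open Preorder ProbabilityTheory in
/-- Existence of Markov chains with a given initial distribution and given transition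
probabilities on a finite space. -/
theorem exists_markov_measure {E : Type*} [Fintype E] (p : E → ℝ) (hp : IsDistribution p)
    (K : E → E → ℝ) (hK : ∀ e, IsDistribution (K e)) :
    letI : MeasurableSpace (ℕ → E) := ⨆ t : ℕ, MeasurableSpace.comap (fun x => x t) ⊤
    ∃ μ : Measure (ℕ → E), IsProbabilityMeasure μ ∧ ∀ (t : ℕ) (x : ℕ → E),
      μ {y | ∀ l ≤ t, y l = x l} =
        ENNReal.ofReal (p (x 0) * ∏ l ∈ Finset.range t, K (x l) (x (l + 1))) := by
  classical
  let _ : MeasurableSpace E := ⊤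
  have hpmf : ∀ p : E → ℝ, IsDistribution p → ∑ e, ENNReal.ofReal (p e) = 1 := fun p hp => by
    rw [← ENNReal.ofReal_sum_of_nonneg fun e _ => hp.1 e, hp.2, ENNReal.ofReal_one]
  set μ₀ : Measure E := (PMF.ofFintype (fun e => ENNReal.ofReal (p e)) (hpmf p hp)).toMeasure
    with hμ₀
  set κ₀ : E → Measure E := fun e =>
    (PMF.ofFintype (fun e' => ENNReal.ofReal (K e e')) (hpmf (K e) (hK e))).toMeasure with hκ₀
  have hκ₀p : ∀ e, IsProbabilityMeasure (κ₀ e) := fun e => PMF.toMeasure.isProbabilityMeasure _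
  have hμ₀p : IsProbabilityMeasure μ₀ := PMF.toMeasure.isProbabilityMeasure _
  set κ : (t : ℕ) → Kernel (Π _ : Finset.Iic t, E) E := fun t =>
    Kernel.ofFunOfCountable fun y => κ₀ (y ⟨t, Finset.mem_Iic.2 le_rfl⟩) with hκ
  have hκp : ∀ t, IsMarkovKernel (κ t) := fun t => ⟨fun y => hκ₀p _⟩
  set μ : Measure (ℕ → E) := Kernel.trajMeasure (X := fun _ => E) μ₀ κ with hμ
  have hset : ∀ (t : ℕ) (x : ℕ → E), {y : ℕ → E | ∀ l ≤ t, y l = x l} =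
      frestrictLe (π := fun _ => E) t ⁻¹' {frestrictLe t x} := by
    intro t x
    ext y
    simp only [Set.mem_ofPred_eq, Set.mem_preimage, Set.mem_singleton_iff, funext_iff]
    exact ⟨fun h l => h l (Finset.mem_Iic.1 l.2), fun h l hl => h ⟨l, Finset.mem_Iic.2 hl⟩⟩
  refine ⟨μ, inferInstance, fun t x => ?_⟩
  induction t with
  | zero =>
    have h1 : μ.map (frestrictLe (π := fun _ => E) 0) =
        μ₀.map (MeasurableEquiv.piUnique fun _ : Finset.Iic 0 => E).symm := by
      rw [hμ, Kernel.trajMeasure, Measure.map_comp _ _ (by fun_prop), Kernel.traj_map_frestrictLe,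
        Kernel.partialTraj_self, Measure.id_comp]
    rw [hset, ← Measure.map_apply (by fun_prop) (measurableSet_singleton _), h1,
      Measure.map_apply (MeasurableEquiv.measurable _) (measurableSet_singleton _)]
    have h2 : (MeasurableEquiv.piUnique fun _ : Finset.Iic 0 => E).symm ⁻¹'
        {frestrictLe (π := fun _ => E) 0 x} = {x 0} := by
      ext e
      rw [Set.mem_preimage, Set.mem_singleton_iff, MeasurableEquiv.symm_apply_eq,
        Set.mem_singleton_iff]
      rfl
    rw [h2, hμ₀, PMF.toMeasure_apply_singleton _ _ (measurableSet_singleton _)]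
    simp
  | succ t ih =>
    have h1 : {y : ℕ → E | ∀ l ≤ t + 1, y l = x l} =
        (fun y : ℕ → E => (frestrictLe (π := fun _ => E) t y, y (t + 1))) ⁻¹'
          ({frestrictLe t x} ×ˢ {x (t + 1)}) := by
      have h2 : {y : ℕ → E | ∀ l ≤ t + 1, y l = x l} =
          {y | ∀ l ≤ t, y l = x l} ∩ {y | y (t + 1) = x (t + 1)} := by
        ext y
        constructor
        · exact fun h => ⟨fun l hl => h l (by omega), h (t + 1) le_rfl⟩
        · rintro ⟨h, h'⟩ l hl
          rcases Nat.le_succ_iff.1 hl with hl | rfl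
          · exact h l hl
          · exact h'
      rw [h2, hset]
      rfl
    rw [h1, ← Measure.map_apply (by fun_prop)
      ((measurableSet_singleton _).prod (measurableSet_singleton _)), hμ,
      ← Kernel.map_frestrictLe_trajMeasure_compProd_eq_map_trajMeasure,
      Measure.compProd_apply_prod (measurableSet_singleton _) (measurableSet_singleton _),
      ← hμ, lintegral_singleton, Measure.map_apply (by fun_prop) (measurableSet_singleton _),
      ← hset, ih]
    have h3 : κ t (frestrictLe t x) {x (t + 1)} = ENNReal.ofReal (K (x t) (x (t + 1))) :=
      PMF.toMeasure_apply_singleton _ _ (measurableSet_singleton _)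
    rw [h3, ← ENNReal.ofReal_mul ((hK _).1 _), Finset.prod_range_succ]
    congr 1
    ring

variable {n : ℕ} {S A : Fin n → Type*} [∀ i, Fintype (S i)] [∀ i, Fintype (A i)]
  (G : Game n S A) {π : ∀ i, S i → A i → ℝ} (hπ : ∀ i, IsStationaryPolicy (π i))

include hπ in
/-- The game can be played with stationary policies. -/
theorem Game.exists_isPlay :
    letI : MeasurableSpace (ℕ → (∀ i, S i) × (∀ i, A i)) := pathSpace S A
    ∃ μ : Measure (ℕ → (∀ i, S i) × (∀ i, A i)), IsProbabilityMeasure μ ∧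
      G.IsPlay (fun _ _ => π) μ (fun t x => x t) := by
  classical
  have hact : ∀ s : ∀ i, S i, ∑ a : ∀ i, A i, ∏ i, π i (s i) (a i) = 1 := fun s => by
    rw [← Fintype.prod_sum fun i a => π i (s i) a]
    exact Finset.prod_eq_one fun i _ => (hπ i (s i)).2
  have hact0 : ∀ (s : ∀ i, S i) (a : ∀ i, A i), 0 ≤ ∏ i, π i (s i) (a i) := fun s a =>
    Finset.prod_nonneg fun i _ => (hπ i (s i)).1 (a i)
  have hst : ∀ (s : ∀ i, S i) (a : ∀ i, A i),
      ∑ s' : ∀ i, S i, ∏ i, G.P i (s i) (a i) (s' i) = 1 := fun s a => by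
    rw [← Fintype.prod_sum fun i s' => G.P i (s i) (a i) s']
    exact Finset.prod_eq_one fun i _ => (G.P_isTransition i (s i) (a i)).2
  set p : (∀ i, S i) × (∀ i, A i) → ℝ := fun e =>
    (if e.1 = G.s0 then 1 else 0) * ∏ i, π i (e.1 i) (e.2 i) with hp
  set K : (∀ i, S i) × (∀ i, A i) → (∀ i, S i) × (∀ i, A i) → ℝ := fun e e' =>
    (∏ i, G.P i (e.1 i) (e.2 i) (e'.1 i)) * ∏ i, π i (e'.1 i) (e'.2 i) with hK
  obtain ⟨μ, hμ, hlaw⟩ := exists_markov_measure p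
    ⟨fun e => mul_nonneg (by split_ifs <;> norm_num) (hact0 _ _), by
      simp only [hp, Fintype.sum_prod_type]
      simpa using hact G.s0⟩ K
    fun e => ⟨fun e' => mul_nonneg
      (Finset.prod_nonneg fun i _ => (G.P_isTransition i _ _).1 _) (hact0 _ _), by
      simp only [hK, Fintype.sum_prod_type, ← Finset.mul_sum, hact, mul_one, hst]⟩
  let _ : MeasurableSpace (ℕ → (∀ i, S i) × (∀ i, A i)) := pathSpace S A
  refine ⟨μ, hμ, ⟨fun t z => ?_, fun t x => ?_⟩⟩
  · exact le_iSup (fun t : ℕ => MeasurableSpace.comap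
      (fun x : ℕ → (∀ i, S i) × (∀ i, A i) => x t) ⊤) t _ ⟨{z}, trivial, rfl⟩
  · rw [hlaw]
    congr 1
    simp only [hp, hK, Game.pathProb, Finset.prod_mul_distrib]
    rw [Finset.prod_range_succ' (fun l => ∏ i, π i ((x l).1 i) ((x l).2 i))]
    ac_rfl

end Existence

section Stationary

variable {S A : Type*} [Fintype S] [Fintype A]

/-- A contracting chain has a stationary distribution. -/
theorem Contracts.exists_stationary [Nonempty S] {P : S → A → S → ℝ} {β : ℝ} (hc : Contracts P β)
    (hβ0 : 0 ≤ β) (hβ1 : β < 1) (hP : IsTransition P) {π : S → A → ℝ}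
    (hπ : IsStationaryPolicy π) :
    ∃ ν : S → ℝ, IsDistribution ν ∧ push (inducedChain P π) ν = ν := by
  classical
  set s₀ : S := Classical.arbitrary S
  set f : ℕ → S → ℝ := fun t => (push (inducedChain P π))^[t] fun y => if y = s₀ then 1 else 0
    with hf
  have hfd : ∀ t, IsDistribution (f t) := fun t =>
    (isDistribution_single s₀).iterate_push hP hπ t
  have hfs : ∀ t, f (t + 1) = push (inducedChain P π) (f t) := fun t =>
    Function.iterate_succ_apply' _ _ _
  have hdist : ∀ t, ∑ s, |f t s - f (t + 1) s| ≤ 2 * β ^ t := by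
    intro t
    induction t with
    | zero => simpa using (hfd 0).l1_dist_le_two (hfd 1)
    | succ t ih =>
      have h1 := hc.push_dist_le hπ (hfd t) (hfd (t + 1))
      rw [← hfs, ← hfs] at h1
      refine h1.trans ((mul_le_mul_of_nonneg_left ih hβ0).trans (le_of_eq (by ring)))
  have hcauchy : CauchySeq f := cauchySeq_of_le_geometric β 2 hβ1 fun t => by
    rw [dist_pi_le_iff (by positivity)]
    intro s
    rw [Real.dist_eq]
    exact (Finset.single_le_sum (f := fun s => |f t s - f (t + 1) s|) (fun _ _ => abs_nonneg _)
      (Finset.mem_univ s)).trans (hdist t)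
  obtain ⟨ν, hν⟩ := cauchySeq_tendsto_of_complete hcauchy
  have hνs := tendsto_pi_nhds.1 hν
  refine ⟨ν, ⟨fun s => ge_of_tendsto' (hνs s) fun t => (hfd t).1 s, ?_⟩, ?_⟩
  · refine tendsto_nhds_unique (tendsto_finsetSum _ fun s _ => hνs s) ?_
    simp only [(hfd _).2]
    exact tendsto_const_nhds
  · refine tendsto_nhds_unique ?_ ((tendsto_add_atTop_iff_nat 1).2 hν)
    simp only [hfs]
    rw [tendsto_pi_nhds]
    exact fun s' => tendsto_finsetSum _ fun s _ => (hνs s).mul_const _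

end Stationary

/-! ### The ergodic theorem and the payoffs of stationary policies -/

section Kronecker

/-- Summation by parts: if `∑ a t / (t + 1)` converges, the averages of `a` tend to `0`. -/
theorem tendsto_average_zero {a M : ℕ → ℝ} (hM : ∀ t, M (t + 1) = M t + a t / (t + 1))
    {c : ℝ} (hc : Tendsto M atTop (𝓝 c)) :
    Tendsto (fun T : ℕ => (1 / (T : ℝ)) * ∑ t ∈ Finset.range T, a t) atTop (𝓝 0) := by
  have h1 : ∀ T : ℕ, ∑ t ∈ Finset.range T, a t = T * M T - ∑ t ∈ Finset.range T, M t := by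
    intro T
    induction T with
    | zero => simp
    | succ T ih =>
      rw [Finset.sum_range_succ, ih, Finset.sum_range_succ, hM]
      push_cast
      field_simp
      ring
  have h2 := hc.sub hc.cesaro
  rw [sub_self] at h2
  refine h2.congr' ?_
  filter_upwards [eventually_ge_atTop 1] with T hT
  have : (T : ℝ) ≠ 0 := by positivity
  rw [h1, one_div]
  field_simp

end Kronecker

section Ergodic

variable {n : ℕ} {S A : Fin n → Type*} [∀ i, Fintype (S i)] [∀ i, Fintype (A i)]
  (G : Game n S A) {π : ∀ i, S i → A i → ℝ} (hπ : ∀ i, IsStationaryPolicy (π i))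
  {ν : ∀ j, S j → ℝ} (hν : ∀ j, IsDistribution (ν j))
  (hνs : ∀ j, push (G.chains π j) (ν j) = ν j)

/-- Expected reward of player `i` in one step. -/
def Game.meanReward (G : Game n S A) (π : ∀ i, S i → A i → ℝ) (i : Fin n) (s : ∀ j, S j) : ℝ :=
  G.stepMean π s fun a _ => G.r i s a

include hπ in
theorem Game.meanReward_mem (i : Fin n) (s : ∀ j, S j) :
    G.meanReward π i s ∈ Set.Icc (0 : ℝ) 1 := by
  constructor
  · rw [← G.stepMean_const hπ s 0]
    exact G.stepMean_mono hπ fun a _ => (G.r_mem i s a).1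
  · rw [← G.stepMean_const hπ s 1]
    exact G.stepMean_mono hπ fun a _ => (G.r_mem i s a).2

include hπ hν hνs in
/-- The expectation of a function of the state converges geometrically to its mean under the product
of the stationary distributions. -/
theorem Game.abs_iterate_jointMean_sub_le {β : ℝ} (hβ0 : 0 ≤ β) (hβ1 : β < 1)
    (hc : ∀ j, Contracts (G.P j) β) {f : (∀ j, S j) → ℝ} (hf : ∀ s, f s ∈ Set.Icc (0 : ℝ) 1)
    (t : ℕ) (s : ∀ j, S j) :
    |(jointMean (G.chains π))^[t] f s - pairing ν f| ≤
      (Fintype.card (∀ j, S j) * (n * 2) : ℝ) * β ^ t := by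
  classical
  have hdist1 : ∀ j (α : S j → ℝ), IsDistribution α → ∀ y, |α y| ≤ 1 := fun j α hα y => by
    rw [abs_of_nonneg (hα.1 y)]; exact hα.le_one y
  rw [← pairing_single s ((jointMean (G.chains π))^[t] f), pairing_iterate_jointMean]
  refine (abs_pairing_sub_le (fun j => hdist1 j _ ?_) (fun j => hdist1 j _ (hν j))
    (fun s => by rw [abs_of_nonneg (hf s).1]; exact (hf s).2) (r := β ^ t * 2)
    fun j y => ?_).trans (le_of_eq (by ring))
  · exact (isDistribution_single (s j)).iterate_push (G.P_isTransition j) (hπ j) t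
  · refine (Finset.single_le_sum (f := fun y => |(push (G.chains π j))^[t]
      (fun y => if y = s j then 1 else 0) y - ν j y|) (fun _ _ => abs_nonneg _)
      (Finset.mem_univ y)).trans ?_
    have := (hc j).iterate_push_dist_le hβ0 hβ1 (G.P_isTransition j) (hπ j)
      (isDistribution_single (s j)) (hν j) (r := 0) (by
        change ∑ y, |push (G.chains π j) (ν j) y - ν j y| ≤ 0
        rw [hνs j]; simp) t
    rw [zero_div, add_zero] at this
    exact this

include hπ hν hνs in
/-- The Poisson equation: up to the constant `⟨ν, f⟩`, the function `f` is a coboundary. The solution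
is the sum over `t` of the differences between the expectation of `f` after `t` steps and `⟨ν, f⟩`. -/
theorem Game.exists_poisson {β : ℝ} (hβ0 : 0 ≤ β) (hβ1 : β < 1)
    (hc : ∀ j, Contracts (G.P j) β) {f : (∀ j, S j) → ℝ} (hf : ∀ s, f s ∈ Set.Icc (0 : ℝ) 1) :
    ∃ g : (∀ j, S j) → ℝ, ∀ s, f s + jointMean (G.chains π) g s = pairing ν f + g s := by
  set F : ℕ → (∀ j, S j) → ℝ := fun t s => (jointMean (G.chains π))^[t] f s - pairing ν f with hF
  have hsum : ∀ s, Summable fun t => F t s := fun s =>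
    Summable.of_norm_bounded
      ((summable_geometric_of_lt_one hβ0 hβ1).mul_left (Fintype.card (∀ j, S j) * (n * 2) : ℝ))
      fun t => G.abs_iterate_jointMean_sub_le hπ hν hνs hβ0 hβ1 hc hf t s
  have hconst : ∀ s c, jointMean (G.chains π) (fun _ => c) s = c := fun s c => by
    rw [← Game.stepMean_state, G.stepMean_const hπ]
  refine ⟨fun s => ∑' t, F t s, fun s => ?_⟩
  have h1 : jointMean (G.chains π) (fun s => ∑' t, F t s) s = ∑' t, F (t + 1) s := by
    unfold jointMean
    simp only [← tsum_mul_left]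
    rw [← Summable.tsum_finsetSum fun s' _ => (hsum s').mul_left _]
    refine tsum_congr fun t => ?_
    have h2 := hconst s (pairing ν f)
    unfold jointMean at h2
    simp only [hF, mul_sub, Finset.sum_sub_distrib, h2, Function.iterate_succ_apply']
    rfl
  dsimp only
  rw [h1, (hsum s).tsum_eq_zero_add]
  simp only [hF, Function.iterate_zero, id_eq]
  ring

variable {Ω : Type*} [MeasurableSpace Ω] {μ : Measure Ω} [IsProbabilityMeasure μ]
  {X : ℕ → Ω → (∀ i, S i) × (∀ i, A i)}

/-- The increments of the martingale in the proof of the ergodic theorem. -/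
def Game.centredReward (G : Game n S A) (i : Fin n) (g : (∀ j, S j) → ℝ) (v : ℝ) (s : ∀ j, S j)
    (a : ∀ j, A j) (s' : ∀ j, S j) : ℝ :=
  G.r i s a + g s' - v - g s

theorem sum_inv_sq_le (t : ℕ) :
    ∑ l ∈ Finset.range t, (1 / ((l : ℝ) + 1)) ^ 2 ≤ ∑' l : ℕ, (1 / ((l : ℝ) + 1)) ^ 2 := by
  have h1 : Summable fun l : ℕ => (1 / ((l : ℝ) + 1)) ^ 2 := by
    have := (summable_nat_add_iff 1).2 (Real.summable_one_div_nat_pow.2 one_lt_two)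
    refine this.congr fun l => ?_
    push_cast
    rw [one_div_pow]
  exact h1.sum_le_tsum _ fun l _ => sq_nonneg _

include hπ in
/-- The ergodic theorem for stationary play, given a solution of the Poisson equation. The centred
rewards, divided by the time, are the increments of an `L²`-bounded martingale, which therefore
converges; their averages tend to `0` by summation by parts. -/
theorem Game.IsPlay.ae_tendsto_average {G : Game n S A} (hX : G.IsPlay (fun _ _ => π) μ X)
    (i : Fin n) {g : (∀ j, S j) → ℝ} {v : ℝ}
    (hg : ∀ s, G.meanReward π i s + jointMean (G.chains π) g s = v + g s) :
    ∀ᵐ ω ∂μ, Tendsto (fun T : ℕ => (1 / (T : ℝ)) *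
      ∑ t ∈ Finset.range (T + 1), G.r i (X t ω).1 (X t ω).2) atTop (𝓝 v) := by
  have hna : ∀ t, PreDet t (fun _ : ℕ → (∀ i, S i) × (∀ i, A i) => π) := fun _ _ _ _ _ => rfl
  have hpol : ∀ (_ : ℕ → (∀ i, S i) × (∀ i, A i)) (_ : ℕ) i, IsStationaryPolicy (π i) :=
    fun _ _ => hπ
  have hmean : ∀ s, G.stepMean π s (G.centredReward i g v s) = 0 := by
    intro s
    have h1 := hg s
    rw [← Game.stepMean_state] at h1
    have h2 : G.stepMean π s (G.centredReward i g v s) = G.meanReward π i s +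
        G.stepMean π s (fun _ s' => g s') + (-v + -g s) := by
      unfold Game.centredReward Game.meanReward
      simp only [sub_eq_add_neg, Game.stepMean_add, G.stepMean_const hπ]
      ring
    rw [h2]
    linarith
  obtain ⟨B, hB0, hB⟩ : ∃ B : ℝ, 0 ≤ B ∧ ∀ s a s', |G.centredReward i g v s a s'| ≤ B := by
    refine ⟨∑ s, ∑ a, ∑ s', |G.centredReward i g v s a s'|,
      Finset.sum_nonneg fun _ _ => Finset.sum_nonneg fun _ _ => Finset.sum_nonneg fun _ _ =>
        abs_nonneg _, fun s a s' => ?_⟩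
    refine le_trans ?_ (Finset.single_le_sum
      (f := fun s => ∑ a, ∑ s', |G.centredReward i g v s a s'|)
      (fun _ _ => Finset.sum_nonneg fun _ _ => Finset.sum_nonneg fun _ _ => abs_nonneg _)
      (Finset.mem_univ s))
    refine le_trans ?_ (Finset.single_le_sum
      (f := fun a => ∑ s', |G.centredReward i g v s a s'|)
      (fun _ _ => Finset.sum_nonneg fun _ _ => abs_nonneg _) (Finset.mem_univ a))
    exact Finset.single_le_sum (f := fun s' => |G.centredReward i g v s a s'|)
      (fun _ _ => abs_nonneg _) (Finset.mem_univ s')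
  set M : ℕ → (ℕ → (∀ i, S i) × (∀ i, A i)) → ℝ := fun t x => ∑ l ∈ Finset.range t,
    G.centredReward i g v (x l).1 (x l).2 (x (l + 1)).1 / (l + 1) with hM
  have hMd : ∀ t, PreDet t (M t) := by
    intro t x y h1 h2
    refine Finset.sum_congr rfl fun l hl => ?_
    have hl := Finset.mem_range.1 hl
    have h4 : (x (l + 1)).1 = (y (l + 1)).1 := by
      rcases (Nat.succ_le_of_lt hl).eq_or_lt with h | h
      · rw [Nat.succ_eq_add_one] at h; rw [h]; exact h2
      · rw [h1 (l + 1) h]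
    rw [h1 l hl, h4]
  have hMext : ∀ t x a s', M (t + 1) (extPath x t a s') =
      M t x + 1 / ((t : ℝ) + 1) * G.centredReward i g v (x t).1 a s' := by
    intro t x a s'
    rw [← (hMd t).extPath le_rfl x a s']
    simp only [hM]
    rw [Finset.sum_range_succ]
    simp only [extPath_self, extPath_succ]
    ring
  have hMstep : ∀ t x, G.stepMean π (x t).1 (fun a s' => M (t + 1) (extPath x t a s')) = M t x := by
    intro t x
    simp only [hMext, Game.stepMean_add, Game.stepMean_const_mul, G.stepMean_const hπ]
    have := hmean (x t).1
    simp only [this, mul_zero, add_zero]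
  set Q : ℕ → ℝ := fun t => B ^ 2 * ∑ l ∈ Finset.range t, (1 / ((l : ℝ) + 1)) ^ 2 with hQ
  have hZd : ∀ t, PreDet t (fun x => M t x ^ 2 - Q t) := fun t x y h1 h2 => by
    simp only [hMd t x y h1 h2]
  have hZ : ∀ t, ∫ ω, (M t (fun l => X l ω) ^ 2 - Q t) ∂μ ≤ 0 := by
    intro t
    induction t with
    | zero => simp [hM, hQ]
    | succ t ih =>
      refine (hX.integral_succ_le hna hpol (hZd t) (hZd (t + 1)) fun x => ?_).trans ih
      have h1 : ∀ a s', M (t + 1) (extPath x t a s') ^ 2 - Q (t + 1) ≤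
          (M t x ^ 2 - Q t) + 2 * M t x * (1 / ((t : ℝ) + 1)) *
            G.centredReward i g v (x t).1 a s' := by
        intro a s'
        rw [hMext]
        have h2 : G.centredReward i g v (x t).1 a s' ^ 2 ≤ B ^ 2 :=
          sq_le_sq.2 ((hB _ _ _).trans (le_abs_self _))
        have h3 := mul_le_mul_of_nonneg_right h2 (sq_nonneg (1 / ((t : ℝ) + 1)))
        simp only [hQ, Finset.sum_range_succ]
        nlinarith
      refine (G.stepMean_mono hπ h1).trans (le_of_eq ?_)
      simp only [Game.stepMean_add, Game.stepMean_const_mul, G.stepMean_const hπ]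
      have := hmean (x t).1
      simp only [this, mul_zero, add_zero]
  have hL2 : ∀ t, ∫ ω, M t (fun l => X l ω) ^ 2 ∂μ ≤
      B ^ 2 * ∑' l : ℕ, (1 / ((l : ℝ) + 1)) ^ 2 := by
    intro t
    have hsq : PreDet t fun x => M t x ^ 2 := fun x y h3 h4 => by simp only [hMd t x y h3 h4]
    have h1 := hZ t
    rw [integral_sub (hX.integrable hsq) (integrable_const _)] at h1
    have h2 : Q t ≤ B ^ 2 * ∑' l : ℕ, (1 / ((l : ℝ) + 1)) ^ 2 :=
      mul_le_mul_of_nonneg_left (sum_inv_sq_le t) (sq_nonneg B)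
    have h3 : ∫ _ : Ω, Q t ∂μ = Q t := by simp
    linarith
  filter_upwards [hX.ae_exists_tendsto hna hpol hMd hMstep hL2] with ω hω
  obtain ⟨c, hc⟩ := hω
  set x : ℕ → (∀ i, S i) × (∀ i, A i) := fun l => X l ω with hx
  have havg := tendsto_average_zero
    (a := fun t => G.centredReward i g v (x t).1 (x t).2 (x (t + 1)).1)
    (M := fun t => M t x) (fun t => Finset.sum_range_succ _ _) hc
  have htel : ∀ T : ℕ, ∑ t ∈ Finset.range T,
      G.centredReward i g v (x t).1 (x t).2 (x (t + 1)).1 =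
      ∑ t ∈ Finset.range T, G.r i (x t).1 (x t).2 + (g (x T).1 - g (x 0).1) - T * v := by
    intro T
    induction T with
    | zero => simp
    | succ T ih =>
      rw [Finset.sum_range_succ, ih, Finset.sum_range_succ, Game.centredReward]
      push_cast
      ring
  obtain ⟨D, hD⟩ : ∃ D : ℝ, ∀ s, |g s| ≤ D := ⟨∑ s, |g s|, fun s =>
    Finset.single_le_sum (f := fun s => |g s|) (fun _ _ => abs_nonneg _) (Finset.mem_univ s)⟩
  have hrest : Tendsto (fun T : ℕ => (1 / (T : ℝ)) *
      (G.r i (x T).1 (x T).2 - (g (x T).1 - g (x 0).1))) atTop (𝓝 0) := by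
    refine squeeze_zero_norm (a := fun T : ℕ => (1 / (T : ℝ)) * (1 + (D + D))) (fun T => ?_) ?_
    · rw [norm_mul, Real.norm_of_nonneg (by positivity)]
      gcongr
      rw [Real.norm_eq_abs]
      refine (abs_sub _ _).trans (add_le_add ?_ ((abs_sub _ _).trans
        (add_le_add (hD _) (hD _))))
      have := G.r_mem i (x T).1 (x T).2
      rw [abs_of_nonneg this.1]
      exact this.2
    · have := tendsto_one_div_atTop_nhds_zero_nat (𝕜 := ℝ)
      simpa using this.mul_const (1 + (D + D))
  have hlim := (havg.add hrest).add_const v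
  rw [add_zero, zero_add] at hlim
  refine hlim.congr' ?_
  filter_upwards [eventually_ge_atTop 1] with T hT
  have hT0 : (T : ℝ) ≠ 0 := by positivity
  rw [htel, Finset.sum_range_succ]
  field_simp
  ring

end Ergodic

section Payoff

variable {n : ℕ} {S A : Fin n → Type*} [∀ i, Fintype (S i)] [∀ i, Fintype (A i)]
  {G : Game n S A}

/-- The payoff of stationary policies is the virtual payoff of their occupancy measures. -/
theorem Game.hasPayoff_virtualPayoff {β : ℝ} (hβ0 : 0 ≤ β) (hβ1 : β < 1)
    (hc : ∀ j, Contracts (G.P j) β) {π : ∀ i, S i → A i → ℝ}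
    (hπ : ∀ i, IsStationaryPolicy (π i)) {q : ∀ j, S j → A j → S j → ℝ}
    (hq : ∀ j, q j ∈ occPolytopeOf (G.P j))
    (hqπ : ∀ j s a, rho (q j) s a = (∑ a', rho (q j) s a') * π j s a) (i : Fin n) :
    G.HasPayoff π i (G.virtualPayoff i q) := by
  classical
  set ν : ∀ j, S j → ℝ := fun j s => ∑ a, rho (q j) s a with hν
  have hνd : ∀ j, IsDistribution (ν j) := fun j => isDistribution_sum_rho (hq j).1
  have hνs : ∀ j, push (G.chains π j) (ν j) = ν j := by
    intro j
    ext s'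
    have h1 : ν j s' = ∑ s, ∑ a, q j s a s' := ((hq j).1.2.2 s').symm
    rw [h1]
    unfold push Game.chains inducedChain
    refine Finset.sum_congr rfl fun s _ => ?_
    rw [Finset.mul_sum]
    refine Finset.sum_congr rfl fun a _ => ?_
    rw [(hq j).2, hqπ]
    ring
  obtain ⟨g, hg⟩ := G.exists_poisson hπ hνd hνs hβ0 hβ1 hc (G.meanReward_mem hπ i)
  have hv : pairing ν (G.meanReward π i) = G.virtualPayoff i q := by
    unfold pairing Game.virtualPayoff Game.meanReward Game.stepMean
    refine Finset.sum_congr rfl fun s _ => ?_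
    rw [Finset.mul_sum]
    refine Finset.sum_congr rfl fun a _ => ?_
    have h1 : ∏ j, ∑ s', q j (s j) (a j) s' = (∏ j, ν j (s j)) * ∏ j, π j (s j) (a j) := by
      rw [← Finset.prod_mul_distrib]
      exact Finset.prod_congr rfl fun j _ => hqπ j (s j) (a j)
    rw [h1, ← Finset.sum_mul]
    simp only [Game.stepProb, Finset.prod_mul_distrib, ← Finset.mul_sum]
    rw [← Fintype.prod_sum (fun j (y : S j) => G.P j (s j) (a j) y),
      Finset.prod_eq_one fun j _ => (G.P_isTransition j (s j) (a j)).2]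
    ring
  rw [hv] at hg
  obtain ⟨μ, hμ, hX⟩ := G.exists_isPlay hπ
  let _ : MeasurableSpace (ℕ → (∀ i, S i) × (∀ i, A i)) := pathSpace S A
  refine ⟨μ, hμ, hX, fun _ => G.virtualPayoff i q, ?_, integrable_const _, by simp⟩
  exact hX.ae_tendsto_average hπ i hg

/-- The policies of a Nash equilibrium of the constrained virtual game form an `ε`-Nash equilibrium
of the stochastic game: every unilateral deviation has an occupancy measure. -/
theorem Game.IsConstrainedNash.isEpsNash {β : ℝ} (hβ0 : 0 ≤ β) (hβ1 : β < 1)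
    (hc : ∀ j, Contracts (G.P j) β) {δ : Fin n → ℝ} (hδ : ∀ j, 0 < δ j) {ε : ℝ}
    (hloss : G.ShrunkLoss ε δ) {q : ∀ j, S j → A j → S j → ℝ} (hq : G.IsConstrainedNash δ q) :
    G.IsEpsNash ε fun i => inducedPolicy (q i) := by
  have hπ : ∀ i, IsStationaryPolicy (inducedPolicy (q i)) := fun i =>
    isStationaryPolicy_inducedPolicy (hδ i) (hq.1 i).1
  have hqP : ∀ j, q j ∈ occPolytopeOf (G.P j) := fun j =>
    mem_occPolytopeOf_of_mem_shrunkOf (hδ j) (hq.1 j)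
  have hqπ : ∀ j s a, rho (q j) s a = (∑ a', rho (q j) s a') * inducedPolicy (q j) s a :=
    fun j s a => (sum_mul_inducedPolicy (hδ j) (hq.1 j).1 s a).symm
  refine ⟨hπ, fun i => ⟨_, G.hasPayoff_virtualPayoff hβ0 hβ1 hc hπ hqP hqπ i, fun π' hπ' => ?_⟩⟩
  have : Nonempty (S i) := ⟨G.s0 i⟩
  obtain ⟨ν, hν, hνs⟩ := (hc i).exists_stationary hβ0 hβ1 (G.P_isTransition i) hπ'
  set p : S i → A i → S i → ℝ := fun s a s' => ν s * π' s a * G.P i s a s' with hp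
  have hrho : ∀ s a, rho p s a = ν s * π' s a := fun s a => by
    simp only [rho, hp, ← Finset.mul_sum, (G.P_isTransition i s a).2, mul_one]
  have hrho' : ∀ s, ∑ a, rho p s a = ν s := fun s => by
    simp only [hrho, ← Finset.mul_sum, (hπ' s).2, mul_one]
  have hp0 : ∀ s a s', 0 ≤ p s a s' := fun s a s' =>
    mul_nonneg (mul_nonneg (hν.1 s) ((hπ' s).1 a)) ((G.P_isTransition i s a).1 s')
  have hpsum : ∑ s, ∑ a, ∑ s', p s a s' = 1 := by
    rw [← hν.2]
    exact Finset.sum_congr rfl fun s _ => hrho' s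
  have hpP : p ∈ occPolytopeOf (G.P i) := by
    refine ⟨⟨fun s a s' => ⟨hp0 s a s', ?_⟩, hpsum, fun s' => ?_⟩, fun s a s' => by rw [hrho]⟩
    · rw [← hpsum]
      refine le_trans ?_ (Finset.single_le_sum (f := fun s => ∑ a, ∑ s', p s a s')
        (fun _ _ => Finset.sum_nonneg fun _ _ => Finset.sum_nonneg fun _ _ => hp0 _ _ _)
        (Finset.mem_univ s))
      refine le_trans ?_ (Finset.single_le_sum (f := fun a => ∑ s', p s a s')
        (fun _ _ => Finset.sum_nonneg fun _ _ => hp0 _ _ _) (Finset.mem_univ a))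
      exact Finset.single_le_sum (f := fun s' => p s a s') (fun _ _ => hp0 _ _ _)
        (Finset.mem_univ s')
    · have h1 : ∑ a, ∑ s, p s' a s = ν s' := hrho' s'
      rw [h1, ← congrFun hνs s']
      unfold push inducedChain
      refine Finset.sum_congr rfl fun s _ => ?_
      rw [Finset.mul_sum]
      exact Finset.sum_congr rfl fun a _ => by simp only [hp]; ring
  obtain ⟨p', hp', hle⟩ := hloss i q hqP p hpP
  refine ⟨G.virtualPayoff i (Function.update q i p), ?_, hle.trans (hq.2 i p' hp')⟩
  refine G.hasPayoff_virtualPayoff hβ0 hβ1 hc (fun j => ?_) (fun j => ?_) (fun j s a => ?_) i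
  · by_cases hj : j = i
    · subst hj; rw [Function.update_self]; exact hπ'
    · rw [Function.update_of_ne hj]; exact hπ j
  · by_cases hj : j = i
    · subst hj; rw [Function.update_self]; exact hpP
    · rw [Function.update_of_ne hj]; exact hqP j
  · by_cases hj : j = i
    · subst hj
      simp only [Function.update_self]
      rw [hrho', hrho]
    · simp only [Function.update_of_ne hj]
      exact hqπ j s a

end Payoff

end LearnGame

end

theorem theorem2 {n : ℕ} {S A : Fin n → Type*} [∀ i, Fintype (S i)] [∀ i, Fintype (A i)]
    (G : LearnGame.Game n S A)
    (τ : ℝ) (hτ : 0 < τ) (hmix : G.UniformlyMixing τ)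
    (ε : ℝ) (hε : 0 < ε)
    (δ : Fin n → ℝ) (hδ : ∀ i, δ i ∈ Set.Ioo (0 : ℝ) 1) (hshrunk : G.ShrunkLoss ε δ)
    (qs : ∀ i, S i → A i → S i → ℝ) (hqs : G.IsGloballyStableNash δ qs)
    (h : ∀ i, (S i → A i → S i → ℝ) → ℝ) (m : ℝ) (hm : 0 < m)
    (hconv : ∀ i, StrongConvexOn (LearnGame.shrunk (δ i)) m (h i))
    (hdiff : ∀ i, DifferentiableOn ℝ (h i) (LearnGame.shrunk (δ i)))
    (η : ℕ → ℝ) (hη : AntitoneOn η (Set.Ici 1))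
    (hη_sum : Tendsto (fun K : ℕ => ∑ k ∈ Finset.Icc 1 K, η k) atTop atTop)
    (hη_sq : Summable (fun k : ℕ => η (k + 1) ^ 2))
    (hη_log : Summable
      (fun k : ℕ => η (k + 1) * Real.sqrt (Real.log ((k : ℝ) + 1) / ((k : ℝ) + 1))))
    (γ : ℝ) (hγ : γ ∈ Set.Ioo (0 : ℝ) 1)
    (θ : LearnGame.AlgParams n S A)
    (hθ : θ =
      { δ := δ
        h := h
        η := η
        d := fun k => 2 * τ * Real.log (k : ℝ)
        rad := fun i k N => Real.sqrt
          ((Real.log (2 * (n : ℝ) * (k : ℝ) ^ 2 * (Fintype.card (A i) : ℝ)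
              * (Fintype.card (S i) : ℝ) ^ 2) - Real.log γ) / (2 * max 1 (N : ℝ))) })
    {Ω : Type*} [MeasurableSpace Ω] (μ : Measure Ω) [IsProbabilityMeasure μ]
    (X : ℕ → Ω → (∀ i, S i) × (∀ i, A i)) (hX : G.IsPlay (G.algPolicy θ) μ X) :
    G.IsEpsNash ε (fun i => LearnGame.inducedPolicy (qs i)) ∧
    ENNReal.ofReal (1 - γ) ≤
      μ {ω | (∀ k ≥ 1, ∃ t, (G.algState θ (fun t => X t ω) t).episode = k) ∧
        Tendsto (fun k => G.episodePolicy θ (fun t => X t ω) k) atTop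
          (𝓝 (fun i => LearnGame.inducedPolicy (qs i)))} := by
  subst hθ
  have hc : ∀ i, LearnGame.Contracts (G.P i) (Real.exp (-1 / τ)) := fun i => hmix i
  have hβ1 : Real.exp (-1 / τ) < 1 :=
    Real.exp_lt_one_iff.2 (div_neg_of_neg_of_pos (by norm_num) hτ)
  refine ⟨hqs.1.isEpsNash (Real.exp_pos _).le hβ1 hc (fun i => (hδ i).1) hshrunk, ?_⟩
  have hae := hX.ae_tendsto_episodePolicy (fun i => (hδ i).1) hτ hc hqs hm hconv hdiff hη hη_sum
    hη_sq hη_log (fun _ => rfl) hγ (fun _ _ _ => rfl)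
  refine (ENNReal.ofReal_le_one.2 (by linarith [hγ.1])).trans_eq ?_
  rw [← measure_univ (μ := μ)]
  exact (measure_congr (eventuallyEq_univ.2 hae)).symm
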